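/- Let $(\phi_t,r_t,\phi'_t)_{t\ge 0}$ be an i.i.d. sequence in $\mathbb{R}^k\times\mathbb{R}\times\mathbb{R}^k$ with uniformly bounded second moments, let $\gamma\in[0,1]$, $\eta>0$, and write $(\phi,r,\phi')$ for a generic sample. Assume that $\mathbb{E}[\phi(\phi-\gamma\phi')^\top]$ and $\mathbb{E}[\phi\phi^\top]$ are invertible. For $\theta\in\mathbb{R}^k$ put $\delta(\theta)=r+\theta^\top(\gamma\phi'-\phi)$ and let $$F(\theta)=\tfrac12\,\mathbb{E}[\delta(\theta)\phi]^\top\,\mathbb{E}[\phi\phi^\top]^{-1}\,\mathbb{E}[\delta(\theta)\phi]+\eta\|\theta\|_1$$ be the $\ell_1$-regularized mean squared projected Bellman error. Let $\Psi_\nu(x)=\operatorname{sgn}(x)\odot\max\{|x|-\nu,0\}$ (entrywise) be the soft thresholding operator. For step sizes $\alpha_t,\beta_t>0$ and arbitrary initial vectors $\theta_0,w_0\in\mathbb{R}^k$ let, with $\delta_t=r_t+\theta_t^\top(\gamma\phi'_t-\phi_t)$, $$\theta_{t+1}=\Psi_{\alpha_t\eta}(\theta_t-\alpha_t g_t),\qquad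 w_{t+1}=w_t+\beta_t(\delta_t-\phi_t^\top w_t)\phi_t,$$ where $g_t=(\phi_t^\top w_t)(\gamma\phi'_t-\phi_t)$ for the GTD2-IST algorithm and $g_t=\gamma(\phi_t^\top w_t)\phi'_t-\delta_t\phi_t$ for the TDC-IST algorithm. Assume that $\sum_t\alpha_t=\infty$ and that either $\beta_t=O(1/t)$, or $\sum_t\beta_t^2<\infty$ and the entries of $\phi\phi^\top$, $\phi\phi'^\top$ and $r\phi$ have finite second moments. Then $F$ has a unique global minimizer $\theta^*$ (the TD solution of the regularized problem), which does not depend on the step sizes or the initial vectors, and: (i) the GTD2-IST iterates $\theta_t$ converge to $\theta^*$ with probability one if $\alpha_t/\beta_t\to0$ or if $\beta_t=\kappa\alpha_t$ for all $t$ with a constant $\kappa>0$; (ii) the TDC-IST iterates $\theta_t$ converge to $\theta^*$ with probability one if $\alpha_t/\beta_t\to0$. -/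

import Mathlib

open MeasureTheory ProbabilityTheory Filter Topology
open scoped Matrix NNReal

noncomputable section

namespace GTDIST

/-- A sample `(φ, r, φ')`: current feature vector, reward, next feature vector. -/
abbrev Sample (k : ℕ) : Type := (Fin k → ℝ) × ℝ × (Fin k → ℝ)

/-- The TD error `δ(θ) = r + θᵀ (γ φ' - φ)`. -/
def tdError {k : ℕ} (γ : ℝ) (θ : Fin k → ℝ) (x : Sample k) : ℝ :=
  x.2.1 + θ ⬝ᵥ (γ • x.2.2 - x.1)

/-- The entrywise soft thresholding operator `sgn(x) ⊙ max{|x| - ν, 0}`. -/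
def softThreshold {k : ℕ} (ν : ℝ) (x : Fin k → ℝ) : Fin k → ℝ :=
  fun i => Real.sign (x i) * max (|x i| - ν) 0

/-- GTD2 stochastic gradient: `(φᵀ w) (γ φ' - φ)`. -/
def gtd2Grad {k : ℕ} (γ : ℝ) (_θ w : Fin k → ℝ) (x : Sample k) : Fin k → ℝ :=
  (x.1 ⬝ᵥ w) • (γ • x.2.2 - x.1)

/-- TDC stochastic gradient: `γ (φᵀ w) φ' - δ(θ) φ`. -/
def tdcGrad {k : ℕ} (γ : ℝ) (θ w : Fin k → ℝ) (x : Sample k) : Fin k → ℝ :=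
  (γ * (x.1 ⬝ᵥ w)) • x.2.2 - tdError γ θ x • x.1

/-- The pair of iterates `(θ_t, w_t)` of the soft-thresholded stochastic gradient algorithm with
stochastic gradient `grad`, along a realization `x` of the sample sequence:
`θ_{t+1} = Ψ_{α_t η} (θ_t - α_t grad_t)`, `w_{t+1} = w_t + β_t (δ_t - φ_tᵀ w_t) φ_t`. -/
def iterates {k : ℕ} (grad : (Fin k → ℝ) → (Fin k → ℝ) → Sample k → (Fin k → ℝ))
    (γ η : ℝ) (α β : ℕ → ℝ) (x : ℕ → Sample k) (θ₀ w₀ : Fin k → ℝ) :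
    ℕ → (Fin k → ℝ) × (Fin k → ℝ)
  | 0 => (θ₀, w₀)
  | t + 1 =>
    let p := iterates grad γ η α β x θ₀ w₀ t
    (softThreshold (α t * η) (p.1 - α t • grad p.1 p.2 (x t)),
      p.2 + (β t * (tdError γ p.1 (x t) - (x t).1 ⬝ᵥ p.2)) • (x t).1)

/-- The parameters `θ_t` of the GTD2-IST algorithm. -/
def gtd2IST {k : ℕ} (γ η : ℝ) (α β : ℕ → ℝ) (x : ℕ → Sample k) (θ₀ w₀ : Fin k → ℝ) (t : ℕ) :
    Fin k → ℝ :=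
  (iterates (gtd2Grad γ) γ η α β x θ₀ w₀ t).1

/-- The parameters `θ_t` of the TDC-IST algorithm. -/
def tdcIST {k : ℕ} (γ η : ℝ) (α β : ℕ → ℝ) (x : ℕ → Sample k) (θ₀ w₀ : Fin k → ℝ) (t : ℕ) :
    Fin k → ℝ :=
  (iterates (tdcGrad γ) γ η α β x θ₀ w₀ t).1

variable {Ω : Type*} [MeasurableSpace Ω] {k : ℕ}

/-- The matrix `E[φ φᵀ]`. -/
def featureCov (μ : Measure Ω) (X : Ω → Sample k) : Matrix (Fin k) (Fin k) ℝ :=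
  Matrix.of fun i j => ∫ ω, (X ω).1 i * (X ω).1 j ∂μ

/-- The matrix `E[φ (φ - γ φ')ᵀ]`. -/
def tdMatrix (μ : Measure Ω) (γ : ℝ) (X : Ω → Sample k) : Matrix (Fin k) (Fin k) ℝ :=
  Matrix.of fun i j => ∫ ω, (X ω).1 i * ((X ω).1 j - γ * (X ω).2.2 j) ∂μ

/-- The vector `E[δ(θ) φ]`. -/
def expectedTDUpdate (μ : Measure Ω) (γ : ℝ) (X : Ω → Sample k) (θ : Fin k → ℝ) : Fin k → ℝ :=
  fun i => ∫ ω, tdError γ θ (X ω) * (X ω).1 i ∂μ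

/-- The mean squared projected Bellman error
`J(θ) = ½ E[δ(θ) φ]ᵀ E[φ φᵀ]⁻¹ E[δ(θ) φ]`. -/
def mspbe (μ : Measure Ω) (γ : ℝ) (X : Ω → Sample k) (θ : Fin k → ℝ) : ℝ :=
  1 / 2 * (expectedTDUpdate μ γ X θ ⬝ᵥ ((featureCov μ X)⁻¹ *ᵥ expectedTDUpdate μ γ X θ))

/-- The `ℓ¹`-regularized MSPBE `F(θ) = J(θ) + η ‖θ‖₁`. -/
def regMSPBE (μ : Measure Ω) (γ η : ℝ) (X : Ω → Sample k) (θ : Fin k → ℝ) : ℝ :=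
  mspbe μ γ X θ + η * ∑ i, |θ i|

/-- `θ` is the TD solution of the regularized problem: the unique global minimizer of the
`ℓ¹`-regularized MSPBE. -/
def IsRegTDSolution (μ : Measure Ω) (γ η : ℝ) (X : Ω → Sample k) (θ : Fin k → ℝ) : Prop :=
  ∀ θ' : Fin k → ℝ, θ' ≠ θ → regMSPBE μ γ η X θ < regMSPBE μ γ η X θ'

/-- Uniformly bounded second moments of the sequence `(φ_t, r_t, φ'_t)`. -/
def UniformlyBoundedSecondMoments (μ : Measure Ω) (X : ℕ → Ω → Sample k) : Prop :=
  ∃ M : ℝ≥0, ∀ t,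
    eLpNorm (fun ω => (X t ω).1) 2 μ ≤ M ∧
    eLpNorm (fun ω => (X t ω).2.1) 2 μ ≤ M ∧
    eLpNorm (fun ω => (X t ω).2.2) 2 μ ≤ M

/-- All entries of `φ φᵀ`, `φ φ'ᵀ` and `r φ` have finite second moments. -/
def ProductsSquareIntegrable (μ : Measure Ω) (X : Ω → Sample k) : Prop :=
  (∀ i j, MemLp (fun ω => (X ω).1 i * (X ω).1 j) 2 μ) ∧
  (∀ i j, MemLp (fun ω => (X ω).1 i * (X ω).2.2 j) 2 μ) ∧
  (∀ i, MemLp (fun ω => (X ω).2.1 * (X ω).1 i) 2 μ)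

/-- Diminishing step sizes: `α_t, β_t > 0`, `∑ α_t = ∞`, and either `β_t = O(1/t)`, or
`∑ β_t² < ∞` when the products `φ φᵀ`, `φ φ'ᵀ`, `r φ` are square integrable. -/
def AdmissibleStepSizes (μ : Measure Ω) (X : Ω → Sample k) (α β : ℕ → ℝ) : Prop :=
  (∀ t, 0 < α t) ∧ (∀ t, 0 < β t) ∧ ¬ Summable α ∧
  ((∃ c : ℝ, ∀ t : ℕ, β t ≤ c / ((t : ℝ) + 1)) ∨
    (Summable (fun t => β t ^ 2) ∧ ProductsSquareIntegrable μ X))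

/-- The auxiliary iterate moves on the faster time scale: `α_t / β_t → 0`. -/
def TwoTimeScale (α β : ℕ → ℝ) : Prop :=
  Tendsto (fun t => α t / β t) atTop (𝓝 0)

/-- Both iterates move on the same time scale: `β_t = κ α_t` for a constant `κ > 0`. -/
def OneTimeScale (α β : ℕ → ℝ) : Prop :=
  ∃ κ : ℝ, 0 < κ ∧ ∀ t, β t = κ * α t

end GTDIST

end

/-!
Write `A = E[φ(φ - γφ')ᵀ]`, `C = E[φφᵀ]`, `d = E[rφ]`. Then `E[δ(θ)φ] = d - Aθ`, so the
regularized objective is a strictly convex quadratic plus `η‖·‖₁`, and its minimizer `θ*` is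
characterized by `Aᵀ w* ∈ η ∂‖·‖₁(θ*)` with `C w* = d - Aθ*` (`exists_regTDSolution`; existence is
Banach's fixed point theorem for the proximal gradient map, `exists_regularized_solution`).

Soft thresholding is the proximal map of the `ℓ¹` norm, so a step of the algorithm reads
`θ⁺ = θ - α (g + s)` with a bounded subgradient `s` at `θ⁺`, and monotonicity of the
subdifferential gives `⟨θ⁺ - θ*, s - Aᵀ w*⟩ ≥ 0`. Apart from measurability, the convergence proof
uses nothing else about the nonsmooth term.

Convergence is shown with the Lyapunov coordinates `L(θ, w) = (θ - θ*, √K (w - p + Gθ))`. On two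
time scales, `G = C⁻¹A` and `p = C⁻¹d`, so that the second coordinate is the displacement of `w`
from its equilibrium for frozen `θ`, which contracts at the fast rate `β`. On one time scale (GTD2
only), `K = α / β`, `G = εA` and `p = w* + εAθ*` with a small `ε`: for `ε = 0` the drift is a skew
symmetric part minus a multiple of `‖w - w*‖²`, and the cross term makes it negative definite. In
both cases the mean drift of `L` is at most `-α (c ‖L‖² - ρ)` with an error `ρ` that can be made
arbitrarily small compared with `c δ²` (`IsScheme.tendsto_of_twoTimeScale`,
`IsScheme.tendsto_of_oneTimeScale`). The squared distance of `L` to the ball of radius `δ` is then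
an almost-supermartingale, hence tends to zero almost surely (`tendsto_ball_of_drift`); finally
`δ → 0`.

If `β_t = O(1/t)` the samples need not have square integrable products. The argument is then
applied to the samples replaced by `0` when `‖φ‖² + r² + ‖φ'‖²` exceeds `t + N + 1`. The second
moments of the truncated products grow slowly enough to be summable against `1/t²`, the truncated
means have bounded variation in `t` (so `G` and `p` may depend on `t`), and almost surely, for
some `N`, no sample is truncated at all (`ae_exists_linear_bound`).
-/

namespace GTDIST

/-! ### Almost-supermartingales -/

/-- A form of the Robbins–Siegmund theorem: a nonnegative adapted process `D` with
`E[D (n + 1) | ℱ n] ≤ (1 + e n) D n + e n - a n D n`, where `∑ e n < ∞` and `∑ a n = ∞`, tends to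
zero almost surely. The conditional inequality is stated through integrals over `ℱ n`-measurable
sets. -/
theorem ae_tendsto_zero_of_almost_supermartingale {Ω : Type*} {m0 : MeasurableSpace Ω}
    {μ : Measure Ω} [IsProbabilityMeasure μ] (ℱ : Filtration ℕ m0) (D : ℕ → Ω → ℝ)
    (hadp : StronglyAdapted ℱ D) (hint : ∀ n, Integrable (D n) μ) (hD : ∀ n ω, 0 ≤ D n ω)
    (e a : ℕ → ℝ) (he : ∀ n, 0 ≤ e n) (hes : Summable e) (ha : ∀ n, 0 ≤ a n)
    (has : ¬ Summable a)
    (h : ∀ n s, MeasurableSet[ℱ n] s →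
      ∫ ω in s, D (n + 1) ω ∂μ ≤ ∫ ω in s, ((1 + e n) * D n ω + e n - a n * D n ω) ∂μ) :
    ∀ᵐ ω ∂μ, Tendsto (fun n => D n ω) atTop (𝓝 0) := by
  set P : ℕ → ℝ := fun n => ∏ i ∈ Finset.range n, (1 + e i) with hP
  have hP1 : ∀ n, 1 ≤ P n := fun n => by
    rw [hP]
    exact Finset.prod_induction _ (fun x => (1 : ℝ) ≤ x)
      (fun x y hx hy => one_le_mul_of_one_le_of_one_le hx hy) le_rfl
      (fun i _ => by linarith [he i])
  have hP0 : ∀ n, 0 < P n := fun n => one_pos.trans_le (hP1 n)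
  have hPs : ∀ n, P (n + 1) = P n * (1 + e n) := fun n => by
    simp only [hP, Finset.prod_range_succ]
  have hPmono : Monotone P := monotone_nat_of_le_succ fun n => by
    rw [hPs]; nlinarith [hP0 n, he n]
  have hPb : ∀ n, P n ≤ Real.exp (∑' i, e i) := fun n => by
    calc P n ≤ ∏ i ∈ Finset.range n, Real.exp (e i) := by
          refine Finset.prod_le_prod (fun i _ => by linarith [he i]) (fun i _ => ?_)
          linarith [Real.add_one_le_exp (e i)]
      _ = Real.exp (∑ i ∈ Finset.range n, e i) := (Real.exp_sum _ _).symm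
      _ ≤ _ := Real.exp_le_exp.2 (hes.sum_le_tsum _ (fun i _ => he i))
  have hPlim : Tendsto P atTop (𝓝 (⨆ n, P n)) :=
    tendsto_atTop_ciSup hPmono ⟨_, by rintro _ ⟨n, rfl⟩; exact hPb n⟩
  -- the one-step inequality with the integral on the right expanded
  have h' : ∀ n s, MeasurableSet[ℱ n] s →
      ∫ ω in s, D (n + 1) ω ∂μ ≤
        (1 + e n) * ∫ ω in s, D n ω ∂μ + e n * μ.real s - a n * ∫ ω in s, D n ω ∂μ := by
    intro n s hs
    refine (h n s hs).trans_eq ?_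
    have hi := (hint n).integrableOn (s := s)
    have hi1 : Integrable (fun ω => (1 + e n) * D n ω + e n) (μ.restrict s) :=
      (hi.const_mul _).add (integrable_const _)
    rw [integral_sub hi1 (hi.const_mul _),
      integral_add (hi.const_mul _) (integrable_const _), integral_const_mul, integral_const_mul,
      integral_const, smul_eq_mul, measureReal_restrict_apply_univ]
    ring
  have hDs0 : ∀ n (s : Set Ω), 0 ≤ ∫ ω in s, D n ω ∂μ := fun n s =>
    integral_nonneg fun ω => hD n ω
  -- normalising by the product turns `1 + D` into a supermartingale
  have hsub : Submartingale (fun n ω => -((1 + D n ω) * (P n)⁻¹)) ℱ μ := by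
    refine submartingale_of_setIntegral_le_succ (fun n => ?_) (fun n => ?_) fun n s hs => ?_
    · exact ((stronglyMeasurable_const.add (hadp n)).mul stronglyMeasurable_const).neg
    · exact (((integrable_const _).add (hint n)).mul_const _).neg
    · have hform : ∀ n, ∫ ω in s, -((1 + D n ω) * (P n)⁻¹) ∂μ
          = -((μ.real s + ∫ ω in s, D n ω ∂μ) * (P n)⁻¹) := by
        intro n
        rw [integral_neg, integral_mul_const, integral_add (integrable_const _)
          (hint n).integrableOn, integral_const, smul_eq_mul, mul_one,
          measureReal_restrict_apply_univ]
      rw [hform, hform, hPs, neg_le_neg_iff, mul_inv, ← mul_assoc]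
      have h1 := h' n s hs
      have h2 := hDs0 n s
      have h3 := mul_nonneg (ha n) h2
      have h4 : 0 < 1 + e n := by linarith [he n]
      rw [mul_right_comm]
      refine mul_le_mul_of_nonneg_right ?_ (inv_nonneg.2 (hP0 n).le)
      rw [← div_eq_mul_inv, div_le_iff₀ h4]
      nlinarith
  have hu : ∀ n, 1 + ∫ ω, D n ω ∂μ ≤ P n * (1 + ∫ ω, D 0 ω ∂μ) := by
    intro n
    induction n with
    | zero => simp [hP]
    | succ n ih =>
      have h1 := h' n Set.univ MeasurableSet.univ
      have h2 := hDs0 n Set.univ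
      simp only [Measure.restrict_univ, probReal_univ] at h1 h2
      have h3 := mul_nonneg (ha n) h2
      rw [hPs]
      nlinarith [he n]
  obtain ⟨M, hM⟩ : ∃ M, ∀ n, 1 + ∫ ω, D n ω ∂μ ≤ M :=
    ⟨_, fun n => (hu n).trans (mul_le_mul_of_nonneg_right (hPb n)
      (by have := hDs0 0 Set.univ; simp only [Measure.restrict_univ] at this; linarith))⟩
  have hbdd : ∀ n, eLpNorm (fun ω => -((1 + D n ω) * (P n)⁻¹)) 1 μ ≤ (Real.toNNReal M : ℝ≥0) := by
    intro n
    have hn : ∀ ω, 0 ≤ (1 + D n ω) * (P n)⁻¹ := fun ω =>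
      mul_nonneg (by linarith [hD n ω]) (inv_nonneg.2 (hP0 n).le)
    rw [eLpNorm_one_eq_lintegral_enorm]
    have : ∀ ω, ‖-((1 + D n ω) * (P n)⁻¹)‖ₑ = ENNReal.ofReal ((1 + D n ω) * (P n)⁻¹) := by
      intro ω
      rw [enorm_neg, Real.enorm_eq_ofReal (hn ω)]
    simp_rw [this]
    have hi1 : Integrable (fun ω => (1 + D n ω) * (P n)⁻¹) μ :=
      ((integrable_const _).add (hint n)).mul_const _
    rw [← ofReal_integral_eq_lintegral_ofReal hi1 (ae_of_all _ hn)]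
    refine ENNReal.ofReal_le_ofReal ?_
    rw [integral_mul_const, integral_add (integrable_const _) (hint n)]
    simp only [integral_const, probReal_univ, smul_eq_mul, mul_one]
    have h2 := hDs0 n Set.univ
    simp only [Measure.restrict_univ] at h2
    exact (mul_le_of_le_one_right (by linarith) (inv_le_one_of_one_le₀ (hP1 n))).trans (hM n)
  have hconv := hsub.exists_ae_tendsto_of_bdd hbdd
  -- summing the expectations of the recursion: the sum of `a n * D n` is finite in expectation,
  -- hence almost surely
  have hsum : ∀ n, ∑ i ∈ Finset.range n, a i * ∫ ω, D i ω ∂μ ≤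
      (∫ ω, D 0 ω ∂μ) + M * (∑ i ∈ Finset.range n, e i) - ∫ ω, D n ω ∂μ := by
    intro n
    induction n with
    | zero => simp
    | succ n ih =>
      have h1 := h' n Set.univ MeasurableSet.univ
      simp only [Measure.restrict_univ, probReal_univ] at h1
      rw [Finset.sum_range_succ, Finset.sum_range_succ]
      have := mul_le_mul_of_nonneg_left (hM n) (he n)
      nlinarith
  have hM0 : 0 ≤ M := by
    have := hM 0
    have h2 := hDs0 0 Set.univ
    simp only [Measure.restrict_univ] at h2
    linarith
  have hsumm : Summable fun i => a i * ∫ ω, D i ω ∂μ := by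
    have hnn : ∀ i, 0 ≤ ∫ ω, D i ω ∂μ := fun i => by
      have h2 := hDs0 i Set.univ
      simpa only [Measure.restrict_univ] using h2
    refine summable_of_sum_range_le (c := (∫ ω, D 0 ω ∂μ) + M * ∑' i, e i)
      (fun i => mul_nonneg (ha i) (hnn i)) fun n => ?_
    have := mul_le_mul_of_nonneg_left (hes.sum_le_tsum (Finset.range n) (fun i _ => he i)) hM0
    linarith [hsum n, hnn n]
  have hae : ∀ᵐ ω ∂μ, Summable fun i => a i * D i ω := by
    have hlt : ∫⁻ ω, ∑' i, ENNReal.ofReal (a i * D i ω) ∂μ ≠ ⊤ := by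
      rw [lintegral_tsum fun i => ((hint i).1.aemeasurable.const_mul _).ennreal_ofReal]
      have : ∀ i, ∫⁻ ω, ENNReal.ofReal (a i * D i ω) ∂μ
          = ENNReal.ofReal (a i * ∫ ω, D i ω ∂μ) := by
        intro i
        rw [← ofReal_integral_eq_lintegral_ofReal ((hint i).const_mul _)
          (ae_of_all _ fun ω => mul_nonneg (ha i) (hD i ω)), integral_const_mul]
      simp_rw [this]
      exact hsumm.tsum_ofReal_ne_top
    have hmeas : AEMeasurable (fun ω => ∑' i, ENNReal.ofReal (a i * D i ω)) μ :=
      AEMeasurable.tsum fun i => ((hint i).1.aemeasurable.const_mul _).ennreal_ofReal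
    filter_upwards [ae_lt_top' hmeas hlt] with ω hω
    have h1 := ENNReal.summable_toReal hω.ne
    refine h1.congr fun i => ?_
    rw [ENNReal.toReal_ofReal (mul_nonneg (ha i) (hD i ω))]
  filter_upwards [hconv, hae] with ω ⟨c, hc⟩ hs
  have hlim : Tendsto (fun n => D n ω) atTop (𝓝 (-c * (⨆ n, P n) - 1)) := by
    have := ((hc.neg).mul hPlim).sub_const 1
    refine this.congr fun n => ?_
    have := (hP0 n).ne'
    field_simp
    ring
  set ℓ := -c * (⨆ n, P n) - 1 with hℓ
  have hℓ0 : 0 ≤ ℓ := ge_of_tendsto' hlim fun n => hD n ω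
  rcases hℓ0.eq_or_lt with h0 | hpos
  · rwa [← h0] at hlim
  · exfalso
    apply has
    have hev : ∀ᶠ n in atTop, ℓ / 2 < D n ω := hlim.eventually_const_lt (by linarith)
    refine Summable.of_norm_bounded_eventually_nat (hs.mul_left (2 / ℓ)) ?_
    filter_upwards [hev] with n hn
    rw [Real.norm_of_nonneg (ha n), div_mul_eq_mul_div, le_div_iff₀ hpos]
    nlinarith [ha n]

/-! ### Independence -/

/-- If `Z` is measurable with respect to `m` and `X` is independent of `m`, then `X` may be
integrated out with `Z` frozen, on every event of `m`. -/
theorem setLIntegral_indep {Ω S 𝒵 : Type*} {m : MeasurableSpace Ω} {m0 : MeasurableSpace Ω}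
    {μ : Measure Ω} [IsProbabilityMeasure μ] [MeasurableSpace S] [MeasurableSpace 𝒵] (hm : m ≤ m0)
    {X : Ω → S} (hX : Measurable[m0] X) {Z : Ω → 𝒵} (hZ : Measurable[m] Z)
    (hind : Indep m (MeasurableSpace.comap X inferInstance) μ)
    {s : Set Ω} (hs : MeasurableSet[m] s) {f : 𝒵 → S → ENNReal}
    (hf : Measurable (Function.uncurry f)) :
    ∫⁻ ω in s, f (Z ω) (X ω) ∂μ = ∫⁻ ω in s, ∫⁻ x, f (Z ω) x ∂(μ.map X) ∂μ := by
  have hZ0 : Measurable[m0] Z := hZ.mono hm le_rfl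
  have hs0 : MeasurableSet[m0] s := hm _ hs
  -- the event enters through its indicator, as a second coordinate measurable with respect to `m`
  set Y : Ω → 𝒵 × ENNReal := fun ω => (Z ω, s.indicator 1 ω) with hY
  have hi : Measurable[m] fun ω => s.indicator (1 : Ω → ENNReal) ω := by
    refine Measurable.indicator (f := fun _ => (1 : ENNReal)) ?_ hs
    exact measurable_const
  have hYm : Measurable[m] Y := hZ.prodMk hi
  have hYm0 : Measurable[m0] Y := hYm.mono hm le_rfl
  have hYX : IndepFun Y X μ := by
    rw [IndepFun_iff_Indep]
    exact indep_of_indep_of_le_left hind hYm.comap_le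
  have hprod := hYX.map_prod_eq_prod_map_map hYm0.aemeasurable hX.aemeasurable
  have hg : Measurable fun p : (𝒵 × ENNReal) × S => p.1.2 * f p.1.1 p.2 := by
    refine (measurable_snd.comp measurable_fst).mul ?_
    exact hf.comp ((measurable_fst.comp measurable_fst).prodMk measurable_snd)
  have : IsProbabilityMeasure (μ.map X) := Measure.isProbabilityMeasure_map hX.aemeasurable
  calc ∫⁻ ω in s, f (Z ω) (X ω) ∂μ
      = ∫⁻ ω, (Y ω).2 * f (Y ω).1 (X ω) ∂μ := by
        rw [← lintegral_indicator hs0]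
        refine lintegral_congr fun ω => ?_
        by_cases hω : ω ∈ s <;> simp [hY, hω]
    _ = ∫⁻ p, p.1.2 * f p.1.1 p.2 ∂(μ.map fun ω => (Y ω, X ω)) := by
        rw [lintegral_map hg (hYm0.prodMk hX)]
    _ = ∫⁻ y, ∫⁻ x, y.2 * f y.1 x ∂(μ.map X) ∂(μ.map Y) := by
        rw [hprod, lintegral_prod _ hg.aemeasurable]
    _ = ∫⁻ ω, ∫⁻ x, (Y ω).2 * f (Y ω).1 x ∂(μ.map X) ∂μ := by
        rw [lintegral_map hg.lintegral_prod_right' hYm0]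
    _ = ∫⁻ ω in s, ∫⁻ x, f (Z ω) x ∂(μ.map X) ∂μ := by
        rw [← lintegral_indicator hs0]
        refine lintegral_congr fun ω => ?_
        by_cases hω : ω ∈ s <;> simp [hY, hω]

/-- The `σ`-algebras generated by the samples strictly before time `t`. -/
def pastFiltration {Ω S : Type*} {m0 : MeasurableSpace Ω} [MeasurableSpace S] (X : ℕ → Ω → S)
    (hX : ∀ t, Measurable (X t)) : Filtration ℕ m0 where
  seq t := ⨆ i ∈ Set.Iio t, MeasurableSpace.comap (X i) inferInstance
  mono' := fun _ _ hst => iSup₂_mono' fun i hi => ⟨i, lt_of_lt_of_le hi hst, le_rfl⟩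
  le' := fun _ => iSup₂_le fun i _ => (hX i).comap_le

theorem indep_pastFiltration {Ω S : Type*} {m0 : MeasurableSpace Ω} {μ : Measure Ω}
    [IsProbabilityMeasure μ] [MeasurableSpace S] {X : ℕ → Ω → S}
    (hX : ∀ t, Measurable (X t)) (hind : iIndepFun X μ) (t : ℕ) :
    Indep (pastFiltration X hX t) (MeasurableSpace.comap (X t) inferInstance) μ := by
  have := indep_iSup_of_disjoint (fun i => (hX i).comap_le) hind (S := Set.Iio t) (T := {t})
    (by simp)
  simpa [pastFiltration] using this

/-! ### Drift towards a ball -/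

/-- First order expansion of the squared distance to the closed ball of radius `δ` around `0`. It
holds with constant `1` in front of `‖h‖ ^ 2` because the projection of `v` onto the ball is a
competitor for the distance from `v + h`. -/
theorem sq_dist_ball_add_le {H : Type*} [NormedAddCommGroup H] [InnerProductSpace ℝ H]
    (v h : H) {δ : ℝ} (hδ : 0 < δ) :
    (max (‖v + h‖ - δ) 0) ^ 2 ≤ (max (‖v‖ - δ) 0) ^ 2
      + 2 * (max (‖v‖ - δ) 0 / ‖v‖) * inner ℝ v h + ‖h‖ ^ 2 := by
  rcases le_or_gt ‖v‖ δ with hv | hv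
  · have h1 : max (‖v‖ - δ) 0 = 0 := max_eq_right (by linarith)
    rw [h1]
    have : max (‖v + h‖ - δ) 0 ≤ ‖h‖ := max_le (by linarith [norm_add_le v h]) (norm_nonneg h)
    have := pow_le_pow_left₀ (le_max_right _ _) this 2
    simpa using this
  · have hv0 : 0 < ‖v‖ := hδ.trans hv
    rw [max_eq_left (show 0 ≤ ‖v‖ - δ by linarith)]
    set κ := (‖v‖ - δ) / ‖v‖ with hκ
    have hκ0 : 0 ≤ κ := div_nonneg (by linarith) hv0.le
    have hκv : κ * ‖v‖ = ‖v‖ - δ := by rw [hκ]; field_simp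
    have hsplit : v + h = (δ / ‖v‖) • v + (κ • v + h) := by
      rw [← add_assoc, ← add_smul, hκ, ← add_div, add_sub_cancel, div_self hv0.ne', one_smul]
    have hle : max (‖v + h‖ - δ) 0 ≤ ‖κ • v + h‖ := by
      refine max_le ?_ (norm_nonneg _)
      have := norm_add_le ((δ / ‖v‖) • v) (κ • v + h)
      rw [← hsplit, norm_smul, Real.norm_of_nonneg (by positivity), div_mul_cancel₀ _ hv0.ne']
        at this
      linarith
    calc (max (‖v + h‖ - δ) 0) ^ 2 ≤ ‖κ • v + h‖ ^ 2 :=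
          pow_le_pow_left₀ (le_max_right _ _) hle 2
      _ = (‖v‖ - δ) ^ 2 + 2 * κ * inner ℝ v h + ‖h‖ ^ 2 := by
          rw [norm_add_sq_real, norm_smul, Real.norm_of_nonneg hκ0, hκv, real_inner_smul_left]
          ring

/-- A Markovian recursion `Z (t + 1) = Φ t (Z t) (X t)` driven by independent samples, observed
through coordinates `L t` whose mean drift points inwards outside the ball of radius `δ`, up to
errors that are summable relative to `1 + ‖L t z‖ ^ 2`, ends up in every neighbourhood of that
ball. The drift and the second moment of a step are controlled through integrable majorants, so
that the step itself need not be known to be integrable. -/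
theorem tendsto_ball_of_drift {Ω S 𝒵 H : Type*} {m0 : MeasurableSpace Ω} {μ : Measure Ω}
    [IsProbabilityMeasure μ] [MeasurableSpace S] [MeasurableSpace 𝒵]
    [NormedAddCommGroup H] [InnerProductSpace ℝ H]
    {X : ℕ → Ω → S} (hX : ∀ t, Measurable (X t)) (hind : iIndepFun X μ)
    {Φ : ℕ → 𝒵 → S → 𝒵} (hΦ : ∀ t, Measurable (Function.uncurry (Φ t)))
    {Z : ℕ → Ω → 𝒵} {z₀ : 𝒵} (hZ0 : ∀ ω, Z 0 ω = z₀)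
    (hZ : ∀ t ω, Z (t + 1) ω = Φ t (Z t ω) (X t ω))
    {L : ℕ → 𝒵 → H} (hL : ∀ t, Measurable fun z => ‖L t z‖)
    {e α : ℕ → ℝ} {c ρ δ : ℝ} {T : ℕ} (he : ∀ t, 0 ≤ e t) (hes : Summable e)
    (hα : ∀ t, 0 ≤ α t) (hαs : ¬ Summable α) (hc : 0 < c) (hδ : 0 < δ) (hρ : 2 * ρ ≤ c * δ ^ 2)
    (hsq : ∀ t z, ∃ h : S → ℝ, Integrable h (μ.map (X t)) ∧
      (∀ x, ‖L (t + 1) (Φ t z x) - L t z‖ ^ 2 ≤ h x) ∧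
      ∫ x, h x ∂(μ.map (X t)) ≤ e t * (1 + ‖L t z‖ ^ 2))
    (hdrift : ∀ t, T ≤ t → ∀ z, ∃ m : S → ℝ, Integrable m (μ.map (X t)) ∧
      (∀ x, inner ℝ (L t z) (L (t + 1) (Φ t z x) - L t z) ≤ m x) ∧
      ∫ x, m x ∂(μ.map (X t)) ≤ -α t * (c * ‖L t z‖ ^ 2 - ρ) + e t * (1 + ‖L t z‖ ^ 2)) :
    ∀ᵐ ω ∂μ, Tendsto (fun t => max (‖L t (Z t ω)‖ - δ) 0) atTop (𝓝 0) := by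
  set ℱ := pastFiltration X hX with hℱ
  have hXF : ∀ t, Measurable[ℱ (t + 1)] (X t) := fun t => by
    rw [measurable_iff_comap_le]
    exact le_iSup₂_of_le (f := fun i (_ : i ∈ Set.Iio (t + 1)) =>
      MeasurableSpace.comap (X i) inferInstance) t (Nat.lt_succ_self t) le_rfl
  have hZF : ∀ t, Measurable[ℱ t] (Z t) := by
    intro t
    induction t with
    | zero =>
      have : Z 0 = fun _ => z₀ := funext hZ0
      rw [this]; exact measurable_const
    | succ t ih =>
      have : Z (t + 1) = fun ω => Function.uncurry (Φ t) (Z t ω, X t ω) := funext (hZ t)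
      rw [this]
      exact (hΦ t).comp ((ih.mono (ℱ.mono (Nat.le_succ t)) le_rfl).prodMk (hXF t))
  have hZm : ∀ t, Measurable (Z t) := fun t => (hZF t).mono (ℱ.le t) le_rfl
  have hprob : ∀ t, IsProbabilityMeasure (μ.map (X t)) := fun t =>
    Measure.isProbabilityMeasure_map (hX t).aemeasurable
  -- conditioning on the past: a bound for each frozen state integrates to a bound for the process
  have hstep : ∀ (t : ℕ) (f g : 𝒵 → ℝ), Measurable f → (∀ z, 0 ≤ f z) → Measurable g →
      (∀ z, ∃ b : S → ℝ, Integrable b (μ.map (X t)) ∧ (∀ x, f (Φ t z x) ≤ b x) ∧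
        ∫ x, b x ∂(μ.map (X t)) ≤ g z) → Integrable (fun ω => g (Z t ω)) μ →
      Integrable (fun ω => f (Z (t + 1) ω)) μ ∧ ∀ s, MeasurableSet[ℱ t] s →
        ∫ ω in s, f (Z (t + 1) ω) ∂μ ≤ ∫ ω in s, g (Z t ω) ∂μ := by
    intro t f g hf hf0 hg hb hgi
    have hg0 : ∀ z, 0 ≤ g z := fun z => by
      obtain ⟨b, hbi, hfb, hbg⟩ := hb z
      exact (integral_nonneg fun x => (hf0 _).trans (hfb x)).trans hbg
    have key : ∀ s, MeasurableSet[ℱ t] s →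
        ∫⁻ ω in s, ENNReal.ofReal (f (Z (t + 1) ω)) ∂μ
          ≤ ∫⁻ ω in s, ENNReal.ofReal (g (Z t ω)) ∂μ := by
      intro s hs
      simp_rw [hZ]
      rw [setLIntegral_indep (ℱ.le t) (hX t) (hZF t) (indep_pastFiltration hX hind t) hs
        (f := fun z x => ENNReal.ofReal (f (Φ t z x))) (hf.comp (hΦ t)).ennreal_ofReal]
      refine lintegral_mono fun ω => ?_
      obtain ⟨b, hbi, hfb, hbg⟩ := hb (Z t ω)
      calc ∫⁻ x, ENNReal.ofReal (f (Φ t (Z t ω) x)) ∂(μ.map (X t))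
          ≤ ∫⁻ x, ENNReal.ofReal (b x) ∂(μ.map (X t)) :=
            lintegral_mono fun x => ENNReal.ofReal_le_ofReal (hfb x)
        _ = ENNReal.ofReal (∫ x, b x ∂(μ.map (X t))) :=
            (ofReal_integral_eq_lintegral_ofReal hbi
              (ae_of_all _ fun x => (hf0 _).trans (hfb x))).symm
        _ ≤ _ := ENNReal.ofReal_le_ofReal hbg
    have hfi : Integrable (fun ω => f (Z (t + 1) ω)) μ := by
      refine ⟨(hf.comp (hZm _)).aestronglyMeasurable, ?_⟩
      rw [hasFiniteIntegral_iff_ofReal (ae_of_all _ fun ω => hf0 _)]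
      have h1 := key Set.univ MeasurableSet.univ
      simp only [Measure.restrict_univ] at h1
      refine h1.trans_lt ?_
      rw [← hasFiniteIntegral_iff_ofReal (ae_of_all _ fun ω => hg0 _)]
      exact hgi.2
    refine ⟨hfi, fun s hs => ?_⟩
    rw [← ENNReal.ofReal_le_ofReal_iff (integral_nonneg fun ω => hg0 _),
      ofReal_integral_eq_lintegral_ofReal hfi.integrableOn (ae_of_all _ fun ω => hf0 _),
      ofReal_integral_eq_lintegral_ofReal hgi.integrableOn (ae_of_all _ fun ω => hg0 _)]
    exact key s hs
  -- second moments are finite at every time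
  have hW : ∀ t, Integrable (fun ω => ‖L t (Z t ω)‖ ^ 2) μ := by
    intro t
    induction t with
    | zero => simp_rw [hZ0]; exact integrable_const _
    | succ t ih =>
      refine (hstep t (fun z => ‖L (t + 1) z‖ ^ 2)
        (fun z => 2 * ‖L t z‖ ^ 2 + 2 * (e t * (1 + ‖L t z‖ ^ 2))) ((hL _).pow_const 2)
        (fun z => by positivity) ?_ (fun z => ?_) ?_).1
      · exact (((hL t).pow_const 2).const_mul 2).add
          ((((hL t).pow_const 2).const_add 1).const_mul _ |>.const_mul 2)
      · obtain ⟨h, hi, hh, hle⟩ := hsq t z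
        refine ⟨fun x => 2 * ‖L t z‖ ^ 2 + 2 * h x, (integrable_const _).add (hi.const_mul _),
          fun x => ?_, ?_⟩
        · have h1 : ‖L (t + 1) (Φ t z x)‖ ≤ ‖L t z‖ + ‖L (t + 1) (Φ t z x) - L t z‖ := by
            simpa using norm_add_le (L t z) (L (t + 1) (Φ t z x) - L t z)
          have h2 := hh x
          have h3 := norm_nonneg (L (t + 1) (Φ t z x))
          have h4 := pow_le_pow_left₀ h3 h1 2
          nlinarith [sq_nonneg (‖L t z‖ - ‖L (t + 1) (Φ t z x) - L t z‖)]
        · have := hprob t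
          rw [integral_add (integrable_const _) (hi.const_mul _),
            integral_const, probReal_univ, one_smul, integral_const_mul]
          linarith
      · exact (ih.const_mul _).add ((((integrable_const 1).add ih).const_mul _).const_mul _)
  set d : ℕ → 𝒵 → ℝ := fun t z => (max (‖L t z‖ - δ) 0) ^ 2 with hd
  have hdm : ∀ t, Measurable (d t) := fun t =>
    (((hL t).sub_const δ).max measurable_const).pow_const 2
  have hd0 : ∀ t z, 0 ≤ d t z := fun t z => sq_nonneg _
  have hdi : ∀ t, Integrable (fun ω => d t (Z t ω)) μ := by
    intro t
    refine (hW t).mono' ((hdm t).comp (hZm t)).aestronglyMeasurable (ae_of_all _ fun ω => ?_)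
    rw [Real.norm_of_nonneg (hd0 _ _)]
    exact pow_le_pow_left₀ (le_max_right _ _) (max_le (by linarith) (norm_nonneg _)) 2
  -- `e` after passing from `‖L t z‖ ^ 2` to the squared distance `d t z` to the ball
  set E : ℕ → ℝ := fun t => 6 * (1 + δ ^ 2) * e t with hE
  -- the squared distance to the ball is an almost-supermartingale from time `T` on
  have hrec : ∀ n s, MeasurableSet[ℱ (T + n)] s →
      ∫ ω in s, d (T + n + 1) (Z (T + n + 1) ω) ∂μ ≤
      ∫ ω in s, ((1 + E (T + n)) * d (T + n) (Z (T + n) ω) + E (T + n)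
        - c * α (T + n) * d (T + n) (Z (T + n) ω)) ∂μ := by
    intro n
    set t := T + n with ht
    refine (hstep t (d (t + 1))
      (fun z => (1 + E t) * d t z + E t - c * α t * d t z) (hdm _) (hd0 _)
      ?_ (fun z => ?_) ?_).2
    · exact (((hdm t).const_mul _).add_const _).sub ((hdm t).const_mul _)
    · obtain ⟨h, hhi, hh, hhle⟩ := hsq t z
      obtain ⟨m, hmi, hm, hmle⟩ := hdrift t (by omega) z
      set κ := max (‖L t z‖ - δ) 0 / ‖L t z‖ with hκ
      have hκ0 : 0 ≤ κ := div_nonneg (le_max_right _ _) (norm_nonneg _)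
      have hκ1 : κ ≤ 1 := div_le_one_of_le₀ (max_le (by linarith) (norm_nonneg _)) (norm_nonneg _)
      refine ⟨fun x => d t z + 2 * κ * m x + h x,
        ((integrable_const _).add (hmi.const_mul _)).add hhi, fun x => ?_, ?_⟩
      · have h1 := sq_dist_ball_add_le (L t z) (L (t + 1) (Φ t z x) - L t z) hδ
        rw [add_sub_cancel] at h1
        have h2 := mul_le_mul_of_nonneg_left (hm x) (mul_nonneg zero_le_two hκ0)
        have h3 := hh x
        simp only [hd]
        linarith
      · have := hprob t
        have hi1 : Integrable (fun x => d t z + 2 * κ * m x) (μ.map (X t)) :=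
          (integrable_const _).add (hmi.const_mul _)
        rw [integral_add hi1 hhi,
          integral_add (integrable_const _) (hmi.const_mul _), integral_const_mul,
          integral_const, probReal_univ, one_smul]
        have h1 := mul_le_mul_of_nonneg_left hmle (mul_nonneg zero_le_two hκ0)
        have hWd : ‖L t z‖ ^ 2 ≤ 2 * δ ^ 2 + 2 * d t z := by
          simp only [hd]
          nlinarith [le_max_left (‖L t z‖ - δ) 0, le_max_right (‖L t z‖ - δ) 0,
            norm_nonneg (L t z), sq_nonneg (max (‖L t z‖ - δ) 0 - δ)]
        have hdr : c * d t z ≤ 2 * κ * (c * ‖L t z‖ ^ 2 - ρ) := by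
          rcases le_or_gt ‖L t z‖ δ with hv | hv
          · have e1 : d t z = 0 := by simp only [hd]; rw [max_eq_right (by linarith)]; simp
            have e2 : κ = 0 := by rw [hκ, max_eq_right (by linarith), zero_div]
            rw [e1, e2]; simp
          · have hv0 : 0 < ‖L t z‖ := hδ.trans hv
            have e2 : κ * ‖L t z‖ = ‖L t z‖ - δ := by
              rw [hκ, max_eq_left (by linarith), div_mul_cancel₀ _ hv0.ne']
            have e3 : d t z = (‖L t z‖ - δ) ^ 2 := by
              simp only [hd]; rw [max_eq_left (by linarith)]
            have e4 : ρ ≤ c * ‖L t z‖ ^ 2 / 2 := by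
              have := mul_le_mul_of_nonneg_left (pow_le_pow_left₀ hδ.le hv.le 2) hc.le
              linarith
            have e5 : κ * (c * ‖L t z‖ ^ 2) ≤ 2 * κ * (c * ‖L t z‖ ^ 2 - ρ) := by
              have := mul_le_mul_of_nonneg_left e4 hκ0
              linarith
            have e6 : κ * (c * ‖L t z‖ ^ 2) = c * ((‖L t z‖ - δ) * ‖L t z‖) := by
              rw [← e2]; ring
            rw [e3]
            have e7 : c * (‖L t z‖ - δ) ^ 2 ≤ c * ((‖L t z‖ - δ) * ‖L t z‖) := by
              refine mul_le_mul_of_nonneg_left ?_ hc.le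
              nlinarith
            linarith
        have h2 := mul_le_mul_of_nonneg_left hdr (hα t)
        have h3 : 0 ≤ e t * (1 + ‖L t z‖ ^ 2) := mul_nonneg (he t) (by positivity)
        have h4 : 2 * κ * (e t * (1 + ‖L t z‖ ^ 2)) ≤ 2 * (e t * (1 + ‖L t z‖ ^ 2)) := by
          nlinarith
        have h5 : 3 * (e t * (1 + ‖L t z‖ ^ 2)) ≤ E t * (1 + d t z) := by
          have : 3 * (1 + ‖L t z‖ ^ 2) ≤ 6 * (1 + δ ^ 2) * (1 + d t z) := by
            nlinarith [mul_nonneg (sq_nonneg δ) (hd0 t z)]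
          have := mul_le_mul_of_nonneg_left this (he t)
          simp only [hE]
          linarith
        nlinarith
    · exact (((hdi t).const_mul _).add (integrable_const _)).sub ((hdi t).const_mul _)
  have hfin := ae_tendsto_zero_of_almost_supermartingale (μ := μ)
    { seq := fun n => ℱ (T + n)
      mono' := fun i j hij => ℱ.mono (by omega)
      le' := fun i => ℱ.le _ } (fun n ω => d (T + n) (Z (T + n) ω))
    (fun n => ((hdm _).comp (hZF _)).stronglyMeasurable) (fun n => hdi _) (fun n ω => hd0 _ _)
    (fun n => E (T + n)) (fun n => c * α (T + n)) (fun n => mul_nonneg (by positivity) (he _))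
    (by
      have := (summable_nat_add_iff T).2 (hes.mul_left (6 * (1 + δ ^ 2)))
      simpa only [hE, add_comm] using this)
    (fun n => mul_nonneg hc.le (hα _))
    (fun hs => hαs <| by
      rw [← summable_nat_add_iff T]
      have := hs.mul_left c⁻¹
      refine this.congr fun n => ?_
      rw [inv_mul_cancel_left₀ hc.ne', add_comm])
    hrec
  filter_upwards [hfin] with ω hω
  have h1 : Tendsto (fun t => d t (Z t ω)) atTop (𝓝 0) := by
    rw [← tendsto_add_atTop_iff_nat T]
    simpa only [add_comm] using hω
  have h2 := h1.sqrt
  rw [Real.sqrt_zero] at h2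
  refine h2.congr fun t => ?_
  simp only [hd]
  exact Real.sqrt_sq (le_max_right _ _)

/-! ### The stochastic recursion on a Hilbert space -/

section Recursion

variable {E : Type*} [NormedAddCommGroup E] [InnerProductSpace ℝ E]

open ContinuousLinearMap (adjoint)

/-- Coefficients `(a, c, d)` of an affine temporal difference recursion on `E`: one sample
contributes `a = φ(φ - γφ')ᵀ`, `c = φφᵀ` and `d = rφ`. The norm is the maximum of the three
norms. -/
abbrev Coeff (E : Type*) [NormedAddCommGroup E] [InnerProductSpace ℝ E] : Type _ :=
  (E →L[ℝ] E) × (E →L[ℝ] E) × E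

/-- The direction `d - a θ - c w` of the update of `w` at `z = (θ, w)`, as a linear function of
the coefficients; for one sample it is `(δ(θ) - φᵀw) φ`. -/
noncomputable def residual (z : E × E) : Coeff E →ₗ[ℝ] E where
  toFun ξ := ξ.2.2 - ξ.1 z.1 - ξ.2.1 z.2
  map_add' ξ ζ := by
    simp only [Prod.fst_add, Prod.snd_add, _root_.add_apply]
    abel
  map_smul' r ξ := by
    simp only [Prod.smul_fst, Prod.smul_snd, _root_.smul_apply, smul_sub, RingHom.id_apply]

theorem residual_apply (z : E × E) (ξ : Coeff E) :
    residual z ξ = ξ.2.2 - ξ.1 z.1 - ξ.2.1 z.2 := rfl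

theorem Coeff.norm_td_le (ξ : Coeff E) : ‖ξ.1‖ ≤ ‖ξ‖ := norm_fst_le ξ

theorem Coeff.norm_cov_le (ξ : Coeff E) : ‖ξ.2.1‖ ≤ ‖ξ‖ := (norm_fst_le ξ.2).trans (norm_snd_le ξ)

theorem Coeff.norm_vec_le (ξ : Coeff E) : ‖ξ.2.2‖ ≤ ‖ξ‖ := (norm_snd_le ξ.2).trans (norm_snd_le ξ)

theorem norm_residual_le (z : E × E) (ξ : Coeff E) :
    ‖residual z ξ‖ ≤ ‖ξ‖ * (1 + ‖z.1‖ + ‖z.2‖) := by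
  have h1 := ξ.1.le_of_opNorm_le ξ.norm_td_le z.1
  have h2 := ξ.2.1.le_of_opNorm_le ξ.norm_cov_le z.2
  have h3 := ξ.norm_vec_le
  rw [residual_apply]
  have h4 := norm_sub_le (ξ.2.2 - ξ.1 z.1) (ξ.2.1 z.2)
  have h5 := norm_sub_le ξ.2.2 (ξ.1 z.1)
  linarith

/-- The Lyapunov coordinates `(θ - θs, √K (w - p + G θ))` of `z = (θ, w)`, in the Hilbert sum. -/
noncomputable def lyap (θs : E) (K : ℝ) (G : E →L[ℝ] E) (p : E) (z : E × E) : WithLp 2 (E × E) :=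
  WithLp.toLp 2 (z.1 - θs, √K • (z.2 - p + G z.1))

theorem norm_sq_lyap (θs : E) {K : ℝ} (hK : 0 ≤ K) (G : E →L[ℝ] E) (p : E) (z : E × E) :
    ‖lyap θs K G p z‖ ^ 2 = ‖z.1 - θs‖ ^ 2 + K * ‖z.2 - p + G z.1‖ ^ 2 := by
  rw [WithLp.prod_norm_sq_eq_of_L2]
  simp only [lyap, WithLp.toLp_fst, WithLp.toLp_snd, norm_smul, mul_pow]
  rw [Real.norm_of_nonneg (Real.sqrt_nonneg K), Real.sq_sqrt hK]

theorem norm_sub_le_norm_lyap (θs : E) {K : ℝ} (hK : 0 ≤ K) (G : E →L[ℝ] E) (p : E) (z : E × E) :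
    ‖z.1 - θs‖ ≤ ‖lyap θs K G p z‖ := by
  refine (pow_le_pow_iff_left₀ (norm_nonneg _) (norm_nonneg _) two_ne_zero).1 ?_
  rw [norm_sq_lyap θs hK]
  have : 0 ≤ K * ‖z.2 - p + G z.1‖ ^ 2 := by positivity
  linarith

theorem lyap_coordinate_step {α β : ℝ} {G G' : E →L[ℝ] E} {p p' g q s : E} {z z' : E × E}
    (h1 : z'.1 = z.1 - α • (g + s)) (h2 : z'.2 = z.2 + β • q) :
    (z'.2 - p' + G' z'.1) - (z.2 - p + G z.1)
      = β • q - α • G' (g + s) + ((G' - G) z.1 - (p' - p)) := by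
  rw [h1, h2]
  simp only [map_sub, map_smul, _root_.sub_apply]
  abel

/-- The effect of a change of `G` and `p` on the second Lyapunov coordinate. -/
theorem norm_perturbation_le {G G' : E →L[ℝ] E} {p p' θ : E} :
    ‖(G' - G) θ - (p' - p)‖ ≤ (‖G' - G‖ + ‖p' - p‖) * (1 + ‖θ‖) := by
  have h1 := norm_sub_le ((G' - G) θ) (p' - p)
  have h2 := (G' - G).le_opNorm θ
  nlinarith [norm_nonneg (p' - p), norm_nonneg θ, norm_nonneg (G' - G),
    mul_nonneg (norm_nonneg (p' - p)) (norm_nonneg θ)]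

/-- First order effect of a step on the Lyapunov coordinates. The subgradient `s` belongs to the
new point `z'.1`, so that `hmono` replaces it by `ss` at the cost of a term of order `α ^ 2`. -/
theorem inner_lyap_step_le {θs ss : E} {K : ℝ} (hK : 0 ≤ K) {α β B : ℝ} (hα : 0 ≤ α)
    {G G' : E →L[ℝ] E} {p p' g q s : E} {z z' : E × E}
    (h1 : z'.1 = z.1 - α • (g + s)) (h2 : z'.2 = z.2 + β • q)
    (hs : ‖s‖ ≤ B) (hss : ‖ss‖ ≤ B) (hmono : 0 ≤ inner ℝ (z'.1 - θs) (s - ss)) :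
    inner ℝ (lyap θs K G p z) (lyap θs K G' p' z' - lyap θs K G p z) ≤
      -α * inner ℝ (z.1 - θs) (g + ss) + 2 * B * α ^ 2 * (‖g‖ + B)
      + K * (β * inner ℝ (z.2 - p + G z.1) q - α * inner ℝ (z.2 - p + G z.1) (G' g)
        + α * ‖G'‖ * B * ‖z.2 - p + G z.1‖
        + (‖G' - G‖ + ‖p' - p‖) * (1 + ‖z.1‖) * ‖z.2 - p + G z.1‖) := by
  set y := z.2 - p + G z.1 with hy
  have hsplit : inner ℝ (lyap θs K G p z) (lyap θs K G' p' z' - lyap θs K G p z)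
      = inner ℝ (z.1 - θs) (-(α • (g + s)))
        + K * inner ℝ y (β • q - α • G' (g + s) + ((G' - G) z.1 - (p' - p))) := by
    rw [← lyap_coordinate_step h1 h2, WithLp.prod_inner_apply]
    simp only [lyap, WithLp.ofLp_sub, Prod.fst_sub, Prod.snd_sub, ← smul_sub,
      real_inner_smul_left, real_inner_smul_right, ← hy]
    rw [← mul_assoc, Real.mul_self_sqrt hK, h1]
    congr 2
    abel
  rw [hsplit]
  have hB : 0 ≤ B := (norm_nonneg s).trans hs
  have hth : inner ℝ (z.1 - θs) (-(α • (g + s)))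
      ≤ -α * inner ℝ (z.1 - θs) (g + ss) + 2 * B * α ^ 2 * (‖g‖ + B) := by
    have e1 : inner ℝ (z'.1 - θs) (s - ss)
        = inner ℝ (z.1 - θs) (s - ss) - α * inner ℝ (g + s) (s - ss) := by
      rw [h1, sub_right_comm, inner_sub_left, real_inner_smul_left]
    have e2 : -inner ℝ (g + s) (s - ss) ≤ (‖g‖ + B) * (2 * B) := by
      refine (neg_le_abs _).trans ((abs_real_inner_le_norm _ _).trans ?_)
      refine mul_le_mul ((norm_add_le _ _).trans (by linarith))
        ((norm_sub_le _ _).trans (by linarith)) (norm_nonneg _) (by positivity)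
    have e3 : inner ℝ (z.1 - θs) (-(α • (g + s))) = -α * inner ℝ (z.1 - θs) (g + ss)
        - α * inner ℝ (z.1 - θs) (s - ss) := by
      rw [inner_neg_right, real_inner_smul_right, inner_add_right, inner_add_right, inner_sub_right]
      ring
    have e4 := mul_le_mul_of_nonneg_left e2 (sq_nonneg α)
    have e5 := mul_nonneg hα hmono
    rw [e1] at e5
    rw [e3]
    nlinarith
  have hyy : inner ℝ y (β • q - α • G' (g + s) + ((G' - G) z.1 - (p' - p)))
      ≤ β * inner ℝ y q - α * inner ℝ y (G' g) + α * ‖G'‖ * B * ‖y‖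
        + (‖G' - G‖ + ‖p' - p‖) * (1 + ‖z.1‖) * ‖y‖ := by
    rw [inner_add_right, inner_sub_right, real_inner_smul_right, real_inner_smul_right, map_add,
      inner_add_right]
    have e1 : -inner ℝ y (G' s) ≤ ‖y‖ * (‖G'‖ * B) :=
      (neg_le_abs _).trans ((abs_real_inner_le_norm _ _).trans
        (mul_le_mul_of_nonneg_left ((G'.le_opNorm s).trans
          (mul_le_mul_of_nonneg_left hs (norm_nonneg _))) (norm_nonneg _)))
    have e2 := mul_le_mul_of_nonneg_left e1 hα
    have e3 := (real_inner_le_norm y ((G' - G) z.1 - (p' - p))).trans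
      (mul_le_mul_of_nonneg_left norm_perturbation_le (norm_nonneg y))
    linarith
  have := mul_le_mul_of_nonneg_left hyy hK
  linarith

/-- Second order effect of a step on the Lyapunov coordinates. -/
theorem norm_sq_lyap_step_le {θs : E} {K : ℝ} (hK : 0 ≤ K) {α β B : ℝ} (hα : 0 ≤ α) (hβ : 0 ≤ β)
    {G G' : E →L[ℝ] E} {p p' g q s : E} {z z' : E × E}
    (h1 : z'.1 = z.1 - α • (g + s)) (h2 : z'.2 = z.2 + β • q) (hs : ‖s‖ ≤ B) :
    ‖lyap θs K G' p' z' - lyap θs K G p z‖ ^ 2 ≤ (α * (‖g‖ + B)) ^ 2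
      + K * (β * ‖q‖ + α * (‖G'‖ * (‖g‖ + B)) + (‖G' - G‖ + ‖p' - p‖) * (1 + ‖z.1‖)) ^ 2 := by
  have hsplit : lyap θs K G' p' z' - lyap θs K G p z = WithLp.toLp 2 (-(α • (g + s)),
      √K • (β • q - α • G' (g + s) + ((G' - G) z.1 - (p' - p)))) := by
    rw [← lyap_coordinate_step h1 h2, smul_sub, lyap, lyap, ← WithLp.toLp_sub, Prod.mk_sub_mk, h1]
    congr 2
    abel
  rw [hsplit, WithLp.prod_norm_sq_eq_of_L2]
  simp only [WithLp.toLp_fst, WithLp.toLp_snd, norm_smul, mul_pow, norm_neg]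
  rw [Real.norm_of_nonneg (Real.sqrt_nonneg K), Real.sq_sqrt hK, Real.norm_of_nonneg hα]
  have hgs : ‖g + s‖ ≤ ‖g‖ + B := (norm_add_le _ _).trans (by linarith)
  refine add_le_add ?_ (mul_le_mul_of_nonneg_left ?_ hK)
  · rw [← mul_pow, ← mul_pow]
    exact pow_le_pow_left₀ (by positivity) (mul_le_mul_of_nonneg_left hgs hα) 2
  · refine pow_le_pow_left₀ (norm_nonneg _) ?_ 2
    refine (norm_add_le _ _).trans (add_le_add ((norm_sub_le _ _).trans (add_le_add ?_ ?_))
      norm_perturbation_le)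
    · rw [norm_smul, Real.norm_of_nonneg hβ]
    · rw [norm_smul, Real.norm_of_nonneg hα]
      exact mul_le_mul_of_nonneg_left ((G'.le_opNorm _).trans
        (mul_le_mul_of_nonneg_left hgs (norm_nonneg _))) hα

/-- The iterates are bounded linearly by their Lyapunov coordinates, uniformly in bounded `G` and
`p`. -/
theorem exists_growth_lyap (θs : E) {K : ℝ} (hK : 0 < K) (Γ : ℝ) (hΓ : 0 ≤ Γ) :
    ∃ N : ℝ, 0 ≤ N ∧ ∀ (G : E →L[ℝ] E) (p : E), ‖G‖ ≤ Γ → ‖p‖ ≤ Γ → ∀ z : E × E,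
      (1 + ‖z.1‖ + ‖z.2‖) ^ 2 ≤ N * (1 + ‖lyap θs K G p z‖ ^ 2) := by
  refine ⟨3 * ((1 + ‖θs‖ + Γ + Γ * ‖θs‖) ^ 2 + (1 + Γ) ^ 2 + K⁻¹), by positivity,
    fun G p hG hp z => ?_⟩
  rw [norm_sq_lyap θs hK.le]
  set x := ‖z.1 - θs‖
  set y := ‖z.2 - p + G z.1‖
  have h1 : ‖z.1‖ ≤ x + ‖θs‖ := by simpa using norm_add_le (z.1 - θs) θs
  have h2 : ‖z.2‖ ≤ y + Γ + Γ * (x + ‖θs‖) := by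
    have e1 : z.2 = (z.2 - p + G z.1) + p - G z.1 := by abel
    have e2 : ‖z.2‖ ≤ y + ‖p‖ + ‖G z.1‖ := by
      conv_lhs => rw [e1]
      exact (norm_sub_le _ _).trans (add_le_add (norm_add_le _ _) le_rfl)
    have e3 : ‖G z.1‖ ≤ Γ * (x + ‖θs‖) :=
      (G.le_of_opNorm_le hG _).trans (mul_le_mul_of_nonneg_left h1 hΓ)
    linarith
  set a := 1 + ‖θs‖ + Γ + Γ * ‖θs‖ with ha
  have h3 : 1 + ‖z.1‖ + ‖z.2‖ ≤ a + (1 + Γ) * x + y := by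
    rw [ha]; linarith
  have h4 : (1 + ‖z.1‖ + ‖z.2‖) ^ 2 ≤ (a + (1 + Γ) * x + y) ^ 2 :=
    pow_le_pow_left₀ (by positivity) h3 2
  have h5 : (a + (1 + Γ) * x + y) ^ 2 ≤ 3 * (a ^ 2 + (1 + Γ) ^ 2 * x ^ 2 + y ^ 2) := by
    nlinarith [sq_nonneg (a - (1 + Γ) * x), sq_nonneg (a - y), sq_nonneg ((1 + Γ) * x - y)]
  have h6 : y ^ 2 = K⁻¹ * (K * y ^ 2) := by field_simp
  have h7 : 0 ≤ K * y ^ 2 := by positivity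
  have h8 : 0 ≤ K⁻¹ := by positivity
  have h9 : 0 ≤ x ^ 2 := sq_nonneg x
  have h10 : a ^ 2 + (1 + Γ) ^ 2 * x ^ 2 + y ^ 2
      ≤ (a ^ 2 + (1 + Γ) ^ 2 + K⁻¹) * (1 + (x ^ 2 + K * y ^ 2)) := by
    generalize K * y ^ 2 = u at h6 h7 ⊢
    rw [h6]
    nlinarith [mul_nonneg (sq_nonneg a) h9, mul_nonneg (sq_nonneg a) h7, sq_nonneg a,
      mul_nonneg (sq_nonneg (1 + Γ)) h7, mul_nonneg h8 h9, mul_nonneg (sq_nonneg (1 + Γ)) h9,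
      sq_nonneg (1 + Γ)]
  linarith

variable [FiniteDimensional ℝ E]

instance : CompleteSpace (Coeff E) := FiniteDimensional.complete ℝ _

/-- The stochastic gradient `-(aᵀ w + j (d - a θ - c w))` at `z = (θ, w)`, as a linear function of
the coefficients. The parameter `j` interpolates between GTD2 (`j = 0`) and TDC (`j = 1`). -/
noncomputable def gradient (j : ℝ) (z : E × E) : Coeff E →ₗ[ℝ] E where
  toFun ξ := -(adjoint ξ.1 z.2 + j • residual z ξ)
  map_add' ξ ζ := by
    simp only [Prod.fst_add, map_add, _root_.add_apply, smul_add]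
    abel
  map_smul' r ξ := by
    simp only [Prod.smul_fst, map_smulₛₗ, _root_.smul_apply, RingHom.id_apply, smul_add,
      smul_neg, smul_comm j r]
    simp

theorem gradient_apply (j : ℝ) (z : E × E) (ξ : Coeff E) :
    gradient j z ξ = -(adjoint ξ.1 z.2 + j • residual z ξ) := rfl

theorem norm_gradient_le {j : ℝ} (hj : |j| ≤ 1) (z : E × E) (ξ : Coeff E) :
    ‖gradient j z ξ‖ ≤ 2 * ‖ξ‖ * (1 + ‖z.1‖ + ‖z.2‖) := by
  have h1 := (adjoint ξ.1).le_of_opNorm_le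
    ((LinearIsometryEquiv.norm_map adjoint ξ.1).le.trans ξ.norm_td_le) z.2
  have h2 := norm_residual_le z ξ
  have h3 : ‖j • residual z ξ‖ ≤ ‖residual z ξ‖ := by
    rw [norm_smul, Real.norm_eq_abs]
    exact mul_le_of_le_one_left (norm_nonneg _) hj
  rw [gradient_apply, norm_neg]
  have h4 := norm_add_le (adjoint ξ.1 z.2) (j • residual z ξ)
  nlinarith [norm_nonneg ξ, norm_nonneg z.1, norm_nonneg z.2,
    mul_nonneg (norm_nonneg ξ) (norm_nonneg z.1)]

/-- The leading part of `⟪L, L⁺ - L⟫` for one step from `z` with coefficients `ξ`, where `L` are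
the Lyapunov coordinates for `(G, p)` and `L⁺` those of the new point for `G'`; the summand
`α * ‖G'‖ * B * ‖w - p + G θ‖` accounts for a subgradient of norm at most `B`. It is affine in
`ξ`, hence commutes with expectations. -/
noncomputable def meanDrift (θs ss : E) (K j B α β : ℝ) (G G' : E →L[ℝ] E) (p : E) (ξ : Coeff E)
    (z : E × E) : ℝ :=
  -α * inner ℝ (z.1 - θs) (gradient j z ξ + ss)
    + K * (β * inner ℝ (z.2 - p + G z.1) (residual z ξ)
      - α * inner ℝ (z.2 - p + G z.1) (G' (gradient j z ξ)) + α * ‖G'‖ * B * ‖z.2 - p + G z.1‖)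

theorem integrable_meanDrift {S : Type*} [MeasurableSpace S] {P : Measure S}
    [IsProbabilityMeasure P] {ξ : S → Coeff E} (hξ : Integrable ξ P) (θs ss : E)
    (K j B α β : ℝ) (G G' : E →L[ℝ] E) (p : E) (z : E × E) :
    Integrable (fun x => meanDrift θs ss K j B α β G G' p (ξ x) z) P ∧
    ∫ x, meanDrift θs ss K j B α β G G' p (ξ x) z ∂P
      = meanDrift θs ss K j B α β G G' p (∫ x, ξ x ∂P) z := by
  set y := z.2 - p + G z.1 with hy
  let ℓ : Coeff E →ₗ[ℝ] ℝ := (-α) • ((innerₛₗ ℝ (z.1 - θs)).comp (gradient j z))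
    + K • (β • (innerₛₗ ℝ y).comp (residual z)
      - α • (innerₛₗ ℝ y).comp (G'.toLinearMap.comp (gradient j z)))
  set b : ℝ := -α * inner ℝ (z.1 - θs) ss + K * (α * ‖G'‖ * B * ‖y‖) with hb
  have hform : ∀ ζ : Coeff E, meanDrift θs ss K j B α β G G' p ζ z = ℓ ζ + b := by
    intro ζ
    simp only [meanDrift, ← hy, ℓ, LinearMap.add_apply, LinearMap.smul_apply, LinearMap.sub_apply,
      LinearMap.comp_apply, innerₛₗ_apply_apply, smul_eq_mul, inner_add_right,
      ContinuousLinearMap.coe_coe, hb]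
    ring
  have hℓ : Integrable (fun x => ℓ (ξ x)) P :=
    (LinearMap.toContinuousLinearMap ℓ).integrable_comp hξ
  simp_rw [hform]
  refine ⟨hℓ.add (integrable_const _), ?_⟩
  rw [integral_add hℓ (integrable_const _), integral_const, probReal_univ, one_smul]
  congr 1
  exact (LinearMap.toContinuousLinearMap ℓ).integral_comp_comm hξ

end Recursion

/-! ### Scalar estimates -/

/-- The bound of `norm_sq_lyap_step_le` in terms of the norm `b` of the coefficients and the size
`n` of the iterates. -/
theorem sq_step_bound {K R Γ B α β b n g q G ν m : ℝ} (hK : 0 ≤ K) (hα : 0 ≤ α) (hβ : 0 ≤ β)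
    (hR : α ≤ R * β) (hB : 0 ≤ B) (hn : 1 ≤ n) (hg0 : 0 ≤ g) (hq0 : 0 ≤ q)
    (hG0 : 0 ≤ G) (hν : 0 ≤ ν) (hm : 0 ≤ m) (hg : g ≤ 2 * b * n) (hq : q ≤ b * n) (hG : G ≤ Γ)
    (hmn : m ≤ n) :
    (α * (g + B)) ^ 2 + K * (β * q + α * (G * (g + B)) + ν * m) ^ 2 ≤
      n ^ 2 * (R ^ 2 * (8 + 2 * B ^ 2) + 3 * K * (1 + Γ ^ 2 * R ^ 2 * (8 + 2 * B ^ 2)))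
        * (β ^ 2 * (b ^ 2 + 1) + ν ^ 2) := by
  have hΓ : 0 ≤ Γ := hG0.trans hG
  set C0 : ℝ := 8 + 2 * B ^ 2 with hC0
  have hC00 : 0 ≤ C0 := by positivity
  have hgB : g + B ≤ (2 * b + B) * n := by nlinarith
  have hgα : α * (g + B) ≤ R * β * (2 * b + B) * n := by
    calc _ ≤ (R * β) * ((2 * b + B) * n) :=
          mul_le_mul hR hgB (by positivity) (hα.trans hR)
      _ = _ := by ring
  have hC : (2 * b + B) ^ 2 ≤ C0 * (b ^ 2 + 1) := by
    rw [hC0]; nlinarith [sq_nonneg (2 * b - B), sq_nonneg (B * b)]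
  have e1 : (α * (g + B)) ^ 2 ≤ n ^ 2 * (R ^ 2 * C0 * (β ^ 2 * (b ^ 2 + 1))) := by
    calc _ ≤ (R * β * (2 * b + B) * n) ^ 2 := pow_le_pow_left₀ (by positivity) hgα 2
      _ = n ^ 2 * R ^ 2 * β ^ 2 * (2 * b + B) ^ 2 := by ring
      _ ≤ n ^ 2 * R ^ 2 * β ^ 2 * (C0 * (b ^ 2 + 1)) :=
          mul_le_mul_of_nonneg_left hC (by positivity)
      _ = _ := by ring
  have e2 : β * q + α * (G * (g + B)) + ν * m
      ≤ (β * b + Γ * (R * β * (2 * b + B)) + ν) * n := by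
    have f1 := mul_le_mul_of_nonneg_left hq hβ
    have f2 : α * (G * (g + B)) ≤ Γ * (R * β * (2 * b + B) * n) := by
      rw [mul_left_comm]
      exact mul_le_mul hG hgα (by positivity) hΓ
    have f3 : ν * m ≤ ν * n := mul_le_mul_of_nonneg_left hmn hν
    linarith
  have three : ∀ u v w : ℝ, (u + v + w) ^ 2 ≤ 3 * (u ^ 2 + v ^ 2 + w ^ 2) := fun u v w => by
    nlinarith [sq_nonneg (u - v), sq_nonneg (u - w), sq_nonneg (v - w)]
  have e3 : (β * q + α * (G * (g + B)) + ν * m) ^ 2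
      ≤ n ^ 2 * (3 * (β ^ 2 * b ^ 2 + Γ ^ 2 * R ^ 2 * C0 * (β ^ 2 * (b ^ 2 + 1)) + ν ^ 2)) := by
    calc _ ≤ ((β * b + Γ * (R * β * (2 * b + B)) + ν) * n) ^ 2 :=
          pow_le_pow_left₀ (by positivity) e2 2
      _ = n ^ 2 * (β * b + Γ * (R * β * (2 * b + B)) + ν) ^ 2 := by ring
      _ ≤ n ^ 2 * (3 * ((β * b) ^ 2 + (Γ * (R * β * (2 * b + B))) ^ 2 + ν ^ 2)) :=
          mul_le_mul_of_nonneg_left (three _ _ _) (sq_nonneg n)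
      _ ≤ _ := by
          refine mul_le_mul_of_nonneg_left ?_ (sq_nonneg n)
          have := mul_le_mul_of_nonneg_left hC (show 0 ≤ Γ ^ 2 * R ^ 2 * β ^ 2 by positivity)
          linarith
  have e4 := mul_le_mul_of_nonneg_left e3 hK
  refine (add_le_add e1 e4).trans ?_
  have e5 : 0 ≤ n ^ 2 * (R ^ 2 * C0 * ν ^ 2 + 3 * K * (β ^ 2 + Γ ^ 2 * R ^ 2 * C0 * ν ^ 2)) := by
    positivity
  linarith

/-- The second order term of `inner_lyap_step_le`, bounded in the same quantities. -/
theorem sq_step_noise_bound {R B α β b n g : ℝ} (hα : 0 ≤ α)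
    (hR : α ≤ R * β) (hB : 0 ≤ B) (hn : 1 ≤ n) (hg0 : 0 ≤ g)
    (hg : g ≤ 2 * b * n) :
    2 * B * α ^ 2 * (g + B) ≤ 2 * B * (1 + B) * R ^ 2 * n ^ 2 * (β ^ 2 * (b ^ 2 + 1)) := by
  have hα2 : α ^ 2 ≤ R ^ 2 * β ^ 2 := by
    rw [← mul_pow]; exact pow_le_pow_left₀ hα hR 2
  have hgB : g + B ≤ (1 + B) * (b ^ 2 + 1) * n ^ 2 := by
    have f1 : 2 * b ≤ b ^ 2 + 1 := by nlinarith [sq_nonneg (b - 1)]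
    have f2 : n ≤ n ^ 2 := by nlinarith
    have f3 : 2 * b * n ≤ (b ^ 2 + 1) * n ^ 2 := mul_le_mul f1 f2 (by positivity) (by positivity)
    have f4 : 1 ≤ (b ^ 2 + 1) * n ^ 2 := one_le_mul_of_one_le_of_one_le
      (by nlinarith) (by nlinarith)
    have f5 := mul_le_mul_of_nonneg_left f4 hB
    linarith
  calc _ ≤ 2 * B * (R ^ 2 * β ^ 2) * ((1 + B) * (b ^ 2 + 1) * n ^ 2) :=
        mul_le_mul (mul_le_mul_of_nonneg_left hα2 (by positivity)) hgB (by positivity)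
          (by positivity)
    _ = _ := by ring

/-! ### Schemes with independent samples -/

section Scheme

variable {Ω S E : Type*} {m0 : MeasurableSpace Ω} [MeasurableSpace S]
  [NormedAddCommGroup E] [InnerProductSpace ℝ E] [FiniteDimensional ℝ E] [MeasurableSpace E]

open ContinuousLinearMap (adjoint)

/-- One step of the algorithm on `E × E`: a proximal step in `θ` and a linear step in `w`. -/
noncomputable def saStep (Pr : ℕ → E → E) (ξ : S → Coeff E) (j : ℝ) (α β : ℕ → ℝ) (t : ℕ)
    (z : E × E) (x : S) : E × E :=
  (Pr t (z.1 - α t • gradient j z (ξ x)), z.2 + β t • residual z (ξ x))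

/-- A stochastic approximation scheme `saStep` driven by the independent, not necessarily
identically distributed samples `X`. The maps `Pr t` enter only through `prox`: they subtract
`α t` times a vector bounded by `B` that behaves like a monotone operator relative to the pair
`(θs, ss)`. -/
structure IsScheme (μ : Measure Ω) (X : ℕ → Ω → S) (ξ : S → Coeff E) (Pr : ℕ → E → E) (j : ℝ)
    (α β : ℕ → ℝ) (θs ss : E) (B : ℝ) : Prop where
  measurable : ∀ t, Measurable (X t)
  indep : iIndepFun X μ
  memLp : ∀ t, MemLp ξ 2 (μ.map (X t))
  measurable_step : ∀ t, Measurable (Function.uncurry (saStep Pr ξ j α β t))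
  abs_le_one : |j| ≤ 1
  prox : ∀ t u, ∃ s, Pr t u = u - α t • s ∧ ‖s‖ ≤ B ∧ 0 ≤ inner ℝ (Pr t u - θs) (s - ss)
  norm_le : ‖ss‖ ≤ B
  slow_pos : ∀ t, 0 < α t
  fast_pos : ∀ t, 0 < β t
  not_summable : ¬ Summable α
  summable_sq : Summable fun t => β t ^ 2 * (∫ x, ‖ξ x‖ ^ 2 ∂(μ.map (X t)) + 1)

variable {μ : Measure Ω} [IsProbabilityMeasure μ] {X : ℕ → Ω → S} {ξ : S → Coeff E}
  {Pr : ℕ → E → E} {j : ℝ} {α β : ℕ → ℝ} {θs ss : E} {B : ℝ}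

theorem IsScheme.integrable (h : IsScheme μ X ξ Pr j α β θs ss B) (t : ℕ) :
    Integrable ξ (μ.map (X t)) :=
  have := Measure.isProbabilityMeasure_map (μ := μ) (h.measurable t).aemeasurable
  (h.memLp t).integrable one_le_two

/-- If eventually the mean drift of the Lyapunov coordinates points inwards outside the ball of
radius `δ`, and `G`, `p` have bounded variation, then the Lyapunov coordinates approach that
ball. -/
theorem IsScheme.tendsto_ball [BorelSpace E] (h : IsScheme μ X ξ Pr j α β θs ss B)
    {R Γ K c ρ δ : ℝ} (hR : ∀ t, α t ≤ R * β t) {G : ℕ → E →L[ℝ] E} {p : ℕ → E}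
    (hG : ∀ t, ‖G t‖ ≤ Γ) (hp : ∀ t, ‖p t‖ ≤ Γ)
    (hν : Summable fun t => ‖G (t + 1) - G t‖ + ‖p (t + 1) - p t‖)
    (hK : 0 < K) (hc : 0 < c) (hδ : 0 < δ) (hρ : 2 * ρ ≤ c * δ ^ 2)
    (hdrift : ∀ᶠ t in atTop, ∀ z : E × E,
      meanDrift θs ss K j B (α t) (β t) (G t) (G (t + 1)) (p t) (∫ x, ξ x ∂(μ.map (X t))) z
        ≤ -α t * (c * ‖lyap θs K (G t) (p t) z‖ ^ 2 - ρ))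
    {Z : ℕ → Ω → E × E} {z₀ : E × E} (hZ0 : ∀ ω, Z 0 ω = z₀)
    (hZ : ∀ t ω, Z (t + 1) ω = saStep Pr ξ j α β t (Z t ω) (X t ω)) :
    ∀ᵐ ω ∂μ, Tendsto (fun t => max (‖lyap θs K (G t) (p t) (Z t ω)‖ - δ) 0) atTop (𝓝 0) := by
  have hΓ : 0 ≤ Γ := (norm_nonneg _).trans (hG 0)
  have hB : 0 ≤ B := (norm_nonneg _).trans h.norm_le
  have hR0 : 0 ≤ R := by
    have h1 := (h.slow_pos 0).trans_le (hR 0)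
    exact (pos_of_mul_pos_left h1 (h.fast_pos 0).le).le
  obtain ⟨N, hN0, hN⟩ := exists_growth_lyap θs hK Γ hΓ
  obtain ⟨T, hT⟩ := eventually_atTop.1 hdrift
  set ν : ℕ → ℝ := fun t => ‖G (t + 1) - G t‖ + ‖p (t + 1) - p t‖ with hνd
  have hν0 : ∀ t, 0 ≤ ν t := fun t => by positivity
  set σ : ℕ → ℝ := fun t => β t ^ 2 * (∫ x, ‖ξ x‖ ^ 2 ∂(μ.map (X t)) + 1) with hσ
  have hσ0 : ∀ t, 0 ≤ σ t := fun t =>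
    mul_nonneg (sq_nonneg _) (add_nonneg (integral_nonneg fun x => sq_nonneg _) zero_le_one)
  have hνsq : Summable fun t => ν t ^ 2 := by
    refine Summable.of_nonneg_of_le (fun t => sq_nonneg _) (fun t => ?_)
      (hν.mul_left (∑' t, ν t))
    rw [sq]
    exact mul_le_mul_of_nonneg_right (hν.le_tsum t fun i _ => hν0 i) (hν0 t)
  -- the relative error `e` collects the constants of `sq_step_bound`, of `sq_step_noise_bound` and
  -- of the perturbation term of `inner_lyap_step_le`
  set C0 : ℝ := 8 + 2 * B ^ 2 with hC0
  set C1 : ℝ := R ^ 2 * C0 + 3 * K * (1 + Γ ^ 2 * R ^ 2 * C0) with hC1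
  have hC00 : 0 ≤ C0 := by positivity
  have hC10 : 0 ≤ C1 := by positivity
  set e : ℕ → ℝ := fun t => N * C1 * (σ t + ν t ^ 2) + 2 * B * (1 + B) * R ^ 2 * N * σ t
    + (1 + K * N) * ν t with he
  have he0 : ∀ t, 0 ≤ e t := fun t => by
    have := hσ0 t; have := hν0 t
    positivity
  have hes : Summable e :=
    (((h.summable_sq.add hνsq).mul_left _).add (h.summable_sq.mul_left _)).add (hν.mul_left _)
  have hsqi : ∀ t, Integrable (fun x => ‖ξ x‖ ^ 2) (μ.map (X t)) := fun t =>
    (h.memLp t).integrable_norm_pow two_ne_zero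
  have hcont : ∀ t, Continuous fun z : E × E => ‖lyap θs K (G t) (p t) z‖ := fun t => by
    refine continuous_norm.comp ((WithLp.prod_continuous_toLp 2 E E).comp ?_)
    fun_prop
  have hn1 : ∀ z : E × E, 1 ≤ 1 + ‖z.1‖ + ‖z.2‖ := fun z => by
    linarith [norm_nonneg z.1, norm_nonneg z.2]
  refine tendsto_ball_of_drift (𝒵 := E × E) (T := T) (e := e) (α := α) (c := c) (ρ := ρ)
    h.measurable h.indep h.measurable_step hZ0 hZ
    (fun t => (hcont t).measurable) he0 hes (fun t => (h.slow_pos t).le)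
    h.not_summable hc hδ hρ (fun t z => ?_) (fun t ht z => ?_)
  · have := Measure.isProbabilityMeasure_map (μ := μ) (h.measurable t).aemeasurable
    set n := 1 + ‖z.1‖ + ‖z.2‖ with hn
    have hn0 : 1 ≤ n := hn1 z
    refine ⟨fun x => n ^ 2 * C1 * (β t ^ 2 * (‖ξ x‖ ^ 2 + 1) + ν t ^ 2),
      ((((hsqi t).add (integrable_const _)).const_mul _).add (integrable_const _)).const_mul _,
      fun x => ?_, ?_⟩
    · obtain ⟨s, hs1, hs2, hs3⟩ := h.prox t (z.1 - α t • gradient j z (ξ x))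
      have h1 : (saStep Pr ξ j α β t z x).1 = z.1 - α t • (gradient j z (ξ x) + s) := by
        simp only [saStep]; rw [hs1, smul_add]; abel
      refine (norm_sq_lyap_step_le hK.le (h.slow_pos t).le (h.fast_pos t).le h1 rfl hs2).trans ?_
      exact sq_step_bound hK.le (h.slow_pos t).le (h.fast_pos t).le (hR t) hB hn0
        (norm_nonneg _) (norm_nonneg _) (norm_nonneg _) (hν0 t)
        (by positivity) (norm_gradient_le h.abs_le_one z (ξ x)) (norm_residual_le z (ξ x)) (hG _)
        (by rw [hn]; linarith [norm_nonneg z.2])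
    · have hi1 : Integrable (fun x => β t ^ 2 * (‖ξ x‖ ^ 2 + 1)) (μ.map (X t)) :=
        ((hsqi t).add (integrable_const _)).const_mul _
      rw [integral_const_mul, integral_add hi1 (integrable_const _), integral_const_mul,
        integral_add (hsqi t) (integrable_const _), integral_const, probReal_univ, one_smul,
        integral_const, probReal_univ, one_smul]
      have hNt := hN (G t) (p t) (hG t) (hp t) z
      have h1 : n ^ 2 * C1 * (σ t + ν t ^ 2)
          ≤ N * (1 + ‖lyap θs K (G t) (p t) z‖ ^ 2) * (C1 * (σ t + ν t ^ 2)) := by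
        rw [mul_assoc]
        exact mul_le_mul_of_nonneg_right hNt (mul_nonneg hC10 (add_nonneg (hσ0 t) (sq_nonneg _)))
      refine h1.trans ?_
      have h2 : 0 ≤ (2 * B * (1 + B) * R ^ 2 * N * σ t + (1 + K * N) * ν t)
          * (1 + ‖lyap θs K (G t) (p t) z‖ ^ 2) := by
        have := hσ0 t; have := hν0 t
        positivity
      simp only [he]
      linarith
  · have := Measure.isProbabilityMeasure_map (μ := μ) (h.measurable t).aemeasurable
    set n := 1 + ‖z.1‖ + ‖z.2‖ with hn
    have hn0 : 1 ≤ n := hn1 z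
    set y := z.2 - p t + G t z.1 with hy
    obtain ⟨hmi, hmean⟩ := integrable_meanDrift (h.integrable t) θs ss K j B (α t) (β t) (G t)
      (G (t + 1)) (p t) z
    refine ⟨fun x => meanDrift θs ss K j B (α t) (β t) (G t) (G (t + 1)) (p t) (ξ x) z
      + (2 * B * (1 + B) * R ^ 2 * n ^ 2 * (β t ^ 2 * (‖ξ x‖ ^ 2 + 1))
        + K * (ν t * (1 + ‖z.1‖) * ‖y‖)),
      hmi.add (((((hsqi t).add (integrable_const _)).const_mul _).const_mul _).add
        (integrable_const _)), fun x => ?_, ?_⟩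
    · obtain ⟨s, hs1, hs2, hs3⟩ := h.prox t (z.1 - α t • gradient j z (ξ x))
      have h1 : (saStep Pr ξ j α β t z x).1 = z.1 - α t • (gradient j z (ξ x) + s) := by
        simp only [saStep]; rw [hs1, smul_add]; abel
      have h2 := inner_lyap_step_le (θs := θs) (p := p t) (p' := p (t + 1)) (G := G t)
        (G' := G (t + 1)) hK.le (h.slow_pos t).le h1 rfl hs2 h.norm_le hs3
      refine h2.trans ?_
      rw [← hy]
      have hg := norm_gradient_le h.abs_le_one z (ξ x)
      rw [← hn] at hg
      simp only [meanDrift, ← hy]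
      have hfin := sq_step_noise_bound (h.slow_pos t).le (hR t) hB hn0 (norm_nonneg _) hg
      linarith
    · have hi2 : Integrable (fun x => 2 * B * (1 + B) * R ^ 2 * n ^ 2
          * (β t ^ 2 * (‖ξ x‖ ^ 2 + 1))) (μ.map (X t)) :=
        (((hsqi t).add (integrable_const _)).const_mul _).const_mul _
      have hi3 : Integrable (fun x => 2 * B * (1 + B) * R ^ 2 * n ^ 2
          * (β t ^ 2 * (‖ξ x‖ ^ 2 + 1)) + K * (ν t * (1 + ‖z.1‖) * ‖y‖)) (μ.map (X t)) :=
        hi2.add (integrable_const _)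
      rw [integral_add hmi hi3, hmean, integral_add hi2 (integrable_const _), integral_const_mul,
        integral_const_mul, integral_add (hsqi t) (integrable_const _),
        integral_const, probReal_univ, one_smul, integral_const, probReal_univ, one_smul]
      have h1 := hT t ht z
      have hNt := hN (G t) (p t) (hG t) (hp t) z
      have hL := norm_sq_lyap θs hK.le (G t) (p t) z
      rw [← hy] at hL
      set W := ‖lyap θs K (G t) (p t) z‖ ^ 2 with hW
      rw [← hn] at hNt
      have h2 : 2 * B * (1 + B) * R ^ 2 * n ^ 2 * σ t
          ≤ 2 * B * (1 + B) * R ^ 2 * (N * (1 + W)) * σ t :=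
        mul_le_mul_of_nonneg_right (mul_le_mul_of_nonneg_left hNt (by positivity)) (hσ0 t)
      have h3 : K * (ν t * (1 + ‖z.1‖) * ‖y‖) ≤ (1 + K * N) * ν t * (1 + W) := by
        have f1 : (1 + ‖z.1‖) * ‖y‖ ≤ n ^ 2 + ‖y‖ ^ 2 := by
          have : 1 + ‖z.1‖ ≤ n := by rw [hn]; linarith [norm_nonneg z.2]
          linarith [mul_le_mul_of_nonneg_right this (norm_nonneg y), sq_nonneg (n - ‖y‖),
            sq_nonneg n, sq_nonneg ‖y‖]
        have f2 : K * ((1 + ‖z.1‖) * ‖y‖) ≤ (1 + K * N) * (1 + W) := by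
          have g1 := mul_le_mul_of_nonneg_left f1 hK.le
          have g2 := mul_le_mul_of_nonneg_left hNt hK.le
          linarith [sq_nonneg ‖z.1 - θs‖]
        have := mul_le_mul_of_nonneg_right f2 (hν0 t)
        linarith
      have h4 : 0 ≤ N * C1 * (σ t + ν t ^ 2) * (1 + W) := by
        have := hσ0 t; have : 0 ≤ W := sq_nonneg _
        positivity
      simp only [he]
      simp only [hσ] at h2 h4 ⊢
      linarith

end Scheme

/-! ### Mean drift estimates -/

/-- Absorption of the cross terms when `α / β` is small: `x` and `y` are the norms of the two
Lyapunov coordinates. -/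
theorem two_time_scale_bound {α β m c D ρ ε x y : ℝ} (hm : 0 < m) (hρ : 0 < ρ) (hα : 0 ≤ α)
    (hε : 4 * ε ^ 2 ≤ m * ρ)
    (hβ : α * (2 * D ^ 2 / m + D ^ 2 / (2 * ρ) + D + m / 4) ≤ β * c) :
    α * (-(m / 2) * x ^ 2 + ε * x + D * x * y + D * y ^ 2 + D * y) - β * c * y ^ 2
      ≤ -α * (m / 4 * (x ^ 2 + y ^ 2) - ρ) := by
  have h1 : ε * x ≤ m / 8 * x ^ 2 + ρ / 2 := by
    have : 0 ≤ (m * x - 4 * ε) ^ 2 / (8 * m) := by positivity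
    have h2 : (m * x - 4 * ε) ^ 2 / (8 * m) = m / 8 * x ^ 2 - ε * x + 2 * ε ^ 2 / m := by
      field_simp; ring
    have h3 : 2 * ε ^ 2 / m ≤ ρ / 2 := by rw [div_le_iff₀ hm]; linarith
    linarith
  have h2 : D * x * y ≤ m / 8 * x ^ 2 + 2 * D ^ 2 / m * y ^ 2 := by
    have : 0 ≤ (m * x - 4 * D * y) ^ 2 / (8 * m) := by positivity
    have h2 : (m * x - 4 * D * y) ^ 2 / (8 * m)
        = m / 8 * x ^ 2 - D * x * y + 2 * D ^ 2 / m * y ^ 2 := by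
      field_simp; ring
    linarith
  have h3 : D * y ≤ ρ / 2 + D ^ 2 / (2 * ρ) * y ^ 2 := by
    have : 0 ≤ (ρ - D * y) ^ 2 / (2 * ρ) := by positivity
    have h2 : (ρ - D * y) ^ 2 / (2 * ρ) = ρ / 2 - D * y + D ^ 2 / (2 * ρ) * y ^ 2 := by
      field_simp; ring
    linarith
  have h4 := mul_le_mul_of_nonneg_right hβ (sq_nonneg y)
  have h5 := mul_le_mul_of_nonneg_left (add_le_add (add_le_add h1 h2) h3) hα
  linarith

/-- Absorption of the cross terms for a small weight `ε`: `x = ‖θ - θs‖` and `v = ‖w - ws‖`. The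
constant error is of order `ε ^ 2`, while the coefficient of `x ^ 2` is of order `ε`. -/
theorem one_time_scale_bound {ε m c D x v : ℝ} (hm : 0 < m) (hc : 0 < c)
    (hx : 0 ≤ x) (hv : 0 ≤ v) (hε : 0 ≤ ε) (hε1 : ε ≤ 1)
    (hsmall : ε * ((D + D ^ 2) ^ 2 / m + D) ≤ c / 4) :
    -c * v ^ 2 - ε * m * x ^ 2 + ε * D * (x * v) + ε * D * ((v + ε * D * x) * (v + 1))
      ≤ -(c / 2) * v ^ 2 - ε * (m / 2) * x ^ 2 + ε ^ 2 * (D ^ 2 / c + D ^ 4 / m) := by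
  set F := D + D ^ 2 with hF
  have h1 : F * (x * v) ≤ m / 4 * x ^ 2 + F ^ 2 / m * v ^ 2 := by
    have : 0 ≤ (m * x - 2 * F * v) ^ 2 / (4 * m) := by positivity
    have h2 : (m * x - 2 * F * v) ^ 2 / (4 * m)
        = m / 4 * x ^ 2 - F * (x * v) + F ^ 2 / m * v ^ 2 := by
      field_simp; ring
    linarith
  have h2 : ε * D * v ≤ c / 4 * v ^ 2 + ε ^ 2 * (D ^ 2 / c) := by
    have : 0 ≤ (c * v - 2 * (ε * D)) ^ 2 / (4 * c) := by positivity
    have h2 : (c * v - 2 * (ε * D)) ^ 2 / (4 * c)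
        = c / 4 * v ^ 2 - ε * D * v + ε ^ 2 * (D ^ 2 / c) := by
      field_simp; ring
    linarith
  have h3 : ε * D ^ 2 * x ≤ m / 4 * x ^ 2 + ε ^ 2 * (D ^ 4 / m) := by
    have : 0 ≤ (m * x - 2 * (ε * D ^ 2)) ^ 2 / (4 * m) := by positivity
    have h2 : (m * x - 2 * (ε * D ^ 2)) ^ 2 / (4 * m)
        = m / 4 * x ^ 2 - ε * D ^ 2 * x + ε ^ 2 * (D ^ 4 / m) := by
      field_simp; ring
    linarith
  have h4 := mul_le_mul_of_nonneg_right hsmall (sq_nonneg v)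
  have h5 := mul_le_mul_of_nonneg_left h1 hε
  have h6 := mul_le_mul_of_nonneg_left h3 hε
  have h7 : ε * D * ((v + ε * D * x) * (v + 1)) = ε * D * v ^ 2 + ε * D * v
      + ε * (ε * (D ^ 2 * (x * v))) + ε * (ε * D ^ 2 * x) := by ring
  have h8 : ε * (ε * (D ^ 2 * (x * v))) ≤ ε * (D ^ 2 * (x * v)) :=
    mul_le_mul_of_nonneg_left (mul_le_of_le_one_left (by positivity) hε1) hε
  have h9 : ε * (ε ^ 2 * (D ^ 4 / m)) ≤ ε ^ 2 * (D ^ 4 / m) :=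
    mul_le_of_le_one_left (by positivity) hε1
  rw [h7]
  have h10 : ε * (F * (x * v)) = ε * D * (x * v) + ε * (D ^ 2 * (x * v)) := by rw [hF]; ring
  linarith

section

variable {E : Type*} [NormedAddCommGroup E] [InnerProductSpace ℝ E] [FiniteDimensional ℝ E]

open ContinuousLinearMap (adjoint)

theorem norm_adjoint_apply_le (A : E →L[ℝ] E) {Γ : ℝ} (hA : ‖A‖ ≤ Γ) (v : E) :
    ‖adjoint A v‖ ≤ Γ * ‖v‖ :=
  (adjoint A).le_of_opNorm_le ((LinearIsometryEquiv.norm_map adjoint A).le.trans hA) v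

/-- With `G = C⁻¹A` and `p = C⁻¹d` the residual is `-C y` in the second Lyapunov coordinate `y`,
and the gradient is that of the quadratic objective up to `O(‖y‖)`. -/
theorem meanDrift_le_of_twoTimeScale {θs ss p : E} {j B α β Γ ε m c : ℝ} {G G' Ci : E →L[ℝ] E}
    {ξ : Coeff E} (hCi : ∀ v, ξ.2.1 (Ci v) = v) (hG : G = Ci * ξ.1) (hp : p = Ci ξ.2.2)
    (hj : |j| ≤ 1) (hξΓ : ‖ξ‖ ≤ Γ) (hGΓ : ‖G‖ ≤ Γ) (hG'Γ : ‖G'‖ ≤ Γ) (hss : ‖ss‖ ≤ B)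
    (hε : ‖ss - adjoint ξ.1 (p - G θs)‖ ≤ ε) (hε1 : ε ≤ 1)
    (hm : ∀ v, m * ‖v‖ ^ 2 ≤ inner ℝ v (adjoint ξ.1 (G v)))
    (hc : ∀ v, c * ‖v‖ ^ 2 ≤ inner ℝ v (ξ.2.1 v)) (hα : 0 ≤ α) (hβ : 0 ≤ β) (z : E × E) :
    meanDrift θs ss 1 j B α β G G' p ξ z ≤
      α * (-m * ‖z.1 - θs‖ ^ 2 + ε * ‖z.1 - θs‖
        + (2 * Γ + Γ * (B + 1 + Γ ^ 2 + 2 * Γ) + Γ * B) * ‖z.1 - θs‖ * ‖z.2 - p + G z.1‖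
        + (2 * Γ + Γ * (B + 1 + Γ ^ 2 + 2 * Γ) + Γ * B) * ‖z.2 - p + G z.1‖ ^ 2
        + (2 * Γ + Γ * (B + 1 + Γ ^ 2 + 2 * Γ) + Γ * B) * ‖z.2 - p + G z.1‖)
      - β * c * ‖z.2 - p + G z.1‖ ^ 2 := by
  have hΓ : 0 ≤ Γ := (norm_nonneg _).trans hξΓ
  have hB : 0 ≤ B := (norm_nonneg _).trans hss
  have hε0 : 0 ≤ ε := (norm_nonneg _).trans hε
  set th := z.1 - θs with hth
  set y := z.2 - p + G z.1 with hy
  set A := ξ.1 with hA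
  set C := ξ.2.1 with hC
  have hAΓ : ‖A‖ ≤ Γ := ξ.norm_td_le.trans hξΓ
  have hCΓ : ‖C‖ ≤ Γ := ξ.norm_cov_le.trans hξΓ
  have hq : residual z ξ = -C y := by
    have : C (G z.1) = A z.1 := by
      rw [hG]; exact hCi _
    rw [residual_apply, hy, map_add, map_sub, this, hp, hCi]
    abel
  have hg : gradient j z ξ + ss
      = (ss - adjoint A (p - G θs)) + adjoint A (G th) + (j • C y - adjoint A y) := by
    rw [gradient_apply, hq, ← hA, hy, hth]
    simp only [map_add, map_sub, smul_neg]
    abel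
  set e0 := ss - adjoint A (p - G θs) with he0
  set u := j • C y - adjoint A y with hu
  have huy : ‖u‖ ≤ 2 * Γ * ‖y‖ := by
    have h1 : ‖j • C y‖ ≤ Γ * ‖y‖ := by
      rw [norm_smul, Real.norm_eq_abs]
      exact (mul_le_of_le_one_left (norm_nonneg _) hj).trans (C.le_of_opNorm_le hCΓ y)
    have h2 := norm_adjoint_apply_le A hAΓ y
    have h3 := norm_sub_le (j • C y) (adjoint A y)
    linarith
  have hgn : ‖gradient j z ξ‖ ≤ (B + 1 + Γ ^ 2 + 2 * Γ) * (1 + ‖th‖ + ‖y‖) := by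
    have h1 : gradient j z ξ = e0 + adjoint A (G th) + u - ss := by rw [← hg]; abel
    have h2 : ‖adjoint A (G th)‖ ≤ Γ ^ 2 * ‖th‖ := by
      have := norm_adjoint_apply_le A hAΓ (G th)
      have h3 := mul_le_mul_of_nonneg_left (G.le_of_opNorm_le hGΓ th) hΓ
      linarith
    have h3 : ‖gradient j z ξ‖ ≤ ε + Γ ^ 2 * ‖th‖ + 2 * Γ * ‖y‖ + B := by
      rw [h1]
      refine (norm_sub_le _ _).trans (add_le_add ((norm_add_le _ _).trans
        (add_le_add ((norm_add_le _ _).trans (add_le_add hε h2)) huy)) hss)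
    have h4 := norm_nonneg th
    have h5 := norm_nonneg y
    have h6 : 0 ≤ (B + 1 + 2 * Γ) * ‖th‖ + (B + 1 + Γ ^ 2) * ‖y‖ + Γ ^ 2 + 2 * Γ := by positivity
    linarith
  have h1 : -inner ℝ th (gradient j z ξ + ss) ≤ -m * ‖th‖ ^ 2 + ε * ‖th‖ + 2 * Γ * ‖th‖ * ‖y‖ := by
    rw [hg, inner_add_right, inner_add_right]
    have e1 := (neg_le_abs _).trans (abs_real_inner_le_norm th e0)
    have e2 := (neg_le_abs _).trans (abs_real_inner_le_norm th u)
    have e3 := mul_le_mul_of_nonneg_left hε (norm_nonneg th)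
    have e4 := mul_le_mul_of_nonneg_left huy (norm_nonneg th)
    have e5 := hm th
    linarith
  have h2 : -inner ℝ y (G' (gradient j z ξ))
      ≤ ‖y‖ * (Γ * ((B + 1 + Γ ^ 2 + 2 * Γ) * (1 + ‖th‖ + ‖y‖))) := by
    refine (neg_le_abs _).trans ((abs_real_inner_le_norm _ _).trans
      (mul_le_mul_of_nonneg_left ?_ (norm_nonneg _)))
    exact (G'.le_of_opNorm_le hG'Γ _).trans (mul_le_mul_of_nonneg_left hgn hΓ)
  have h3 : inner ℝ y (residual z ξ) ≤ -c * ‖y‖ ^ 2 := by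
    rw [hq, inner_neg_right]
    linarith [hc y]
  have h4 : ‖G'‖ * B * ‖y‖ ≤ Γ * B * ‖y‖ := by gcongr
  have k1 := mul_le_mul_of_nonneg_left (add_le_add (add_le_add h1 h2) h4) hα
  have k2 := mul_le_mul_of_nonneg_left h3 hβ
  simp only [meanDrift, ← hy, ← hth]
  have hnn : 0 ≤ α * ((Γ * B) * (‖th‖ * ‖y‖) + (2 * Γ + Γ * B) * ‖y‖ ^ 2 + 2 * Γ * ‖y‖) := by
    positivity
  linarith

/-- The mean drift is Lipschitz in the coefficients. -/
theorem meanDrift_le_add {θs ss p : E} {K j B α β R Γ τ : ℝ} {G G' : E →L[ℝ] E} {ξ ζ : Coeff E}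
    (hK : 0 ≤ K) (hj : |j| ≤ 1) (hα : 0 ≤ α) (hβ : 0 ≤ β) (hR : β ≤ R * α) (hG' : ‖G'‖ ≤ Γ)
    (hτ : ‖ξ - ζ‖ ≤ τ) (z : E × E) :
    meanDrift θs ss K j B α β G G' p ξ z ≤ meanDrift θs ss K j B α β G G' p ζ z
      + α * τ * ((1 + ‖z.1‖ + ‖z.2‖) *
        (2 * ‖z.1 - θs‖ + K * (R + 2 * Γ) * ‖z.2 - p + G z.1‖)) := by
  set n := 1 + ‖z.1‖ + ‖z.2‖ with hn
  set y := z.2 - p + G z.1 with hy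
  have hn0 : 0 ≤ n := by positivity
  have hτ0 : 0 ≤ τ := (norm_nonneg _).trans hτ
  have hΓ : 0 ≤ Γ := (norm_nonneg _).trans hG'
  have hdiff : meanDrift θs ss K j B α β G G' p ξ z - meanDrift θs ss K j B α β G G' p ζ z
      = α * -inner ℝ (z.1 - θs) (gradient j z (ξ - ζ))
        + K * (β * inner ℝ y (residual z (ξ - ζ))
          + α * -inner ℝ y (G' (gradient j z (ξ - ζ)))) := by
    simp only [meanDrift, map_sub, inner_sub_right, inner_add_right, ← hy]
    ring
  have hg : ‖gradient j z (ξ - ζ)‖ ≤ 2 * τ * n :=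
    (norm_gradient_le hj z _).trans (by gcongr)
  have hq : ‖residual z (ξ - ζ)‖ ≤ τ * n := (norm_residual_le z _).trans (by gcongr)
  have h1 : -inner ℝ (z.1 - θs) (gradient j z (ξ - ζ)) ≤ ‖z.1 - θs‖ * (2 * τ * n) :=
    (neg_le_abs _).trans ((abs_real_inner_le_norm _ _).trans (by gcongr))
  have h2 : inner ℝ y (residual z (ξ - ζ)) ≤ ‖y‖ * (τ * n) :=
    (real_inner_le_norm _ _).trans (by gcongr)
  have h3 : -inner ℝ y (G' (gradient j z (ξ - ζ))) ≤ ‖y‖ * (Γ * (2 * τ * n)) :=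
    (neg_le_abs _).trans ((abs_real_inner_le_norm _ _).trans (mul_le_mul_of_nonneg_left
      ((G'.le_of_opNorm_le hG' _).trans (by gcongr)) (norm_nonneg _)))
  have k1 := mul_le_mul_of_nonneg_left h1 hα
  have k2 : β * inner ℝ y (residual z (ξ - ζ)) ≤ R * α * (‖y‖ * (τ * n)) :=
    (mul_le_mul_of_nonneg_left h2 hβ).trans (mul_le_mul_of_nonneg_right hR (by positivity))
  have k3 := mul_le_mul_of_nonneg_left h3 hα
  have k4 := mul_le_mul_of_nonneg_left (add_le_add k2 k3) hK
  linarith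

/-- With `K β = α` the terms `⟪A (θ - θs), w - ws⟫` from the two updates cancel, and the weight
`ε` in `G = ε A` contributes `-ε ‖A (θ - θs)‖ ^ 2`. -/
theorem meanDrift_le_of_oneTimeScale {θs ss ws p : E} {K B α β ε m c D : ℝ} {G : E →L[ℝ] E}
    {ξ : Coeff E} (hss : adjoint ξ.1 ws = ss) (hws : ξ.2.1 ws = ξ.2.2 - ξ.1 θs)
    (hG : G = ε • ξ.1) (hp : p = ws + ε • ξ.1 θs) (hK : 0 ≤ K) (hβ : K * β = α) (hα : 0 ≤ α)
    (hB : 0 ≤ B) (hε : 0 ≤ ε) (hm : 0 < m) (hε1 : ε ≤ 1) (hc0 : 0 < c)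
    (hsmall : ε * ((D + D ^ 2) ^ 2 / m + D) ≤ c / 4) (hD0 : ‖ξ.1‖ ≤ D)
    (hD1 : ‖ξ.1‖ * ‖ξ.2.1‖ ≤ D) (hD2 : K * ‖ξ.1‖ ^ 2 ≤ D)
    (hD3 : K * (‖ξ.1‖ ^ 2 * ‖ws‖ + ‖ξ.1‖ * B) ≤ D)
    (hm' : ∀ v, m * ‖v‖ ^ 2 ≤ ‖ξ.1 v‖ ^ 2)
    (hc : ∀ v, c * ‖v‖ ^ 2 ≤ inner ℝ v (ξ.2.1 v)) (z : E × E) :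
    meanDrift θs ss K 0 B α β G G p ξ z ≤
      α * (-(c / 2) * ‖z.2 - ws‖ ^ 2 - ε * (m / 2) * ‖z.1 - θs‖ ^ 2
        + ε ^ 2 * (D ^ 2 / c + D ^ 4 / m)) ∧
    ‖z.2 - p + G z.1‖ ≤ ‖z.2 - ws‖ + ε * D * ‖z.1 - θs‖ := by
  set th := z.1 - θs with hth
  set v := z.2 - ws with hv
  set A := ξ.1 with hA
  set C := ξ.2.1 with hC
  have hDn : 0 ≤ D := (norm_nonneg _).trans hD0
  have hy : z.2 - p + G z.1 = v + ε • A th := by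
    rw [hp, hG, hv, hth, map_sub, smul_sub, _root_.smul_apply]; abel
  have hq : residual z ξ = -A th - C v := by
    rw [residual_apply, ← hA, ← hC, hth, hv, map_sub, map_sub, hws]; abel
  have hz2 : z.2 = ws + v := by rw [hv]; abel
  have hg : gradient 0 z ξ = -(ss + adjoint A v) := by
    rw [gradient_apply, zero_smul, add_zero, ← hA, hz2, map_add, hss]
  have hAn : ∀ u, ‖A u‖ ≤ ‖A‖ * ‖u‖ := A.le_opNorm
  have hyn : ‖v + ε • A th‖ ≤ ‖v‖ + ε * D * ‖th‖ := by
    refine (norm_add_le _ _).trans (add_le_add_right ?_ _)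
    rw [norm_smul, Real.norm_of_nonneg hε, mul_assoc]
    exact mul_le_mul_of_nonneg_left (A.le_of_opNorm_le hD0 _) hε
  refine ⟨?_, by rw [hy]; exact hyn⟩
  have h1 : inner ℝ th (gradient 0 z ξ + ss) = -inner ℝ (A th) v := by
    rw [hg, neg_add_rev, neg_add_cancel_right, inner_neg_right,
      ContinuousLinearMap.adjoint_inner_right]
  have h2 : inner ℝ (v + ε • A th) (residual z ξ)
      ≤ -inner ℝ (A th) v - c * ‖v‖ ^ 2 - ε * m * ‖th‖ ^ 2 + ε * D * (‖th‖ * ‖v‖) := by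
    rw [hq, inner_sub_right, inner_neg_right, inner_add_left, inner_add_left,
      real_inner_smul_left, real_inner_smul_left, real_inner_comm (A th) v,
      real_inner_self_eq_norm_sq]
    have e1 := hc v
    have e2 := mul_le_mul_of_nonneg_left (hm' th) hε
    have e3 : -inner ℝ (A th) (C v) ≤ D * (‖th‖ * ‖v‖) := by
      refine (neg_le_abs _).trans ((abs_real_inner_le_norm _ _).trans ?_)
      calc ‖A th‖ * ‖C v‖ ≤ (‖A‖ * ‖th‖) * (‖C‖ * ‖v‖) := by
            gcongr
            · exact A.le_opNorm th
            · exact C.le_opNorm v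
        _ = (‖A‖ * ‖C‖) * (‖th‖ * ‖v‖) := by ring
        _ ≤ _ := by gcongr
    have e4 := mul_le_mul_of_nonneg_left e3 hε
    linarith
  have h3 : K * (-inner ℝ (v + ε • A th) (A (gradient 0 z ξ)) + ‖A‖ * B * ‖v + ε • A th‖)
      ≤ D * ((‖v‖ + ε * D * ‖th‖) * (‖v‖ + 1)) := by
    have e1 : -inner ℝ (v + ε • A th) (A (gradient 0 z ξ))
        ≤ ‖v + ε • A th‖ * (‖A‖ ^ 2 * ‖ws‖ + ‖A‖ ^ 2 * ‖v‖) := by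
      refine (neg_le_abs _).trans ((abs_real_inner_le_norm _ _).trans
        (mul_le_mul_of_nonneg_left ?_ (norm_nonneg _)))
      have f1 : gradient 0 z ξ = -adjoint A (ws + v) := by rw [hg, map_add, hss]
      rw [f1, map_neg, norm_neg]
      calc ‖A (adjoint A (ws + v))‖ ≤ ‖A‖ * (‖A‖ * ‖ws + v‖) :=
            (hAn _).trans (mul_le_mul_of_nonneg_left
              (norm_adjoint_apply_le A le_rfl _) (norm_nonneg _))
        _ ≤ ‖A‖ * (‖A‖ * (‖ws‖ + ‖v‖)) := by gcongr; exact norm_add_le _ _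
        _ = _ := by ring
    have e2 : K * (-inner ℝ (v + ε • A th) (A (gradient 0 z ξ)) + ‖A‖ * B * ‖v + ε • A th‖)
        ≤ ‖v + ε • A th‖ * (K * (‖A‖ ^ 2 * ‖ws‖ + ‖A‖ * B) + K * ‖A‖ ^ 2 * ‖v‖) := by
      have := mul_le_mul_of_nonneg_left e1 hK
      linarith
    refine e2.trans ?_
    calc _ ≤ (‖v‖ + ε * D * ‖th‖) * (D + D * ‖v‖) := by gcongr
      _ = _ := by ring
  have hfin := one_time_scale_bound hm hc0 (norm_nonneg th) (norm_nonneg v) hε hε1 hsmall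
  have k3 := mul_le_mul_of_nonneg_left h3 hε
  have k5 := mul_le_mul_of_nonneg_left h2 hα
  have k6 := mul_le_mul_of_nonneg_left hfin hα
  have k7 := mul_le_mul_of_nonneg_left k3 hα
  have hGA : ‖G‖ = ε * ‖A‖ := by rw [hG, norm_smul, Real.norm_of_nonneg hε]
  have hGg : ∀ u, inner ℝ u (G (gradient 0 z ξ)) = ε * inner ℝ u (A (gradient 0 z ξ)) := fun u => by
    rw [hG, _root_.smul_apply, real_inner_smul_right]
  rw [meanDrift, hy, hGg, hGA, ← hth, h1]
  have k8 : K * (β * inner ℝ (v + ε • A th) (residual z ξ))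
      = α * inner ℝ (v + ε • A th) (residual z ξ) := by rw [← mul_assoc, hβ]
  linarith

end

/-! ### Convergence of the schemes -/

theorem exists_bound_of_tendsto {F : Type*} [SeminormedAddCommGroup F] {u : ℕ → F} {a : F}
    (h : Tendsto u atTop (𝓝 a)) : ∃ Γ, ∀ t, ‖u t‖ ≤ Γ := by
  obtain ⟨Γ, hΓ⟩ := h.norm.bddAbove_range
  exact ⟨Γ, fun t => hΓ ⟨t, rfl⟩⟩

theorem tendsto_clm_apply {E : Type*} [NormedAddCommGroup E] [NormedSpace ℝ E]
    {T : ℕ → E →L[ℝ] E} {T₀ : E →L[ℝ] E} {u : ℕ → E} {u₀ : E} (hT : Tendsto T atTop (𝓝 T₀))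
    (hu : Tendsto u atTop (𝓝 u₀)) : Tendsto (fun t => T t (u t)) atTop (𝓝 (T₀ u₀)) :=
  (isBoundedBilinearMap_apply.continuous.tendsto (T₀, u₀)).comp (hT.prodMk_nhds hu)

/-- Almost sure convergence from almost sure absorption in the ball of each radius `δ`. -/
theorem ae_tendsto_of_forall_ball {Ω E : Type*} [NormedAddCommGroup E] {m0 : MeasurableSpace Ω}
    {μ : Measure Ω} {θs : E} {θ : ℕ → Ω → E}
    (h : ∀ δ : ℝ, 0 < δ → ∃ ℓ : ℕ → Ω → ℝ, (∀ t ω, ‖θ t ω - θs‖ ≤ ℓ t ω) ∧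
      ∀ᵐ ω ∂μ, Tendsto (fun t => max (ℓ t ω - δ) 0) atTop (𝓝 0)) :
    ∀ᵐ ω ∂μ, Tendsto (fun t => θ t ω) atTop (𝓝 θs) := by
  have h1 : ∀ n : ℕ, ∀ᵐ ω ∂μ, ∀ᶠ t in atTop, ‖θ t ω - θs‖ < 2 * (1 / ((n : ℝ) + 1)) := by
    intro n
    obtain ⟨ℓ, hℓ, hae⟩ := h (1 / ((n : ℝ) + 1)) (by positivity)
    filter_upwards [hae] with ω hω
    filter_upwards [hω.eventually_lt_const (show (0 : ℝ) < 1 / ((n : ℝ) + 1) by positivity)]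
      with t ht
    have := le_max_left (ℓ t ω - 1 / ((n : ℝ) + 1)) 0
    linarith [hℓ t ω]
  filter_upwards [ae_all_iff.2 h1] with ω hω
  rw [tendsto_iff_norm_sub_tendsto_zero, Metric.tendsto_atTop']
  intro ε hε
  obtain ⟨n, hn⟩ := exists_nat_one_div_lt (half_pos hε)
  obtain ⟨T, hT⟩ := eventually_atTop.1 (hω n)
  refine ⟨T, fun t ht => ?_⟩
  rw [Real.dist_0_eq_abs, abs_of_nonneg (norm_nonneg _)]
  linarith [hT t ht.le]

section

variable {Ω S E : Type*} {m0 : MeasurableSpace Ω} [MeasurableSpace S]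
  [NormedAddCommGroup E] [InnerProductSpace ℝ E] [FiniteDimensional ℝ E] [MeasurableSpace E]
  [BorelSpace E]
  {μ : Measure Ω} [IsProbabilityMeasure μ] {X : ℕ → Ω → S} {ξ : S → Coeff E}
  {Pr : ℕ → E → E} {j : ℝ} {α β : ℕ → ℝ} {θs ss : E} {B : ℝ}

open ContinuousLinearMap (adjoint)

/-- Convergence when `α / β → 0`. The Lyapunov coordinates move with the means of the
coefficients, which have to be of bounded variation. -/
theorem IsScheme.tendsto_of_twoTimeScale (h : IsScheme μ X ξ Pr j α β θs ss B)
    (hαβ : TwoTimeScale α β) {M : Coeff E}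
    (hM : Tendsto (fun t => ∫ x, ξ x ∂(μ.map (X t))) atTop (𝓝 M))
    (hMs : Summable fun t => ‖(∫ x, ξ x ∂(μ.map (X (t + 1)))) - ∫ x, ξ x ∂(μ.map (X t))‖)
    (hunit : IsUnit M.2.1)
    (hss : adjoint M.1 (Ring.inverse M.2.1 (M.2.2 - M.1 θs)) = ss)
    {m c : ℝ} (hm : 0 < m) (hc : 0 < c)
    (hcoer : ∀ v, m * ‖v‖ ^ 2 ≤ inner ℝ v (adjoint M.1 (Ring.inverse M.2.1 (M.1 v))))
    (hcov : ∀ v, c * ‖v‖ ^ 2 ≤ inner ℝ v (M.2.1 v))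
    {Z : ℕ → Ω → E × E} {z₀ : E × E} (hZ0 : ∀ ω, Z 0 ω = z₀)
    (hZ : ∀ t ω, Z (t + 1) ω = saStep Pr ξ j α β t (Z t ω) (X t ω)) :
    ∀ᵐ ω ∂μ, Tendsto (fun t => (Z t ω).1) atTop (𝓝 θs) := by
  set mean : ℕ → Coeff E := fun t => ∫ x, ξ x ∂(μ.map (X t)) with hmean
  set Ci : ℕ → E →L[ℝ] E := fun t => Ring.inverse (mean t).2.1 with hCi
  set G : ℕ → E →L[ℝ] E := fun t => Ci t * (mean t).1 with hG
  set p : ℕ → E := fun t => Ci t (mean t).2.2 with hp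
  have hA : Tendsto (fun t => (mean t).1) atTop (𝓝 M.1) := hM.fst_nhds
  have hC : Tendsto (fun t => (mean t).2.1) atTop (𝓝 M.2.1) := hM.snd_nhds.fst_nhds
  have hd : Tendsto (fun t => (mean t).2.2) atTop (𝓝 M.2.2) := hM.snd_nhds.snd_nhds
  have hCit : Tendsto Ci atTop (𝓝 (Ring.inverse M.2.1)) := by
    obtain ⟨u, hu⟩ := hunit
    have := NormedRing.inverse_continuousAt u
    rw [hu] at this
    exact this.tendsto.comp hC
  have hGt : Tendsto G atTop (𝓝 (Ring.inverse M.2.1 * M.1)) := hCit.mul hA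
  have hpt : Tendsto p atTop (𝓝 (Ring.inverse M.2.1 M.2.2)) := tendsto_clm_apply hCit hd
  have hinv : ∀ᶠ t in atTop, IsUnit (mean t).2.1 :=
    hC.eventually (Units.isOpen.mem_nhds hunit)
  obtain ⟨Γ₁, hΓ₁⟩ := exists_bound_of_tendsto hM
  obtain ⟨Γ₂, hΓ₂⟩ := exists_bound_of_tendsto hGt
  obtain ⟨Γ₃, hΓ₃⟩ := exists_bound_of_tendsto hpt
  obtain ⟨Γ₄, hΓ₄⟩ := exists_bound_of_tendsto hCit
  set Γ := max (max Γ₁ Γ₂) (max Γ₃ Γ₄) with hΓ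
  have b1 : ∀ t, ‖mean t‖ ≤ Γ := fun t => (hΓ₁ t).trans (by simp [hΓ])
  have b2 : ∀ t, ‖G t‖ ≤ Γ := fun t => (hΓ₂ t).trans (by simp [hΓ])
  have b3 : ∀ t, ‖p t‖ ≤ Γ := fun t => (hΓ₃ t).trans (by simp [hΓ])
  have b4 : ∀ t, ‖Ci t‖ ≤ Γ := fun t => (hΓ₄ t).trans (by simp [hΓ])
  have hΓ0 : 0 ≤ Γ := (norm_nonneg _).trans (b1 0)
  have hB : 0 ≤ B := (norm_nonneg _).trans h.norm_le
  -- bounded variation of the fast equilibria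
  have hν : Summable fun t => ‖G (t + 1) - G t‖ + ‖p (t + 1) - p t‖ := by
    refine Summable.of_norm_bounded_eventually_nat
      (hMs.mul_left (2 * (Γ ^ 2 * Γ + Γ))) ?_
    filter_upwards [hinv, (tendsto_add_atTop_nat 1).eventually hinv] with t ht ht'
    have hCd : ‖Ci (t + 1) - Ci t‖ ≤ Γ ^ 2 * ‖mean (t + 1) - mean t‖ := by
      have e1 : Ci (t + 1) - Ci t = Ci (t + 1) * ((mean t).2.1 - (mean (t + 1)).2.1) * Ci t := by
        rw [mul_sub, sub_mul, mul_assoc, Ring.mul_inverse_cancel _ ht, mul_one,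
          Ring.inverse_mul_cancel _ ht', one_mul]
      have e2 : ‖(mean t).2.1 - (mean (t + 1)).2.1‖ ≤ ‖mean (t + 1) - mean t‖ := by
        rw [norm_sub_rev]; exact Coeff.norm_cov_le (mean (t + 1) - mean t)
      rw [e1]
      calc _ ≤ ‖Ci (t + 1)‖ * ‖(mean t).2.1 - (mean (t + 1)).2.1‖ * ‖Ci t‖ :=
            (norm_mul_le _ _).trans (mul_le_mul_of_nonneg_right (norm_mul_le _ _) (norm_nonneg _))
        _ ≤ Γ * ‖mean (t + 1) - mean t‖ * Γ := by
            gcongr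
            · exact b4 _
            · exact b4 _
        _ = _ := by ring
    have hGd : ‖G (t + 1) - G t‖ ≤ (Γ ^ 2 * Γ + Γ) * ‖mean (t + 1) - mean t‖ := by
      have e1 : G (t + 1) - G t = (Ci (t + 1) - Ci t) * (mean (t + 1)).1
          + Ci t * ((mean (t + 1)).1 - (mean t).1) := by
        simp only [hG, sub_mul, mul_sub]; abel
      rw [e1]
      refine (norm_add_le _ _).trans ?_
      calc _ ≤ ‖Ci (t + 1) - Ci t‖ * ‖(mean (t + 1)).1‖
            + ‖Ci t‖ * ‖(mean (t + 1)).1 - (mean t).1‖ :=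
            add_le_add (norm_mul_le _ _) (norm_mul_le _ _)
        _ ≤ (Γ ^ 2 * ‖mean (t + 1) - mean t‖) * Γ + Γ * ‖mean (t + 1) - mean t‖ := by
            gcongr
            · exact (Coeff.norm_td_le _).trans (b1 _)
            · exact b4 _
            · exact Coeff.norm_td_le (mean (t + 1) - mean t)
        _ = _ := by ring
    have hpd : ‖p (t + 1) - p t‖ ≤ (Γ ^ 2 * Γ + Γ) * ‖mean (t + 1) - mean t‖ := by
      have e1 : p (t + 1) - p t = (Ci (t + 1) - Ci t) (mean (t + 1)).2.2
          + Ci t ((mean (t + 1)).2.2 - (mean t).2.2) := by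
        simp only [hp, _root_.sub_apply, map_sub]; abel
      rw [e1]
      refine (norm_add_le _ _).trans ?_
      calc _ ≤ ‖Ci (t + 1) - Ci t‖ * ‖(mean (t + 1)).2.2‖
            + ‖Ci t‖ * ‖(mean (t + 1)).2.2 - (mean t).2.2‖ :=
            add_le_add (ContinuousLinearMap.le_opNorm _ _) (ContinuousLinearMap.le_opNorm _ _)
        _ ≤ (Γ ^ 2 * ‖mean (t + 1) - mean t‖) * Γ + Γ * ‖mean (t + 1) - mean t‖ := by
            gcongr
            · exact (Coeff.norm_vec_le _).trans (b1 _)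
            · exact b4 _
            · exact Coeff.norm_vec_le (mean (t + 1) - mean t)
        _ = _ := by ring
    rw [Real.norm_of_nonneg (by positivity)]
    linarith
  obtain ⟨R, hR⟩ : ∃ R, ∀ t, α t ≤ R * β t := by
    obtain ⟨R, hR⟩ := exists_bound_of_tendsto hαβ
    refine ⟨R, fun t => ?_⟩
    rw [← div_le_iff₀ (h.fast_pos t)]
    exact (le_abs_self _).trans (hR t)
  set D := 2 * Γ + Γ * (B + 1 + Γ ^ 2 + 2 * Γ) + Γ * B with hD
  -- convergence of the averaged quantities
  have hAadj : Tendsto (fun t => adjoint (mean t).1) atTop (𝓝 (adjoint M.1)) :=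
    ((adjoint (𝕜 := ℝ) (E := E) (F := E)).continuous.tendsto _).comp hA
  have hepst : Tendsto (fun t => ‖ss - adjoint (mean t).1 (p t - G t θs)‖) atTop (𝓝 0) := by
    have h1 := (tendsto_const_nhds (x := ss)).sub
      (tendsto_clm_apply hAadj (hpt.sub (tendsto_clm_apply hGt (tendsto_const_nhds (x := θs)))))
    have h2 : ss - adjoint M.1 (Ring.inverse M.2.1 M.2.2 - (Ring.inverse M.2.1 * M.1) θs) = 0 := by
      rw [sub_eq_zero, ← hss, map_sub (Ring.inverse M.2.1)]; rfl
    rw [h2] at h1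
    simpa using h1.norm
  have hm' : ∀ᶠ t in atTop, ∀ v, m / 2 * ‖v‖ ^ 2 ≤ inner ℝ v (adjoint (mean t).1 (G t v)) := by
    have h1 : Tendsto (fun t => adjoint (mean t).1 * G t) atTop
        (𝓝 (adjoint M.1 * (Ring.inverse M.2.1 * M.1))) := hAadj.mul hGt
    rw [tendsto_iff_norm_sub_tendsto_zero] at h1
    filter_upwards [h1.eventually_lt_const (half_pos hm)] with t ht v
    have e1 := (neg_le_abs _).trans (abs_real_inner_le_norm v
      ((adjoint (mean t).1 * G t - adjoint M.1 * (Ring.inverse M.2.1 * M.1)) v))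
    have e2 := mul_le_mul_of_nonneg_left (ContinuousLinearMap.le_of_opNorm_le _ ht.le v)
      (norm_nonneg v)
    have e3 := hcoer v
    rw [_root_.sub_apply, inner_sub_right] at e1
    have e4 : inner ℝ v ((adjoint M.1 * (Ring.inverse M.2.1 * M.1)) v)
      = inner ℝ v (adjoint M.1 (Ring.inverse M.2.1 (M.1 v))) := rfl
    have e5 : inner ℝ v ((adjoint (mean t).1 * G t) v)
      = inner ℝ v (adjoint (mean t).1 (G t v)) := rfl
    rw [e4, e5] at e1
    rw [_root_.sub_apply] at e2
    change -(_) ≤ ‖v‖ * ‖(adjoint (mean t).1 * G t) v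
      - (adjoint M.1 * (Ring.inverse M.2.1 * M.1)) v‖ at e1
    linarith
  have hc' : ∀ᶠ t in atTop, ∀ v, c / 2 * ‖v‖ ^ 2 ≤ inner ℝ v ((mean t).2.1 v) := by
    have h1 := hC
    rw [tendsto_iff_norm_sub_tendsto_zero] at h1
    filter_upwards [h1.eventually_lt_const (half_pos hc)] with t ht v
    have e1 := (neg_le_abs _).trans (abs_real_inner_le_norm v (((mean t).2.1 - M.2.1) v))
    have e2 := mul_le_mul_of_nonneg_left (ContinuousLinearMap.le_of_opNorm_le _ ht.le v)
      (norm_nonneg v)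
    have e3 := hcov v
    rw [_root_.sub_apply, inner_sub_right] at e1
    rw [_root_.sub_apply] at e2
    linarith
  refine ae_tendsto_of_forall_ball fun δ hδ =>
    ⟨fun t ω => ‖lyap θs 1 (G t) (p t) (Z t ω)‖,
      fun t ω => norm_sub_le_norm_lyap θs zero_le_one _ _ _, ?_⟩
  -- the largest error that the ball of radius `δ` tolerates for the drift constant `m / 8`
  set ρ := m / 8 * δ ^ 2 / 2 with hρ
  have hρ0 : 0 < ρ := by positivity
  refine h.tendsto_ball hR b2 b3 hν one_pos (c := m / 8) (ρ := ρ) (by positivity) hδ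
    (by rw [hρ]; linarith) ?_ hZ0 hZ
  have hratio : ∀ᶠ t in atTop, α t * (2 * D ^ 2 / (m / 2) + D ^ 2 / (2 * ρ) + D + m / 2 / 4)
      ≤ β t * (c / 2) := by
    have h1 := hαβ.mul_const (2 * D ^ 2 / (m / 2) + D ^ 2 / (2 * ρ) + D + m / 2 / 4)
    rw [zero_mul] at h1
    filter_upwards [h1.eventually_lt_const (half_pos hc)] with t ht
    have := h.fast_pos t
    rw [div_mul_eq_mul_div, div_lt_iff₀ this] at ht
    linarith
  have hsm : ∀ᶠ t in atTop, ‖ss - adjoint (mean t).1 (p t - G t θs)‖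
      < min 1 (Real.sqrt (m / 2 * ρ / 4)) :=
    hepst.eventually_lt_const (lt_min one_pos (Real.sqrt_pos.2 (by positivity)))
  filter_upwards [hinv, hm', hc', hratio, hsm] with t t1 t2 t3 t4 t5 z
  have t5' := t5.trans_le (min_le_right _ _)
  have hsq : 4 * ‖ss - adjoint (mean t).1 (p t - G t θs)‖ ^ 2 ≤ m / 2 * ρ := by
    have := (Real.lt_sqrt (norm_nonneg _)).1 t5'
    linarith
  have hmd := meanDrift_le_of_twoTimeScale (θs := θs) (ss := ss) (p := p t) (j := j) (B := B)
    (α := α t) (β := β t) (Γ := Γ) (m := m / 2) (c := c / 2) (G := G t) (G' := G (t + 1))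
    (Ci := Ci t) (ξ := mean t)
    (fun v => by
      have := Ring.mul_inverse_cancel _ t1
      exact congrArg (fun T : E →L[ℝ] E => T v) this)
    rfl rfl h.abs_le_one (b1 t) (b2 t) (b2 _) h.norm_le le_rfl (t5.le.trans (min_le_left _ _))
    t2 t3 (h.slow_pos t).le (h.fast_pos t).le z
  refine hmd.trans ?_
  have hD' : 0 ≤ D := by positivity
  have := two_time_scale_bound (x := ‖z.1 - θs‖) (y := ‖z.2 - p t + G t z.1‖) (half_pos hm) hρ0
    (h.slow_pos t).le hsq t4
  rw [norm_sq_lyap θs zero_le_one, one_mul]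
  rw [← hD]
  have hle : m / 2 / 2 * ‖z.1 - θs‖ ^ 2 ≤ m / 2 * ‖z.1 - θs‖ ^ 2 := by
    nlinarith [sq_nonneg ‖z.1 - θs‖]
  have hle' := mul_le_mul_of_nonneg_left hle (h.slow_pos t).le
  linarith

/-- Convergence of GTD2 when `β` is a multiple of `α`. The Lyapunov coordinates are built from the
limit of the means, so that the means only need to converge. -/
theorem IsScheme.tendsto_of_oneTimeScale (h : IsScheme μ X ξ Pr 0 α β θs ss B)
    (hαβ : OneTimeScale α β) {M : Coeff E}
    (hM : Tendsto (fun t => ∫ x, ξ x ∂(μ.map (X t))) atTop (𝓝 M)) {ws : E}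
    (hws : M.2.1 ws = M.2.2 - M.1 θs) (hss : adjoint M.1 ws = ss)
    {m c : ℝ} (hm : 0 < m) (hc : 0 < c)
    (hcoer : ∀ v, m * ‖v‖ ^ 2 ≤ ‖M.1 v‖ ^ 2)
    (hcov : ∀ v, c * ‖v‖ ^ 2 ≤ inner ℝ v (M.2.1 v))
    {Z : ℕ → Ω → E × E} {z₀ : E × E} (hZ0 : ∀ ω, Z 0 ω = z₀)
    (hZ : ∀ t ω, Z (t + 1) ω = saStep Pr ξ 0 α β t (Z t ω) (X t ω)) :
    ∀ᵐ ω ∂μ, Tendsto (fun t => (Z t ω).1) atTop (𝓝 θs) := by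
  obtain ⟨κ, hκ, hβα⟩ := hαβ
  set K := κ⁻¹ with hK
  have hK0 : 0 < K := inv_pos.2 hκ
  have hKβ : ∀ t, K * β t = α t := fun t => by
    rw [hβα, hK, inv_mul_cancel_left₀ hκ.ne']
  have hB : 0 ≤ B := (norm_nonneg _).trans h.norm_le
  set D := ‖M.1‖ + ‖M.1‖ * ‖M.2.1‖ + K * ‖M.1‖ ^ 2 + K * (‖M.1‖ ^ 2 * ‖ws‖ + ‖M.1‖ * B) with hD
  have hD0 : 0 ≤ D := by positivity
  set Q := D ^ 2 / c + D ^ 4 / m with hQ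
  have hQ0 : 0 ≤ Q := by positivity
  set R := 1 + 2 * K * D ^ 2 + 2 * K with hRd
  have hR1 : 1 ≤ R := by rw [hRd]; linarith [show 0 ≤ 2 * K * D ^ 2 + 2 * K by positivity]
  refine ae_tendsto_of_forall_ball fun δ hδ => ?_
  -- the weight of the cross term, so small that the error of order `ε ^ 2` is below `ε * m * δ ^ 2`
  obtain ⟨ε, hε0, hε1, hεm, hεs, hεδ⟩ : ∃ ε : ℝ, 0 < ε ∧ ε ≤ 1 ∧ ε * m ≤ c ∧
      ε * ((D + D ^ 2) ^ 2 / m + D) ≤ c / 4 ∧ ε * (8 * R * (Q + 1)) ≤ m * δ ^ 2 := by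
    have hev : ∀ a b : ℝ, 0 < b → ∀ᶠ ε in 𝓝[>] (0 : ℝ), ε * a ≤ b := fun a b hb => by
      have h1 : Tendsto (fun ε : ℝ => ε * a) (𝓝[>] 0) (𝓝 0) := by
        have : Tendsto (fun ε : ℝ => ε * a) (𝓝 0) (𝓝 (0 * a)) := tendsto_id.mul_const a
        rw [zero_mul] at this
        exact this.mono_left nhdsWithin_le_nhds
      filter_upwards [h1.eventually_lt_const hb] with ε hε using hε.le
    obtain ⟨ε, ⟨⟨⟨⟨e1, e2⟩, e3⟩, e4⟩, e5⟩⟩ := ((((eventually_mem_nhdsWithin.and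
      (hev 1 1 one_pos)).and (hev m c hc)).and (hev ((D + D ^ 2) ^ 2 / m + D) (c / 4)
      (by positivity))).and (hev (8 * R * (Q + 1)) (m * δ ^ 2) (by positivity))).exists
    exact ⟨ε, e1, by simpa using e2, e3, e4, e5⟩
  set G : E →L[ℝ] E := ε • M.1 with hG
  set p : E := ws + ε • M.1 θs with hp
  refine ⟨fun t ω => ‖lyap θs K G p (Z t ω)‖,
      fun t ω => norm_sub_le_norm_lyap θs hK0.le _ _ _, ?_⟩
  set Γ := max ‖G‖ ‖p‖ with hΓ
  have hΓ0 : 0 ≤ Γ := (norm_nonneg _).trans (le_max_left _ _)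
  refine h.tendsto_ball (R := K) (G := fun _ => G) (p := fun _ => p) (Γ := Γ)
    (c := ε * m / (4 * R)) (ρ := ε ^ 2 * (Q + 1)) (fun t => (hKβ t).ge)
    (fun _ => le_max_left _ _) (fun _ => le_max_right _ _) (by simp) hK0
    (by positivity) hδ ?_ ?_ hZ0 hZ
  · rw [div_mul_eq_mul_div, le_div_iff₀ (by positivity)]
    have := mul_le_mul_of_nonneg_left hεδ hε0.le
    linarith
  obtain ⟨N, hN0, hN⟩ := exists_growth_lyap θs hK0 Γ hΓ0
  set H := (N + 1) * (2 + K * (κ + 2 * Γ) * (1 + K⁻¹)) with hH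
  have hτ : Tendsto (fun t => ‖(∫ x, ξ x ∂(μ.map (X t))) - M‖ * H) atTop (𝓝 0) := by
    have := (tendsto_iff_norm_sub_tendsto_zero.1 hM).mul_const H
    rwa [zero_mul] at this
  filter_upwards [hτ.eventually_lt_const (show 0 < min (ε * m / (4 * R)) (ε ^ 2) by positivity)]
    with t ht z
  set τ := ‖(∫ x, ξ x ∂(μ.map (X t))) - M‖ with hτd
  have hτ0 : 0 ≤ τ := norm_nonneg _
  have hα := (h.slow_pos t).le
  obtain ⟨d1, d2⟩ := meanDrift_le_of_oneTimeScale (θs := θs) (ss := ss) (ws := ws) (p := p) (K := K)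
    (B := B) (α := α t) (β := β t) (ε := ε) (m := m) (c := c) (D := D) (G := G) (ξ := M)
    hss hws hG hp hK0.le (hKβ t) hα hB hε0.le hm hε1 hc hεs
    (by rw [hD]; linarith [show 0 ≤ ‖M.1‖ * ‖M.2.1‖ + K * ‖M.1‖ ^ 2
      + K * (‖M.1‖ ^ 2 * ‖ws‖ + ‖M.1‖ * B) by positivity])
    (by rw [hD]; linarith [show 0 ≤ ‖M.1‖ + K * ‖M.1‖ ^ 2
      + K * (‖M.1‖ ^ 2 * ‖ws‖ + ‖M.1‖ * B) by positivity])
    (by rw [hD]; linarith [show 0 ≤ ‖M.1‖ + ‖M.1‖ * ‖M.2.1‖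
      + K * (‖M.1‖ ^ 2 * ‖ws‖ + ‖M.1‖ * B) by positivity])
    (by rw [hD]; linarith [show 0 ≤ ‖M.1‖ + ‖M.1‖ * ‖M.2.1‖ + K * ‖M.1‖ ^ 2 by positivity])
    hcoer hcov z
  have d3 := meanDrift_le_add (θs := θs) (ss := ss) (p := p) (K := K) (j := 0) (B := B)
    (G := G) (G' := G) hK0.le (by simp) hα (h.fast_pos t).le (hβα t).le
    (le_max_left ‖G‖ ‖p‖) hτd.ge z
  refine d3.trans ?_
  have hNz := hN G p (le_max_left _ _) (le_max_right _ _) z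
  have hL := norm_sq_lyap θs hK0.le G p z
  set W := ‖lyap θs K G p z‖ ^ 2 with hW
  set x := ‖z.1 - θs‖ with hx
  set v := ‖z.2 - ws‖ with hv
  set y := ‖z.2 - p + G z.1‖ with hy
  set n := 1 + ‖z.1‖ + ‖z.2‖ with hn
  have hn0 : 0 ≤ n := by positivity
  have hx0 : 0 ≤ x := norm_nonneg _
  have hy0 : 0 ≤ y := norm_nonneg _
  have hv0 : 0 ≤ v := norm_nonneg _
  have hKi : y ^ 2 = K⁻¹ * (K * y ^ 2) := by field_simp
  -- the quadratic form is comparable with the sum of squares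
  have hWR : W ≤ R * (x ^ 2 + v ^ 2) := by
    have e1 : y ^ 2 ≤ 2 * v ^ 2 + 2 * D ^ 2 * x ^ 2 := by
      have f1 : y ≤ v + D * x := by
        have : ε * D * x ≤ D * x := by
          rw [mul_assoc]; exact mul_le_of_le_one_left (by positivity) hε1
        linarith
      have f2 := pow_le_pow_left₀ hy0 f1 2
      linarith [sq_nonneg (v - D * x)]
    have e2 := mul_le_mul_of_nonneg_left e1 hK0.le
    rw [hL, hRd]
    linarith [mul_nonneg hK0.le (sq_nonneg x), sq_nonneg v,
      mul_nonneg (mul_nonneg hK0.le (sq_nonneg D)) (sq_nonneg v)]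
  have hmain : -(c / 2) * v ^ 2 - ε * (m / 2) * x ^ 2 ≤ -(ε * m / (2 * R)) * W := by
    have e1 := mul_le_mul_of_nonneg_left hWR (show 0 ≤ ε * m / (2 * R) by positivity)
    have e2 : ε * m / (2 * R) * (R * (x ^ 2 + v ^ 2)) = ε * m / 2 * (x ^ 2 + v ^ 2) := by
      field_simp
    have e3 := mul_le_mul_of_nonneg_right hεm (sq_nonneg v)
    linarith
  have herr : n * (2 * x + K * (κ + 2 * Γ) * y) ≤ H * (1 + W) := by
    have hW0 : 0 ≤ W := sq_nonneg _
    have f1 : x ^ 2 ≤ 1 + W := by linarith [mul_nonneg hK0.le (sq_nonneg y)]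
    have f2 : y ^ 2 ≤ K⁻¹ * (1 + W) := by
      rw [hKi]
      exact mul_le_mul_of_nonneg_left (by linarith [sq_nonneg x]) (by positivity)
    have g1 : n * x ≤ (N + 1) * (1 + W) := by
      linarith [sq_nonneg (n - x), sq_nonneg n, sq_nonneg x]
    have g2 : n * y ≤ (N + 1) * (1 + K⁻¹) * (1 + W) := by
      have k1 : 0 ≤ K⁻¹ := by positivity
      have k2 : n * y ≤ n ^ 2 + y ^ 2 := by
        linarith [sq_nonneg (n - y), sq_nonneg n, sq_nonneg y]
      have k3 : 0 ≤ (N * K⁻¹ + 1) * (1 + W) := by positivity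
      linarith
    have g3 := mul_le_mul_of_nonneg_left g2 (show 0 ≤ K * (κ + 2 * Γ) by positivity)
    rw [hH]
    linarith
  have hmul := mul_le_mul_of_nonneg_left herr hτ0
  have hτH := mul_le_mul_of_nonneg_right ht.le (show 0 ≤ 1 + W by positivity)
  have hmin : min (ε * m / (4 * R)) (ε ^ 2) * (1 + W) ≤ ε * m / (4 * R) * W + ε ^ 2 := by
    have := mul_le_mul_of_nonneg_right (min_le_left (ε * m / (4 * R)) (ε ^ 2))
      (show 0 ≤ W from sq_nonneg _)
    linarith [min_le_right (ε * m / (4 * R)) (ε ^ 2)]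
  have hhalf : ε * m / (2 * R) * W = 2 * (ε * m / (4 * R) * W) := by field_simp; ring
  have htot : (-(c / 2) * v ^ 2 - ε * (m / 2) * x ^ 2 + ε ^ 2 * Q)
      + τ * (n * (2 * x + K * (κ + 2 * Γ) * y)) ≤ -(ε * m / (4 * R) * W - ε ^ 2 * (Q + 1)) := by
    linarith
  have := mul_le_mul_of_nonneg_left htot hα
  linarith

end

/-! ### Coercive operators -/

theorem exists_coercive_of_pos {E : Type*} [NormedAddCommGroup E] [InnerProductSpace ℝ E]
    [FiniteDimensional ℝ E] (T : E →L[ℝ] E) (hT : ∀ v, v ≠ 0 → 0 < inner ℝ v (T v)) :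
    ∃ m : ℝ, 0 < m ∧ ∀ v, m * ‖v‖ ^ 2 ≤ inner ℝ v (T v) := by
  rcases subsingleton_or_nontrivial E with hE | hE
  · exact ⟨1, one_pos, fun v => by simp [Subsingleton.elim v 0]⟩
  have hcont : Continuous fun v : E => inner ℝ v (T v) := continuous_id.inner T.continuous
  obtain ⟨u, hu, hmin⟩ := (isCompact_sphere (0 : E) 1).exists_isMinOn
    (NormedSpace.sphere_nonempty.2 zero_le_one) hcont.continuousOn
  have hu1 : ‖u‖ = 1 := by simpa using hu
  refine ⟨inner ℝ u (T u), hT u (fun h => by simp [h] at hu1), fun v => ?_⟩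
  rcases eq_or_ne v 0 with rfl | hv
  · simp
  have hv0 : 0 < ‖v‖ := norm_pos_iff.2 hv
  have h1 : inner ℝ u (T u) ≤ inner ℝ (‖v‖⁻¹ • v) (T (‖v‖⁻¹ • v)) :=
    hmin (by simp [norm_smul, hv0.ne'])
  rw [map_smul, real_inner_smul_left, real_inner_smul_right] at h1
  have h2 := mul_le_mul_of_nonneg_right h1 (sq_nonneg ‖v‖)
  have h3 : ‖v‖⁻¹ * (‖v‖⁻¹ * inner ℝ v (T v)) * ‖v‖ ^ 2 = inner ℝ v (T v) := by
    field_simp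
  rwa [h3] at h2

/-! ### Soft thresholding -/

section SoftThreshold

variable {k : ℕ}

/-- `s` is a subgradient of `η ‖·‖₁` at `θ`, for `η ≥ 0`: entrywise `|s i| ≤ η`, with equality and
the sign of `θ i` where `θ i ≠ 0`. -/
def IsL1Subgradient (η : ℝ) (θ s : EuclideanSpace ℝ (Fin k)) : Prop :=
  ∀ i, |s i| ≤ η ∧ s i * θ i = η * |θ i|

/-- The subdifferential of the `ℓ¹` norm is monotone. -/
theorem IsL1Subgradient.inner_nonneg {η : ℝ} {θ s θ' s' : EuclideanSpace ℝ (Fin k)}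
    (h : IsL1Subgradient η θ s) (h' : IsL1Subgradient η θ' s') :
    0 ≤ inner ℝ (θ - θ') (s - s') := by
  rw [EuclideanSpace.inner_eq_star_dotProduct]
  simp only [star_trivial, dotProduct, WithLp.ofLp_sub, Pi.sub_apply]
  refine Finset.sum_nonneg fun i _ => ?_
  obtain ⟨h1, h2⟩ := h i
  obtain ⟨h3, h4⟩ := h' i
  have e1 : s i * θ' i ≤ η * |θ' i| :=
    (le_abs_self _).trans (by rw [abs_mul]; exact mul_le_mul_of_nonneg_right h1 (abs_nonneg _))
  have e2 : s' i * θ i ≤ η * |θ i| :=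
    (le_abs_self _).trans (by rw [abs_mul]; exact mul_le_mul_of_nonneg_right h3 (abs_nonneg _))
  linarith

theorem IsL1Subgradient.norm_le {η : ℝ} (hη : 0 ≤ η) {θ s : EuclideanSpace ℝ (Fin k)}
    (h : IsL1Subgradient η θ s) : ‖s‖ ≤ √k * η := by
  rw [← Real.sqrt_sq hη, ← Real.sqrt_mul (Nat.cast_nonneg k), EuclideanSpace.norm_eq]
  refine Real.sqrt_le_sqrt ?_
  calc ∑ i, ‖s i‖ ^ 2 ≤ ∑ _i : Fin k, η ^ 2 :=
        Finset.sum_le_sum fun i _ => pow_le_pow_left₀ (norm_nonneg _) (h i).1 2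
    _ = k * η ^ 2 := by simp

theorem softThreshold_spec {ν : ℝ} (hν : 0 ≤ ν) (x : Fin k → ℝ) (i : Fin k) :
    |x i - softThreshold ν x i| ≤ ν ∧
      (x i - softThreshold ν x i) * softThreshold ν x i = ν * |softThreshold ν x i| := by
  simp only [softThreshold]
  rcases lt_trichotomy (x i) 0 with h | h | h
  · rw [Real.sign_of_neg h, abs_of_neg h]
    rcases le_total ν (-x i) with h1 | h1
    · rw [max_eq_left (by linarith)]
      have e1 : x i - -1 * (-x i - ν) = -ν := by ring
      rw [e1, abs_neg, abs_of_nonneg hν, abs_of_nonpos (by linarith)]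
      exact ⟨le_rfl, by ring⟩
    · rw [max_eq_right (by linarith)]
      simp [abs_of_neg h, h1]
  · simp [h, hν]
  · rw [Real.sign_of_pos h, abs_of_pos h]
    rcases le_total ν (x i) with h1 | h1
    · rw [max_eq_left (by linarith)]
      have e1 : x i - 1 * (x i - ν) = ν := by ring
      rw [e1, abs_of_nonneg hν, abs_of_nonneg (by linarith)]
      exact ⟨le_rfl, by ring⟩
    · rw [max_eq_right (by linarith)]
      simp [abs_of_pos h, h1]

/-- Soft thresholding as a map on Euclidean space. -/
noncomputable def shrink (ν : ℝ) (u : EuclideanSpace ℝ (Fin k)) : EuclideanSpace ℝ (Fin k) :=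
  WithLp.toLp 2 (softThreshold ν (WithLp.ofLp u))

/-- Soft thresholding is the proximal map of the `ℓ¹` norm. -/
theorem exists_shrink_eq {α η : ℝ} (hα : 0 < α) (hη : 0 ≤ η) (u : EuclideanSpace ℝ (Fin k)) :
    ∃ s, shrink (α * η) u = u - α • s ∧ IsL1Subgradient η (shrink (α * η) u) s := by
  refine ⟨α⁻¹ • (u - shrink (α * η) u), ?_, fun i => ?_⟩
  · rw [smul_inv_smul₀ hα.ne']; abel
  · obtain ⟨h1, h2⟩ := softThreshold_spec (mul_nonneg hα.le hη) (WithLp.ofLp u) i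
    simp only [PiLp.smul_apply, PiLp.sub_apply, shrink, smul_eq_mul]
    rw [abs_mul, abs_of_pos (inv_pos.2 hα)]
    constructor
    · rw [inv_mul_le_iff₀ hα]; exact h1
    · rw [mul_assoc, h2, mul_assoc, inv_mul_cancel_left₀ hα.ne']

theorem norm_shrink_sub_le {ν : ℝ} (hν : 0 ≤ ν) (u v : EuclideanSpace ℝ (Fin k)) :
    ‖shrink ν u - shrink ν v‖ ≤ ‖u - v‖ := by
  obtain ⟨s, hs, hs'⟩ := exists_shrink_eq one_pos hν u
  obtain ⟨r, hr, hr'⟩ := exists_shrink_eq one_pos hν v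
  have h := hs'.inner_nonneg hr'
  rw [one_mul, one_smul] at hs hr
  rw [one_mul] at h
  have e1 : s - r = (u - v) - (shrink ν u - shrink ν v) := by rw [hs, hr]; abel
  rw [e1, inner_sub_right, real_inner_self_eq_norm_sq] at h
  have h2 := real_inner_le_norm (shrink ν u - shrink ν v) (u - v)
  by_contra hlt
  push Not at hlt
  nlinarith [norm_nonneg (u - v)]

theorem continuous_shrink {ν : ℝ} (hν : 0 ≤ ν) :
    Continuous (shrink ν : EuclideanSpace ℝ (Fin k) → EuclideanSpace ℝ (Fin k)) :=
  (LipschitzWith.of_dist_le_mul (K := 1) fun u v => by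
    rw [dist_eq_norm, dist_eq_norm, NNReal.coe_one, one_mul]
    exact norm_shrink_sub_le hν u v).continuous

/-- The optimality condition `b - Q θ ∈ η ∂‖·‖₁(θ)` for a coercive `Q` is solvable: a small step
of the proximal gradient map is a contraction. -/
theorem exists_regularized_solution {η : ℝ} (hη : 0 ≤ η)
    (Q : EuclideanSpace ℝ (Fin k) →L[ℝ] EuclideanSpace ℝ (Fin k)) (b : EuclideanSpace ℝ (Fin k))
    {m : ℝ} (hm : 0 < m) (hQ : ∀ v, m * ‖v‖ ^ 2 ≤ inner ℝ v (Q v)) :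
    ∃ θ, IsL1Subgradient η θ (b - Q θ) := by
  -- `l` is a positive bound of `‖Q‖`; the step size `a` minimizes the bound `1 - 2 a m + a² l²`
  -- of the squared contraction factor
  set l := ‖Q‖ + 1 with hl
  have hl0 : 0 < l := by positivity
  set a := m / l ^ 2 with ha
  have ha0 : 0 < a := by positivity
  set q := 1 - m ^ 2 / l ^ 2 with hq
  have hq1 : q < 1 := by rw [hq]; linarith [show 0 < m ^ 2 / l ^ 2 by positivity]
  have hcontr : ∀ v : EuclideanSpace ℝ (Fin k), ‖v - a • Q v‖ ≤ √q * ‖v‖ := by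
    intro v
    have h1 : ‖v - a • Q v‖ ^ 2 ≤ q * ‖v‖ ^ 2 := by
      rw [norm_sub_sq_real, real_inner_smul_right, norm_smul, Real.norm_of_nonneg ha0.le]
      have h2 : ‖Q v‖ ≤ l * ‖v‖ := Q.le_of_opNorm_le (by rw [hl]; linarith) v
      have h3 := pow_le_pow_left₀ (norm_nonneg _) h2 2
      have h4 := mul_le_mul_of_nonneg_left (hQ v) ha0.le
      have h5 := mul_le_mul_of_nonneg_left h3 (sq_nonneg a)
      have h6 : a ^ 2 * (l * ‖v‖) ^ 2 = m ^ 2 / l ^ 2 * ‖v‖ ^ 2 := by rw [ha]; field_simp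
      have h7 : a * (m * ‖v‖ ^ 2) = m ^ 2 / l ^ 2 * ‖v‖ ^ 2 := by rw [ha]; field_simp
      rw [h6] at h5
      rw [h7] at h4
      rw [hq]
      linarith
    have h2 := Real.abs_le_sqrt h1
    rwa [abs_of_nonneg (norm_nonneg _), Real.sqrt_mul' _ (sq_nonneg _),
      Real.sqrt_sq (norm_nonneg _)] at h2
  set f : EuclideanSpace ℝ (Fin k) → EuclideanSpace ℝ (Fin k) :=
    fun θ => shrink (a * η) (θ - a • (Q θ - b)) with hf
  have hcw : ContractingWith (Real.toNNReal √q) f := by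
    refine ⟨?_, LipschitzWith.of_dist_le_mul fun u v => ?_⟩
    · rw [← NNReal.coe_lt_coe, Real.coe_toNNReal _ (Real.sqrt_nonneg _), NNReal.coe_one,
        Real.sqrt_lt' one_pos]
      simpa using hq1
    · rw [Real.coe_toNNReal _ (Real.sqrt_nonneg _), dist_eq_norm, dist_eq_norm]
      refine (norm_shrink_sub_le (by positivity) _ _).trans ?_
      have : u - a • (Q u - b) - (v - a • (Q v - b)) = (u - v) - a • Q (u - v) := by
        rw [map_sub]; module
      rw [this]
      exact hcontr _
  have hfix := hcw.fixedPoint_isFixedPt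
  set θ := ContractingWith.fixedPoint f hcw with hθ
  have hfix' : shrink (a * η) (θ - a • (Q θ - b)) = θ := hfix
  obtain ⟨s, hs, hs'⟩ := exists_shrink_eq ha0 hη (θ - a • (Q θ - b))
  rw [hfix'] at hs hs'
  refine ⟨θ, ?_⟩
  have : a • (b - Q θ) = a • s := by
    have h1 : a • (b - Q θ) - a • s = (θ - a • (Q θ - b) - a • s) - θ := by module
    rw [← sub_eq_zero, h1]
    exact sub_eq_zero.2 hs.symm
  rw [smul_right_injective _ ha0.ne' this]
  exact hs'

end SoftThreshold

/-! ### Samples as coefficients -/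

section Coefficients

variable {k : ℕ}

open ContinuousLinearMap (adjoint)
open InnerProductSpace (rankOne)

/-- The coefficients `(φ(φ - γφ')ᵀ, φφᵀ, rφ)` of a sample, as operators on Euclidean space. -/
noncomputable def sampleCoeff (γ : ℝ) (x : Sample k) : Coeff (EuclideanSpace ℝ (Fin k)) :=
  (rankOne ℝ (WithLp.toLp 2 x.1) (WithLp.toLp 2 (x.1 - γ • x.2.2)),
    rankOne ℝ (WithLp.toLp 2 x.1) (WithLp.toLp 2 x.1), x.2.1 • WithLp.toLp 2 x.1)

theorem inner_toLp (u : Fin k → ℝ) (v : EuclideanSpace ℝ (Fin k)) :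
    inner ℝ (WithLp.toLp 2 u) v = u ⬝ᵥ WithLp.ofLp v := by
  rw [EuclideanSpace.inner_eq_star_dotProduct, star_trivial, dotProduct_comm]

theorem residual_sampleCoeff (γ : ℝ) (x : Sample k)
    (z : EuclideanSpace ℝ (Fin k) × EuclideanSpace ℝ (Fin k)) :
    residual z (sampleCoeff γ x) = WithLp.toLp 2
      ((tdError γ (WithLp.ofLp z.1) x - x.1 ⬝ᵥ WithLp.ofLp z.2) • x.1) := by
  rw [residual_apply]
  simp only [sampleCoeff, InnerProductSpace.rankOne_apply, inner_toLp]
  rw [← sub_smul, ← sub_smul, ← WithLp.toLp_smul]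
  congr 2
  rw [tdError, dotProduct_comm (WithLp.ofLp z.1), ← neg_sub x.1, neg_dotProduct]
  ring

theorem gradient_sampleCoeff (j γ : ℝ) (x : Sample k)
    (z : EuclideanSpace ℝ (Fin k) × EuclideanSpace ℝ (Fin k)) :
    gradient j z (sampleCoeff γ x) = WithLp.toLp 2
      ((x.1 ⬝ᵥ WithLp.ofLp z.2) • (γ • x.2.2 - x.1)
        - j • (tdError γ (WithLp.ofLp z.1) x - x.1 ⬝ᵥ WithLp.ofLp z.2) • x.1) := by
  rw [gradient_apply, residual_sampleCoeff]
  simp only [sampleCoeff, InnerProductSpace.adjoint_rankOne, InnerProductSpace.rankOne_apply,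
    inner_toLp]
  rw [← WithLp.toLp_smul, ← WithLp.toLp_smul, ← WithLp.toLp_add, ← WithLp.toLp_neg]
  congr 1
  module

theorem gradient_zero_sampleCoeff (γ : ℝ) (x : Sample k)
    (z : EuclideanSpace ℝ (Fin k) × EuclideanSpace ℝ (Fin k)) :
    gradient 0 z (sampleCoeff γ x)
      = WithLp.toLp 2 (gtd2Grad γ (WithLp.ofLp z.1) (WithLp.ofLp z.2) x) := by
  rw [gradient_sampleCoeff, zero_smul, sub_zero, gtd2Grad]

theorem gradient_one_sampleCoeff (γ : ℝ) (x : Sample k)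
    (z : EuclideanSpace ℝ (Fin k) × EuclideanSpace ℝ (Fin k)) :
    gradient 1 z (sampleCoeff γ x)
      = WithLp.toLp 2 (tdcGrad γ (WithLp.ofLp z.1) (WithLp.ofLp z.2) x) := by
  rw [gradient_sampleCoeff, tdcGrad]
  congr 1
  module

theorem continuous_sampleCoeff (γ : ℝ) : Continuous (sampleCoeff γ : Sample k → _) := by
  have h1 : Continuous fun x : Sample k => (WithLp.toLp 2 x.1 : EuclideanSpace ℝ (Fin k)) :=
    (PiLp.continuous_toLp 2 _).comp continuous_fst
  have h2 : Continuous fun x : Sample k =>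
      (WithLp.toLp 2 (x.1 - γ • x.2.2) : EuclideanSpace ℝ (Fin k)) :=
    (PiLp.continuous_toLp 2 _).comp (by fun_prop)
  have hr : ∀ {f g : Sample k → EuclideanSpace ℝ (Fin k)}, Continuous f → Continuous g →
      Continuous fun x => rankOne ℝ (f x) (g x) := fun {f g} hf hg => by
    have e1 : Continuous fun x => rankOne ℝ (F := EuclideanSpace ℝ (Fin k)) (f x) :=
      (rankOne ℝ).continuous.comp hf
    exact e1.clm_apply hg
  exact (hr h1 h2).prodMk ((hr h1 h1).prodMk ((continuous_fst.comp continuous_snd).smul h1))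

theorem sampleCoeff_zero (γ : ℝ) : sampleCoeff γ (0 : Sample k) = 0 := by
  simp [sampleCoeff]

theorem norm_sampleCoeff_le (γ : ℝ) (x : Sample k) :
    ‖sampleCoeff γ x‖ ≤ ‖(WithLp.toLp 2 x.1 : EuclideanSpace ℝ (Fin k))‖
        * ‖(WithLp.toLp 2 x.1 : EuclideanSpace ℝ (Fin k))‖
      + |γ| * (‖(WithLp.toLp 2 x.1 : EuclideanSpace ℝ (Fin k))‖
        * ‖(WithLp.toLp 2 x.2.2 : EuclideanSpace ℝ (Fin k))‖)
      + |x.2.1| * ‖(WithLp.toLp 2 x.1 : EuclideanSpace ℝ (Fin k))‖ := by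
  set a := ‖(WithLp.toLp 2 x.1 : EuclideanSpace ℝ (Fin k))‖ with ha
  set b := ‖(WithLp.toLp 2 x.2.2 : EuclideanSpace ℝ (Fin k))‖ with hb
  have ha0 : 0 ≤ a := norm_nonneg _
  have hb0 : 0 ≤ b := norm_nonneg _
  have hs : ‖(WithLp.toLp 2 (x.1 - γ • x.2.2) : EuclideanSpace ℝ (Fin k))‖ ≤ a + |γ| * b := by
    rw [WithLp.toLp_sub, WithLp.toLp_smul]
    refine (norm_sub_le _ _).trans (add_le_add le_rfl ?_)
    rw [norm_smul, Real.norm_eq_abs]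
  rw [sampleCoeff, norm_prod_le_iff, norm_prod_le_iff, InnerProductSpace.norm_rankOne,
    InnerProductSpace.norm_rankOne, norm_smul, Real.norm_eq_abs, ← ha]
  have e1 := mul_le_mul_of_nonneg_left hs ha0
  have e2 : 0 ≤ |γ| * (a * b) := by positivity
  have e3 : 0 ≤ |x.2.1| * a := by positivity
  have e4 : 0 ≤ a * a := by positivity
  refine ⟨?_, ?_, ?_⟩ <;> linarith

/-- The pair of iterates `(θ_t, w_t)` in Euclidean space. -/
noncomputable def iteratePair (grad : (Fin k → ℝ) → (Fin k → ℝ) → Sample k → (Fin k → ℝ))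
    (γ η : ℝ) (α β : ℕ → ℝ) (θ₀ w₀ : Fin k → ℝ) (x : ℕ → Sample k) (t : ℕ) :
    EuclideanSpace ℝ (Fin k) × EuclideanSpace ℝ (Fin k) :=
  (WithLp.toLp 2 (iterates grad γ η α β x θ₀ w₀ t).1,
    WithLp.toLp 2 (iterates grad γ η α β x θ₀ w₀ t).2)

/-- The iterates follow the recursion `saStep`, provided that `grad` is the gradient with
parameter `j`. -/
theorem iteratePair_succ {grad : (Fin k → ℝ) → (Fin k → ℝ) → Sample k → (Fin k → ℝ)} {j γ : ℝ}
    (hgrad : ∀ z x, gradient j z (sampleCoeff γ x)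
      = WithLp.toLp 2 (grad (WithLp.ofLp z.1) (WithLp.ofLp z.2) x))
    (η : ℝ) (α β : ℕ → ℝ) (θ₀ w₀ : Fin k → ℝ) (x : ℕ → Sample k) (t : ℕ) :
    iteratePair grad γ η α β θ₀ w₀ x (t + 1)
      = saStep (fun t => shrink (α t * η)) (sampleCoeff γ) j α β t
          (iteratePair grad γ η α β θ₀ w₀ x t) (x t) := by
  simp only [saStep, hgrad, residual_sampleCoeff, iteratePair, shrink, iterates, mul_smul,
    WithLp.toLp_add, WithLp.toLp_smul, WithLp.ofLp_sub, WithLp.ofLp_smul]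

theorem measurable_saStep {α : ℕ → ℝ} {η : ℝ} (hα : ∀ t, 0 < α t) (hη : 0 ≤ η) (γ j : ℝ)
    (β : ℕ → ℝ) (t : ℕ) :
    Measurable (Function.uncurry (saStep (fun t => shrink (α t * η))
      (sampleCoeff γ : Sample k → _) j α β t)) := by
  have hL : Continuous fun v : Fin k → ℝ => (WithLp.toLp 2 v : EuclideanSpace ℝ (Fin k)) :=
    PiLp.continuous_toLp 2 _
  have hO : Continuous fun v : EuclideanSpace ℝ (Fin k) => WithLp.ofLp v :=
    PiLp.continuous_ofLp 2 _
  refine Continuous.measurable ?_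
  have hq : Continuous fun p : (EuclideanSpace ℝ (Fin k) × EuclideanSpace ℝ (Fin k)) × Sample k =>
      residual p.1 (sampleCoeff γ p.2) := by
    simp only [residual_sampleCoeff, tdError, dotProduct]
    refine hL.comp ?_
    fun_prop
  have hg : Continuous fun p : (EuclideanSpace ℝ (Fin k) × EuclideanSpace ℝ (Fin k)) × Sample k =>
      gradient j p.1 (sampleCoeff γ p.2) := by
    simp only [gradient_sampleCoeff, tdError, dotProduct]
    refine hL.comp ?_
    fun_prop
  have hs := continuous_shrink (k := k) (mul_nonneg (hα t).le hη)
  exact (hs.comp (continuous_fst.fst.sub (hg.const_smul (α t)))).prodMk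
    (continuous_fst.snd.add (hq.const_smul (β t)))

end Coefficients

/-! ### The regularized problem -/

section Problem

variable {Ω : Type*} [MeasurableSpace Ω] {k : ℕ} {μ : Measure Ω} {γ : ℝ} {X : Ω → Sample k}

open ContinuousLinearMap (adjoint)

theorem meanCoeff_cov (h : Integrable (fun ω => sampleCoeff γ (X ω)) μ) :
    (∫ ω, sampleCoeff γ (X ω) ∂μ).2.1 = Matrix.toEuclideanCLM (𝕜 := ℝ) (featureCov μ X) := by
  refine ContinuousLinearMap.coe_injective
    ((EuclideanSpace.basisFun (Fin k) ℝ).toBasis.ext fun j => ?_)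
  ext i
  have := ((EuclideanSpace.proj i : EuclideanSpace ℝ (Fin k) →L[ℝ] ℝ) ∘L
    (ContinuousLinearMap.apply ℝ (EuclideanSpace ℝ (Fin k)) (EuclideanSpace.single j (1 : ℝ))) ∘L
    (ContinuousLinearMap.fst ℝ _ _) ∘L
    (ContinuousLinearMap.snd ℝ (EuclideanSpace ℝ (Fin k) →L[ℝ] EuclideanSpace ℝ (Fin k))
      _)).integral_comp_comm h
  simp only [ContinuousLinearMap.comp_apply, ContinuousLinearMap.apply_apply,
    ContinuousLinearMap.coe_fst', ContinuousLinearMap.coe_snd', PiLp.proj_apply] at this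
  simp only [OrthonormalBasis.coe_toBasis, EuclideanSpace.basisFun_apply,
    ContinuousLinearMap.coe_coe, Matrix.ofLp_toEuclideanCLM]
  rw [← this]
  simp [sampleCoeff, featureCov, inner_toLp, mul_comm]

theorem meanCoeff_td (h : Integrable (fun ω => sampleCoeff γ (X ω)) μ) :
    (∫ ω, sampleCoeff γ (X ω) ∂μ).1 = Matrix.toEuclideanCLM (𝕜 := ℝ) (tdMatrix μ γ X) := by
  refine ContinuousLinearMap.coe_injective
    ((EuclideanSpace.basisFun (Fin k) ℝ).toBasis.ext fun j => ?_)
  ext i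
  have := ((EuclideanSpace.proj i : EuclideanSpace ℝ (Fin k) →L[ℝ] ℝ) ∘L
    (ContinuousLinearMap.apply ℝ (EuclideanSpace ℝ (Fin k)) (EuclideanSpace.single j (1 : ℝ))) ∘L
    (ContinuousLinearMap.fst ℝ (EuclideanSpace ℝ (Fin k) →L[ℝ] EuclideanSpace ℝ (Fin k))
      _)).integral_comp_comm h
  simp only [ContinuousLinearMap.comp_apply, ContinuousLinearMap.apply_apply,
    ContinuousLinearMap.coe_fst', PiLp.proj_apply] at this
  simp only [OrthonormalBasis.coe_toBasis, EuclideanSpace.basisFun_apply,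
    ContinuousLinearMap.coe_coe, Matrix.ofLp_toEuclideanCLM]
  rw [← this]
  simp only [sampleCoeff, tdMatrix, inner_toLp, InnerProductSpace.rankOne_apply]
  simp [mul_comm ((X _).1 i)]

theorem expectedTDUpdate_eq (h : Integrable (fun ω => sampleCoeff γ (X ω)) μ) (θ : Fin k → ℝ) :
    WithLp.toLp 2 (expectedTDUpdate μ γ X θ)
      = (∫ ω, sampleCoeff γ (X ω) ∂μ).2.2
        - (∫ ω, sampleCoeff γ (X ω) ∂μ).1 (WithLp.toLp 2 θ) := by
  have h0 := residual_apply ((WithLp.toLp 2 θ : EuclideanSpace ℝ (Fin k)), 0)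
    (∫ ω, sampleCoeff γ (X ω) ∂μ)
  simp only [map_zero, sub_zero] at h0
  rw [← h0]
  ext i
  have := ((EuclideanSpace.proj i : EuclideanSpace ℝ (Fin k) →L[ℝ] ℝ) ∘L
    LinearMap.toContinuousLinearMap
      (residual ((WithLp.toLp 2 θ : EuclideanSpace ℝ (Fin k)), 0))).integral_comp_comm h
  simp only [ContinuousLinearMap.comp_apply, PiLp.proj_apply,
    LinearMap.coe_toContinuousLinearMap'] at this
  rw [← this]
  simp [residual_sampleCoeff, expectedTDUpdate]

theorem inner_meanCoeff_cov (h : Integrable (fun ω => sampleCoeff γ (X ω)) μ)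
    (u v : EuclideanSpace ℝ (Fin k)) :
    Integrable (fun ω => inner ℝ (WithLp.toLp 2 (X ω).1) u * inner ℝ (WithLp.toLp 2 (X ω).1) v) μ ∧
    inner ℝ u ((∫ ω, sampleCoeff γ (X ω) ∂μ).2.1 v)
      = ∫ ω, inner ℝ (WithLp.toLp 2 (X ω).1) u * inner ℝ (WithLp.toLp 2 (X ω).1) v ∂μ := by
  set ℓ := ((innerSL ℝ u) ∘L (ContinuousLinearMap.apply ℝ (EuclideanSpace ℝ (Fin k)) v) ∘L
    (ContinuousLinearMap.fst ℝ _ (EuclideanSpace ℝ (Fin k))) ∘L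
    (ContinuousLinearMap.snd ℝ (EuclideanSpace ℝ (Fin k) →L[ℝ] EuclideanSpace ℝ (Fin k)) _))
    with hℓ
  have e : ∀ ω, ℓ (sampleCoeff γ (X ω))
      = inner ℝ (WithLp.toLp 2 (X ω).1) u * inner ℝ (WithLp.toLp 2 (X ω).1) v := fun ω => by
    simp only [hℓ, ContinuousLinearMap.comp_apply, ContinuousLinearMap.apply_apply,
      ContinuousLinearMap.coe_fst', ContinuousLinearMap.coe_snd', innerSL_apply_apply, sampleCoeff,
      InnerProductSpace.rankOne_apply, real_inner_smul_right]
    rw [real_inner_comm u, mul_comm]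
  have h1 := ℓ.integral_comp_comm h
  have h2 := ℓ.integrable_comp h
  simp only [e] at h1 h2
  exact ⟨h2, h1.symm⟩

/-- The covariance operator is positive definite as soon as it is invertible, being positive
semidefinite. -/
theorem meanCoeff_cov_pos (h : Integrable (fun ω => sampleCoeff γ (X ω)) μ)
    (hC : IsUnit (∫ ω, sampleCoeff γ (X ω) ∂μ).2.1) (v : EuclideanSpace ℝ (Fin k)) (hv : v ≠ 0) :
    0 < inner ℝ v ((∫ ω, sampleCoeff γ (X ω) ∂μ).2.1 v) := by
  obtain ⟨hi, he⟩ := inner_meanCoeff_cov h v v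
  rw [he]
  have hnn : ∀ ω, 0 ≤ inner ℝ (WithLp.toLp 2 (X ω).1) v * inner ℝ (WithLp.toLp 2 (X ω).1) v :=
    fun ω => mul_self_nonneg _
  refine (integral_nonneg hnn).lt_of_ne' fun h0 => hv ?_
  rw [integral_eq_zero_iff_of_nonneg hnn hi] at h0
  -- the form vanishes at `v` only if `v` is in the kernel of the covariance operator
  have h1 : (∫ ω, sampleCoeff γ (X ω) ∂μ).2.1 v = 0 := by
    refine ext_inner_left ℝ fun u => ?_
    rw [(inner_meanCoeff_cov h u v).2, inner_zero_right]
    refine integral_eq_zero_of_ae ?_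
    filter_upwards [h0] with ω hω
    have := mul_self_eq_zero.1 hω
    simp [this]
  have h2 := congrArg (fun T : EuclideanSpace ℝ (Fin k) →L[ℝ] EuclideanSpace ℝ (Fin k) => T v)
    (Ring.inverse_mul_cancel _ hC)
  simp only [ContinuousLinearMap.mul_def, ContinuousLinearMap.comp_apply, h1, map_zero,
    one_apply_eq_self] at h2
  exact h2.symm

theorem mspbe_eq (h : Integrable (fun ω => sampleCoeff γ (X ω)) μ)
    (hC : IsUnit (featureCov μ X)) (θ : Fin k → ℝ) :
    mspbe μ γ X θ = 1 / 2 * inner ℝ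
      ((∫ ω, sampleCoeff γ (X ω) ∂μ).2.2 - (∫ ω, sampleCoeff γ (X ω) ∂μ).1 (WithLp.toLp 2 θ))
      (Ring.inverse (∫ ω, sampleCoeff γ (X ω) ∂μ).2.1 ((∫ ω, sampleCoeff γ (X ω) ∂μ).2.2
        - (∫ ω, sampleCoeff γ (X ω) ∂μ).1 (WithLp.toLp 2 θ))) := by
  have hinv : Ring.inverse (∫ ω, sampleCoeff γ (X ω) ∂μ).2.1
      = Matrix.toEuclideanCLM (𝕜 := ℝ) (featureCov μ X)⁻¹ := by
    rw [meanCoeff_cov h]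
    have hu := hC.map (Matrix.toEuclideanCLM (n := Fin k) (𝕜 := ℝ))
    have h1 : Matrix.toEuclideanCLM (𝕜 := ℝ) (featureCov μ X)
        * Matrix.toEuclideanCLM (𝕜 := ℝ) (featureCov μ X)⁻¹ = 1 := by
      rw [← map_mul, Matrix.mul_nonsing_inv _ ((Matrix.isUnit_iff_isUnit_det _).1 hC), map_one]
    rw [← mul_one (Ring.inverse _), ← h1, Ring.inverse_mul_cancel_left _ _ hu]
  rw [← expectedTDUpdate_eq h, hinv, Matrix.toEuclideanCLM_toLp, inner_toLp, mspbe]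

/-- Existence of the unique minimizer `θs` of the regularized objective, with its optimality
condition, and the coercivity constants of `Aᵀ C⁻¹ A`, `C` and `Aᵀ A` for `M = (A, C, d)`. -/
theorem exists_regTDSolution (h : Integrable (fun ω => sampleCoeff γ (X ω)) μ) {η : ℝ}
    (hη : 0 < η) (hA : IsUnit (tdMatrix μ γ X)) (hC : IsUnit (featureCov μ X))
    {M : Coeff (EuclideanSpace ℝ (Fin k))} (hM : M = ∫ ω, sampleCoeff γ (X ω) ∂μ) :
    IsUnit M.2.1 ∧
    (∃ m : ℝ, 0 < m ∧ ∀ v, m * ‖v‖ ^ 2 ≤ inner ℝ v (adjoint M.1 (Ring.inverse M.2.1 (M.1 v)))) ∧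
    (∃ c : ℝ, 0 < c ∧ ∀ v, c * ‖v‖ ^ 2 ≤ inner ℝ v (M.2.1 v)) ∧
    (∃ m : ℝ, 0 < m ∧ ∀ v, m * ‖v‖ ^ 2 ≤ ‖M.1 v‖ ^ 2) ∧
    ∃ θs : EuclideanSpace ℝ (Fin k),
      IsL1Subgradient η θs (adjoint M.1 (Ring.inverse M.2.1 (M.2.2 - M.1 θs))) ∧
      IsRegTDSolution μ γ η X (WithLp.ofLp θs) := by
  have hCu : IsUnit M.2.1 := by
    rw [hM, meanCoeff_cov h]; exact hC.map _
  have hAu : IsUnit M.1 := by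
    rw [hM, meanCoeff_td h]; exact hA.map _
  have hpos : ∀ v, v ≠ 0 → 0 < inner ℝ v (M.2.1 v) := by
    subst hM; exact meanCoeff_cov_pos h hCu
  have hsymm : ∀ u v, inner ℝ u (M.2.1 v) = inner ℝ (M.2.1 u) v := by
    intro u v
    subst hM
    rw [real_inner_comm v, (inner_meanCoeff_cov h u v).2, (inner_meanCoeff_cov h v u).2]
    simp_rw [mul_comm]
  set C := M.2.1 with hCdef
  set A := M.1 with hAdef
  set Ci := Ring.inverse C with hCi
  have hCCi : ∀ v, C (Ci v) = v := fun v =>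
    congrArg (fun T : EuclideanSpace ℝ (Fin k) →L[ℝ] EuclideanSpace ℝ (Fin k) => T v)
      (Ring.mul_inverse_cancel _ hCu)
  have hAinj : ∀ v, A v = 0 → v = 0 := fun v hv => by
    have h1 : Ring.inverse A (A v) = v :=
      congrArg (fun T : EuclideanSpace ℝ (Fin k) →L[ℝ] EuclideanSpace ℝ (Fin k) => T v)
        (Ring.inverse_mul_cancel _ hAu)
    rw [← h1, hv, map_zero]
  have hCisymm : ∀ u v, inner ℝ u (Ci v) = inner ℝ (Ci u) v := fun u v => by
    conv_lhs => rw [← hCCi u]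
    rw [← hsymm, hCCi]
  have hCipos : ∀ v, v ≠ 0 → 0 < inner ℝ v (Ci v) := fun v hv => by
    have h1 := hpos (Ci v) (fun h0 => hv (by rw [← hCCi v, h0, map_zero]))
    rwa [hCCi, real_inner_comm] at h1
  obtain ⟨c, hc0, hc⟩ := exists_coercive_of_pos C hpos
  obtain ⟨m, hm0, hm⟩ := exists_coercive_of_pos (adjoint A ∘L Ci ∘L A) fun v hv => by
    simp only [ContinuousLinearMap.comp_apply]
    rw [ContinuousLinearMap.adjoint_inner_right]
    exact hCipos _ fun h0 => hv (hAinj v h0)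
  obtain ⟨m', hm'0, hm'⟩ := exists_coercive_of_pos (adjoint A ∘L A) fun v hv => by
    simp only [ContinuousLinearMap.comp_apply]
    rw [ContinuousLinearMap.adjoint_inner_right]
    exact real_inner_self_pos.2 fun h0 => hv (hAinj v h0)
  simp only [ContinuousLinearMap.comp_apply] at hm hm'
  obtain ⟨θs, hθs⟩ := exists_regularized_solution hη.le (adjoint A ∘L Ci ∘L A)
    (adjoint A (Ci M.2.2)) hm0 hm
  have hsub : adjoint A (Ci M.2.2) - (adjoint A ∘L Ci ∘L A) θs = adjoint A (Ci (M.2.2 - A θs)) := by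
    simp [map_sub]
  rw [hsub] at hθs
  refine ⟨hCu, ⟨m, hm0, hm⟩, ⟨c, hc0, hc⟩, ⟨m', hm'0, fun v => ?_⟩, θs, hθs, fun θ' hne => ?_⟩
  · have := hm' v
    rwa [ContinuousLinearMap.adjoint_inner_right, real_inner_self_eq_norm_sq] at this
  -- expand the objective around the solution
  set θ : EuclideanSpace ℝ (Fin k) := WithLp.toLp 2 θ' with hθ
  set s := adjoint A (Ci (M.2.2 - A θs)) with hs
  have hΔ : θ - θs ≠ 0 := fun h0 => hne (by rw [← sub_eq_zero.1 h0])
  have hJ : mspbe μ γ X θ' = mspbe μ γ X (WithLp.ofLp θs) - inner ℝ (θ - θs) s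
      + 1 / 2 * inner ℝ (A (θ - θs)) (Ci (A (θ - θs))) := by
    rw [mspbe_eq h hC, mspbe_eq h hC, ← hM, ← hθ, WithLp.toLp_ofLp, hs,
      ContinuousLinearMap.adjoint_inner_right, ← hAdef, ← hCdef, ← hCi]
    have e1 : M.2.2 - A θ = (M.2.2 - A θs) - A (θ - θs) := by rw [map_sub]; abel
    rw [e1]
    generalize M.2.2 - A θs = r
    generalize A (θ - θs) = d
    rw [map_sub, inner_sub_left, inner_sub_right, inner_sub_right, hCisymm r d,
      real_inner_comm d (Ci r)]
    ring
  have hQ : 0 < inner ℝ (A (θ - θs)) (Ci (A (θ - θs))) :=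
    hCipos _ fun h0 => hΔ (hAinj _ h0)
  have hl1 : inner ℝ (θ - θs) s ≤ η * (∑ i, |θ' i|) - η * ∑ i, |θs i| := by
    rw [EuclideanSpace.inner_eq_star_dotProduct, star_trivial, dotProduct, Finset.mul_sum,
      Finset.mul_sum, ← Finset.sum_sub_distrib]
    refine Finset.sum_le_sum fun i _ => ?_
    obtain ⟨h1, h2⟩ := hθs i
    have h3 : s i * θ' i ≤ η * |θ' i| :=
      (le_abs_self _).trans (by rw [abs_mul]; exact mul_le_mul_of_nonneg_right h1 (abs_nonneg _))
    have h4 : (θ - θs) i = θ' i - θs i := rfl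
    rw [h4]
    linarith
  rw [regMSPBE, regMSPBE, hJ]
  linarith

end Problem

/-! ### Truncation -/

section Truncation

/-- Means truncated along increasing sets have bounded variation: the increments are integrals
over disjoint sets. -/
theorem summable_norm_setIntegral_sub {𝓧 F : Type*} [MeasurableSpace 𝓧] {P : Measure 𝓧}
    [NormedAddCommGroup F] [NormedSpace ℝ F] {f : 𝓧 → F} (hf : Integrable f P) {s : ℕ → Set 𝓧}
    (hs : ∀ t, MeasurableSet (s t)) (hmono : Monotone s) :
    Summable fun t => ‖(∫ x in s (t + 1), f x ∂P) - ∫ x in s t, f x ∂P‖ := by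
  have hle : ∀ t, ‖(∫ x in s (t + 1), f x ∂P) - ∫ x in s t, f x ∂P‖
      ≤ (∫ x in s (t + 1), ‖f x‖ ∂P) - ∫ x in s t, ‖f x‖ ∂P := fun t => by
    rw [← setIntegral_sdiff (hs t) hf.integrableOn (hmono t.le_succ),
      ← setIntegral_sdiff (hs t) hf.norm.integrableOn (hmono t.le_succ)]
    exact norm_integral_le_integral_norm _
  refine summable_of_sum_range_le (c := ∫ x, ‖f x‖ ∂P) (fun t => norm_nonneg _) fun n => ?_
  refine (Finset.sum_le_sum fun t _ => hle t).trans ?_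
  rw [Finset.sum_range_sub (fun t => ∫ x in s t, ‖f x‖ ∂P)]
  have h1 : ∫ x in s n, ‖f x‖ ∂P ≤ ∫ x, ‖f x‖ ∂P :=
    setIntegral_le_integral hf.norm (ae_of_all _ fun x => norm_nonneg _)
  have h2 : 0 ≤ ∫ x in s 0, ‖f x‖ ∂P := integral_nonneg fun x => norm_nonneg _
  linarith

/-- The estimate behind the strong law of large numbers: for integrable `Y` the second moments of
the truncations at level `t + N + 1` are summable against `(t + 1)⁻²`. -/
theorem summable_truncated_second_moment {𝓧 : Type*} [MeasurableSpace 𝓧] {P : Measure 𝓧}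
    [IsProbabilityMeasure P] {Y : 𝓧 → ℝ} (hYm : Measurable Y) (hY : Integrable Y P)
    (hY0 : ∀ x, 0 ≤ Y x) (N : ℕ) :
    Summable fun t : ℕ => (((t : ℝ) + 1) ^ 2)⁻¹ * ∫ x in {x | Y x ≤ t + N + 1}, Y x ^ 2 ∂P := by
  have hs : Summable fun j : ℕ => ((j : ℝ) ^ 2)⁻¹ * ∫ x, truncation Y j x ^ 2 ∂P := by
    let _ : MeasureSpace 𝓧 := ⟨P⟩
    have : IsProbabilityMeasure (ℙ : Measure 𝓧) := ‹IsProbabilityMeasure P›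
    exact summable_of_sum_range_le
      (fun j => mul_nonneg (by positivity) (integral_nonneg fun x => sq_nonneg _))
      (fun K => sum_variance_truncation_le (X := Y) hY hY0 K)
  refine Summable.of_nonneg_of_le
    (fun t => mul_nonneg (by positivity) (integral_nonneg fun x => sq_nonneg _)) (fun t => ?_)
    (((summable_nat_add_iff (N + 1)).2 hs).mul_left (((N : ℝ) + 1) ^ 2))
  have hset : MeasurableSet {x | Y x ≤ t + N + 1} := measurableSet_le hYm measurable_const
  have hint : ∫ x in {x | Y x ≤ t + N + 1}, Y x ^ 2 ∂P
      = ∫ x, truncation Y ((t + (N + 1) : ℕ) : ℝ) x ^ 2 ∂P := by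
    rw [← integral_indicator hset]
    refine integral_congr_ae (ae_of_all _ fun x => ?_)
    have hpos : (0 : ℝ) < (t + (N + 1) : ℕ) := by positivity
    have hY0x := hY0 x
    simp only [truncation, Function.comp_apply, Set.indicator_apply, Set.mem_ofPred_eq, Set.mem_Ioc,
      id]
    have hiff : (-((t + (N + 1) : ℕ) : ℝ) < Y x ∧ Y x ≤ ((t + (N + 1) : ℕ) : ℝ))
        ↔ Y x ≤ t + N + 1 := by
      push_cast at hpos ⊢
      constructor
      · rintro ⟨_, h⟩; linarith
      · intro h; exact ⟨by linarith, by linarith⟩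
    by_cases h : Y x ≤ t + N + 1
    · rw [if_pos h, if_pos (hiff.2 h)]
    · rw [if_neg h, if_neg fun h' => h (hiff.1 h')]; simp
  rw [hint, ← mul_assoc]
  refine mul_le_mul_of_nonneg_right ?_ (integral_nonneg fun x => sq_nonneg _)
  -- the weights differ by a shift by `N`, which costs a factor `(N + 1) ^ 2`
  push_cast
  rw [← div_eq_mul_inv, inv_eq_one_div, div_le_div_iff₀ (by positivity) (by positivity), one_mul,
    ← mul_pow]
  refine pow_le_pow_left₀ (by positivity) ?_ 2
  nlinarith [show (0 : ℝ) ≤ (N : ℝ) * t by positivity]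

/-- Identically distributed samples with integrable size grow at most linearly, with slope one
(Borel–Cantelli). -/
theorem ae_exists_linear_bound {Ω 𝓧 : Type*} [MeasurableSpace Ω] [MeasurableSpace 𝓧]
    {μ : Measure Ω} {P : Measure 𝓧} [IsProbabilityMeasure P] {Y : 𝓧 → ℝ} (hYm : Measurable Y)
    (hY : Integrable Y P) (hY0 : ∀ x, 0 ≤ Y x) {X : ℕ → Ω → 𝓧} (hX : ∀ t, Measurable (X t))
    (hlaw : ∀ t, μ.map (X t) = P) :
    ∀ᵐ ω ∂μ, ∃ N : ℕ, ∀ t : ℕ, Y (X t ω) ≤ t + N + 1 := by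
  have hlt : (∑' t : ℕ, P {x | Y x ∈ Set.Ioi (t : ℝ)}) < ⊤ := by
    let _ : MeasureSpace 𝓧 := ⟨P⟩
    have : IsProbabilityMeasure (ℙ : Measure 𝓧) := ‹IsProbabilityMeasure P›
    exact tsum_prob_mem_Ioi_lt_top (X := Y) hY hY0
  have hlt' : (∑' t : ℕ, μ {ω | Y (X t ω) ∈ Set.Ioi (t : ℝ)}) ≠ ⊤ := by
    refine ne_of_eq_of_ne (tsum_congr fun t => ?_) hlt.ne
    rw [← hlaw t]
    exact (Measure.map_apply (hX t) (hYm measurableSet_Ioi)).symm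
  filter_upwards [ae_eventually_notMem hlt'] with ω hω
  obtain ⟨T, hT⟩ := eventually_atTop.1 hω
  obtain ⟨N, hN⟩ := exists_nat_ge (∑ t ∈ Finset.range T, Y (X t ω))
  refine ⟨N, fun t => ?_⟩
  have ht0 : (0 : ℝ) ≤ t := Nat.cast_nonneg t
  have hN0 : (0 : ℝ) ≤ N := Nat.cast_nonneg N
  rcases lt_or_ge t T with h | h
  · have := Finset.single_le_sum (f := fun t => Y (X t ω)) (fun i _ => hY0 _)
      (Finset.mem_range.2 h)
    linarith
  · have := hT t h
    simp only [Set.mem_Ioi, not_lt] at this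
    linarith

section Indicator

variable {𝓧 F : Type*} [Zero 𝓧] [NormedAddCommGroup F] {s : Set 𝓧} {ξ : 𝓧 → F}

theorem comp_indicator_id (h0 : ξ 0 = 0) :
    (fun x => ξ (s.indicator id x)) = s.indicator ξ := by
  funext x
  by_cases hx : x ∈ s <;> simp [hx, h0]

variable [MeasurableSpace 𝓧] {P : Measure 𝓧}

theorem memLp_map_indicator_id (hs : MeasurableSet s) (h0 : ξ 0 = 0) {p : ENNReal}
    (hξ : AEStronglyMeasurable ξ (P.map (s.indicator id))) (h : MemLp ξ p (P.restrict s)) :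
    MemLp ξ p (P.map (s.indicator id)) := by
  rw [memLp_map_measure_iff hξ (measurable_id.indicator hs).aemeasurable]
  have e : ξ ∘ s.indicator id = s.indicator ξ := comp_indicator_id h0
  rw [e]
  exact (memLp_indicator_iff_restrict hs).2 h

theorem integral_map_indicator_id [NormedSpace ℝ F] (hs : MeasurableSet s) (h0 : ξ 0 = 0)
    (hξ : AEStronglyMeasurable ξ (P.map (s.indicator id))) :
    ∫ x, ξ x ∂(P.map (s.indicator id)) = ∫ x in s, ξ x ∂P := by
  rw [integral_map (measurable_id.indicator hs).aemeasurable hξ, comp_indicator_id h0,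
    integral_indicator hs]

end Indicator

variable {Ω : Type*} {m0 : MeasurableSpace Ω} {k : ℕ} {μ : Measure Ω} [IsProbabilityMeasure μ]
  {P : Measure (Sample k)} {X : ℕ → Ω → Sample k} {γ : ℝ}

open ContinuousLinearMap (adjoint)

/-- Convergence of the iterates along the samples that are replaced by `0` outside `s t`. A zero
sample has zero coefficients. -/
theorem ae_tendsto_truncated (hX : ∀ t, Measurable (X t)) (hind : iIndepFun X μ)
    (hlaw : ∀ t, μ.map (X t) = P) {s : ℕ → Set (Sample k)} (hs : ∀ t, MeasurableSet (s t))
    (hmono : Monotone s) (hunion : ⋃ t, s t = Set.univ)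
    (hint : Integrable (sampleCoeff γ : Sample k → _) P)
    (hL2 : ∀ t, MemLp (sampleCoeff γ : Sample k → _) 2 (P.restrict (s t)))
    {α β : ℕ → ℝ} (hα : ∀ t, 0 < α t) (hβ : ∀ t, 0 < β t) (hαs : ¬ Summable α)
    (hsum : Summable fun t => β t ^ 2 * (∫ x in s t, ‖sampleCoeff γ x‖ ^ 2 ∂P + 1))
    {η : ℝ} (hη : 0 ≤ η) {M : Coeff (EuclideanSpace ℝ (Fin k))}
    (hM : M = ∫ x, sampleCoeff γ x ∂P) (hunit : IsUnit M.2.1)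
    {m c m' : ℝ} (hm : 0 < m) (hc : 0 < c) (hm' : 0 < m')
    (hcoer : ∀ v, m * ‖v‖ ^ 2 ≤ inner ℝ v (adjoint M.1 (Ring.inverse M.2.1 (M.1 v))))
    (hcov : ∀ v, c * ‖v‖ ^ 2 ≤ inner ℝ v (M.2.1 v))
    (htd : ∀ v, m' * ‖v‖ ^ 2 ≤ ‖M.1 v‖ ^ 2) {θs : EuclideanSpace ℝ (Fin k)}
    (hθs : IsL1Subgradient η θs (adjoint M.1 (Ring.inverse M.2.1 (M.2.2 - M.1 θs))))
    {grad : (Fin k → ℝ) → (Fin k → ℝ) → Sample k → (Fin k → ℝ)} {j : ℝ} (hj : |j| ≤ 1)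
    (hgrad : ∀ z x, gradient j z (sampleCoeff γ x)
      = WithLp.toLp 2 (grad (WithLp.ofLp z.1) (WithLp.ofLp z.2) x))
    (hmode : TwoTimeScale α β ∨ (OneTimeScale α β ∧ j = 0)) (θ₀ w₀ : Fin k → ℝ) :
    ∀ᵐ ω ∂μ, Tendsto (fun t => (iteratePair grad γ η α β θ₀ w₀
      (fun t => (s t).indicator id (X t ω)) t).1) atTop (𝓝 θs) := by
  set f : ℕ → Sample k → Sample k := fun t => (s t).indicator id with hf
  have hfm : ∀ t, Measurable (f t) := fun t => measurable_id.indicator (hs t)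
  have hξc := continuous_sampleCoeff (k := k) γ
  have hmap : ∀ t, μ.map (fun ω => f t (X t ω)) = P.map (f t) := fun t => by
    rw [← hlaw t, Measure.map_map (hfm t) (hX t)]; rfl
  have hmean : ∀ t, ∫ x, sampleCoeff γ x ∂(μ.map fun ω => f t (X t ω))
      = ∫ x in s t, sampleCoeff γ x ∂P := fun t => by
    rw [hmap]
    exact integral_map_indicator_id (hs t) (sampleCoeff_zero γ) hξc.aestronglyMeasurable
  have hscheme : IsScheme μ (fun t ω => f t (X t ω)) (sampleCoeff γ)
      (fun t => shrink (α t * η)) j α β θs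
      (adjoint M.1 (Ring.inverse M.2.1 (M.2.2 - M.1 θs))) (√k * η) := by
    refine ⟨fun t => (hfm t).comp (hX t), hind.comp f hfm, fun t => ?_,
      fun t => measurable_saStep hα hη γ j β t, hj, fun t u => ?_, hθs.norm_le hη, hα, hβ, hαs, ?_⟩
    · rw [hmap]
      exact memLp_map_indicator_id (hs t) (sampleCoeff_zero γ) hξc.aestronglyMeasurable (hL2 t)
    · obtain ⟨r, hr, hr'⟩ := exists_shrink_eq (hα t) hη u
      exact ⟨r, hr, hr'.norm_le hη, hr'.inner_nonneg hθs⟩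
    · refine hsum.congr fun t => ?_
      have e := integral_map_indicator_id (P := P) (ξ := fun x : Sample k => ‖sampleCoeff γ x‖ ^ 2)
        (hs t) (by simp [sampleCoeff_zero]) (hξc.norm.pow 2).aestronglyMeasurable
      rw [hmap, e]
  have hMt : Tendsto (fun t => ∫ x, sampleCoeff γ x ∂(μ.map fun ω => f t (X t ω))) atTop
      (𝓝 M) := by
    simp_rw [hmean]
    have := tendsto_setIntegral_of_monotone (f := sampleCoeff γ) (μ := P) hs hmono
      hint.integrableOn
    rwa [hunion, Measure.restrict_univ, ← hM] at this
  have hMs : Summable fun t => ‖(∫ x, sampleCoeff γ x ∂(μ.map fun ω => f (t + 1) (X (t + 1) ω)))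
      - ∫ x, sampleCoeff γ x ∂(μ.map fun ω => f t (X t ω))‖ := by
    simp_rw [hmean]
    exact summable_norm_setIntegral_sub hint hs hmono
  have hZ0 : ∀ ω, iteratePair grad γ η α β θ₀ w₀ (fun t => f t (X t ω)) 0
      = (WithLp.toLp 2 θ₀, WithLp.toLp 2 w₀) := fun ω => rfl
  have hZ : ∀ t ω, iteratePair grad γ η α β θ₀ w₀ (fun t => f t (X t ω)) (t + 1)
      = saStep (fun t => shrink (α t * η)) (sampleCoeff γ) j α β t
        (iteratePair grad γ η α β θ₀ w₀ (fun t => f t (X t ω)) t) (f t (X t ω)) := fun t ω =>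
    iteratePair_succ hgrad η α β θ₀ w₀ _ t
  rcases hmode with h2 | ⟨h1, rfl⟩
  · exact hscheme.tendsto_of_twoTimeScale h2 hMt hMs hunit rfl hm hc hcoer hcov
      (Z := fun t ω => iteratePair grad γ η α β θ₀ w₀ (fun t => f t (X t ω)) t) hZ0 hZ
  · refine hscheme.tendsto_of_oneTimeScale h1 hMt
      (ws := Ring.inverse M.2.1 (M.2.2 - M.1 θs)) ?_ rfl hm' hc htd hcov
      (Z := fun t ω => iteratePair grad γ η α β θ₀ w₀ (fun t => f t (X t ω)) t) hZ0 hZ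
    exact congrArg (fun T : EuclideanSpace ℝ (Fin k) →L[ℝ] EuclideanSpace ℝ (Fin k) =>
      T (M.2.2 - M.1 θs)) (Ring.mul_inverse_cancel _ hunit)

end Truncation

/-! ### Moments of a sample -/

section Moments

variable {Ω : Type*} {m0 : MeasurableSpace Ω} {k : ℕ} {μ : Measure Ω} {γ : ℝ}

/-- The squared size `‖φ‖² + r² + ‖φ'‖²` of a sample in Euclidean norms, which decides on
truncation. -/
noncomputable def sampleSize (x : Sample k) : ℝ :=
  ‖(WithLp.toLp 2 x.1 : EuclideanSpace ℝ (Fin k))‖ ^ 2 + x.2.1 ^ 2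
    + ‖(WithLp.toLp 2 x.2.2 : EuclideanSpace ℝ (Fin k))‖ ^ 2

theorem sampleSize_nonneg (x : Sample k) : 0 ≤ sampleSize x := by
  unfold sampleSize; positivity

theorem continuous_sampleSize : Continuous (sampleSize : Sample k → ℝ) := by
  have hL : Continuous fun v : Fin k → ℝ => (WithLp.toLp 2 v : EuclideanSpace ℝ (Fin k)) :=
    PiLp.continuous_toLp 2 _
  have h1 := (hL.comp (continuous_fst (X := Fin k → ℝ) (Y := ℝ × (Fin k → ℝ)))).norm.pow 2
  have h2 := (hL.comp (continuous_snd.comp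
    (continuous_snd (X := Fin k → ℝ) (Y := ℝ × (Fin k → ℝ))))).norm.pow 2
  exact (h1.add (by fun_prop : Continuous fun x : Sample k => x.2.1 ^ 2)).add h2

theorem norm_sampleCoeff_le_sampleSize (hγ : γ ∈ Set.Icc (0 : ℝ) 1) (x : Sample k) :
    ‖sampleCoeff γ x‖ ≤ 2 * sampleSize x := by
  refine (norm_sampleCoeff_le γ x).trans ?_
  rw [sampleSize, ← sq_abs x.2.1, abs_of_nonneg hγ.1]
  set a := ‖(WithLp.toLp 2 x.1 : EuclideanSpace ℝ (Fin k))‖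
  set b := ‖(WithLp.toLp 2 x.2.2 : EuclideanSpace ℝ (Fin k))‖
  have ha : 0 ≤ a := norm_nonneg _
  have hb : 0 ≤ b := norm_nonneg _
  have h1 : γ * (a * b) ≤ a * b := mul_le_of_le_one_left (by positivity) hγ.2
  nlinarith [sq_nonneg (a - b), sq_nonneg (|x.2.1| - a), sq_nonneg b, sq_nonneg |x.2.1|]

theorem integrable_sampleSize {X : Ω → Sample k} (hX : AEMeasurable X μ)
    (h1 : eLpNorm (fun ω => (X ω).1) 2 μ < ⊤) (h2 : eLpNorm (fun ω => (X ω).2.1) 2 μ < ⊤)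
    (h3 : eLpNorm (fun ω => (X ω).2.2) 2 μ < ⊤) :
    Integrable (fun ω => sampleSize (X ω)) μ := by
  have hvec : ∀ f : Ω → Fin k → ℝ, AEMeasurable f μ → eLpNorm f 2 μ < ⊤ →
      Integrable (fun ω => ‖(WithLp.toLp 2 (f ω) : EuclideanSpace ℝ (Fin k))‖ ^ 2) μ := by
    intro f hf hfm
    have hL : MemLp f 2 μ := ⟨hf.aestronglyMeasurable, hfm⟩
    simp_rw [EuclideanSpace.real_norm_sq_eq]
    refine integrable_finsetSum _ fun i _ => ?_
    have hi : MemLp (fun ω => f ω i) 2 μ :=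
      hL.mono ((measurable_pi_apply i).comp_aemeasurable hf).aestronglyMeasurable
        (ae_of_all _ fun ω => norm_le_pi_norm (f ω) i)
    exact hi.integrable_sq
  have hr : MemLp (fun ω => (X ω).2.1) 2 μ := ⟨hX.snd.fst.aestronglyMeasurable, h2⟩
  exact ((hvec _ hX.fst h1).add hr.integrable_sq).add (hvec _ hX.snd.snd h3)

theorem memLp_sampleCoeff {X : Ω → Sample k} (hX : AEMeasurable X μ) (hγ : γ ∈ Set.Icc (0 : ℝ) 1)
    (h : ProductsSquareIntegrable μ X) : MemLp (fun ω => sampleCoeff γ (X ω)) 2 μ := by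
  obtain ⟨h1, h2, h3⟩ := h
  have hmeas : AEStronglyMeasurable (fun ω => sampleCoeff γ (X ω)) μ :=
    ((continuous_sampleCoeff γ).measurable.comp_aemeasurable hX).aestronglyMeasurable
  rw [memLp_two_iff_integrable_sq_norm hmeas]
  have hprod : ∀ u v : Fin k → ℝ, (∑ i, ∑ j, (u i * v j) ^ 2)
      = (‖(WithLp.toLp 2 u : EuclideanSpace ℝ (Fin k))‖
        * ‖(WithLp.toLp 2 v : EuclideanSpace ℝ (Fin k))‖) ^ 2 := by
    intro u v
    rw [mul_pow, EuclideanSpace.real_norm_sq_eq, EuclideanSpace.real_norm_sq_eq,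
      Finset.sum_mul_sum]
    simp_rw [mul_pow]
  have i1 : Integrable (fun ω => ∑ i, ∑ j, ((X ω).1 i * (X ω).1 j) ^ 2) μ :=
    integrable_finsetSum _ fun i _ => integrable_finsetSum _ fun j _ => (h1 i j).integrable_sq
  have i2 : Integrable (fun ω => ∑ i, ∑ j, ((X ω).1 i * (X ω).2.2 j) ^ 2) μ :=
    integrable_finsetSum _ fun i _ => integrable_finsetSum _ fun j _ => (h2 i j).integrable_sq
  have i3 : Integrable (fun ω => ∑ i, ((X ω).2.1 * (X ω).1 i) ^ 2) μ :=
    integrable_finsetSum _ fun i _ => (h3 i).integrable_sq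
  refine (((i1.add i2).add i3).const_mul 3).mono' (hmeas.norm.pow 2) (ae_of_all _ fun ω => ?_)
  rw [Real.norm_of_nonneg (sq_nonneg _)]
  have hb := norm_sampleCoeff_le γ (X ω)
  have e3 : ∑ i, ((X ω).2.1 * (X ω).1 i) ^ 2
      = (|(X ω).2.1| * ‖(WithLp.toLp 2 (X ω).1 : EuclideanSpace ℝ (Fin k))‖) ^ 2 := by
    rw [mul_pow, EuclideanSpace.real_norm_sq_eq, sq_abs, Finset.mul_sum]
    simp_rw [mul_pow]
  simp only [Pi.add_apply]
  rw [hprod, hprod, e3]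
  have hn := norm_nonneg (sampleCoeff γ (X ω))
  set n := ‖sampleCoeff γ (X ω)‖
  set a := ‖(WithLp.toLp 2 (X ω).1 : EuclideanSpace ℝ (Fin k))‖
  set b := ‖(WithLp.toLp 2 (X ω).2.2 : EuclideanSpace ℝ (Fin k))‖
  have hab : |γ| * (a * b) ≤ a * b := by
    rw [abs_of_nonneg hγ.1]; exact mul_le_of_le_one_left (by positivity) hγ.2
  have hle : n ≤ a * a + a * b + |(X ω).2.1| * a := by linarith
  have hsq := pow_le_pow_left₀ hn hle 2
  linarith [sq_nonneg (a * a - a * b), sq_nonneg (a * a - |(X ω).2.1| * a),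
    sq_nonneg (a * b - |(X ω).2.1| * a)]

end Moments

/-! ### Convergence under the step size conditions -/

section Convergence

variable {Ω : Type*} {m0 : MeasurableSpace Ω} {k : ℕ} {μ : Measure Ω} [IsProbabilityMeasure μ]
  {X : ℕ → Ω → Sample k} {γ : ℝ}

open ContinuousLinearMap (adjoint)

/-- Convergence of both algorithms for admissible step sizes and measurable samples; `j` selects
the algorithm. -/
theorem ae_tendsto_iterates (hX : ∀ t, Measurable (X t)) (hind : iIndepFun X μ)
    (hident : ∀ t, IdentDistrib (X t) (X 0) μ μ) (hγ : γ ∈ Set.Icc (0 : ℝ) 1)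
    (hsize : Integrable (fun ω => sampleSize (X 0 ω)) μ)
    {α β : ℕ → ℝ} (hαβ : AdmissibleStepSizes μ (X 0) α β)
    {η : ℝ} (hη : 0 ≤ η) {M : Coeff (EuclideanSpace ℝ (Fin k))}
    (hM : M = ∫ ω, sampleCoeff γ (X 0 ω) ∂μ) (hunit : IsUnit M.2.1)
    {m c m' : ℝ} (hm : 0 < m) (hc : 0 < c) (hm' : 0 < m')
    (hcoer : ∀ v, m * ‖v‖ ^ 2 ≤ inner ℝ v (adjoint M.1 (Ring.inverse M.2.1 (M.1 v))))
    (hcov : ∀ v, c * ‖v‖ ^ 2 ≤ inner ℝ v (M.2.1 v))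
    (htd : ∀ v, m' * ‖v‖ ^ 2 ≤ ‖M.1 v‖ ^ 2) {θs : EuclideanSpace ℝ (Fin k)}
    (hθs : IsL1Subgradient η θs (adjoint M.1 (Ring.inverse M.2.1 (M.2.2 - M.1 θs))))
    {grad : (Fin k → ℝ) → (Fin k → ℝ) → Sample k → (Fin k → ℝ)} {j : ℝ} (hj : |j| ≤ 1)
    (hgrad : ∀ z x, gradient j z (sampleCoeff γ x)
      = WithLp.toLp 2 (grad (WithLp.ofLp z.1) (WithLp.ofLp z.2) x))
    (hmode : TwoTimeScale α β ∨ (OneTimeScale α β ∧ j = 0)) (θ₀ w₀ : Fin k → ℝ) :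
    ∀ᵐ ω ∂μ, Tendsto (fun t => (iterates grad γ η α β (fun t => X t ω) θ₀ w₀ t).1) atTop
      (𝓝 (WithLp.ofLp θs)) := by
  suffices h : ∀ᵐ ω ∂μ, Tendsto (fun t => (iteratePair grad γ η α β θ₀ w₀
      (fun t => X t ω) t).1) atTop (𝓝 θs) by
    filter_upwards [h] with ω hω
    exact ((PiLp.continuous_ofLp 2 _).tendsto θs).comp hω
  set P := μ.map (X 0) with hP
  have : IsProbabilityMeasure P := Measure.isProbabilityMeasure_map (hX 0).aemeasurable
  have hlaw : ∀ t, μ.map (X t) = P := fun t => (hident t).map_eq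
  have hξc := continuous_sampleCoeff (k := k) γ
  have hSm : Measurable (sampleSize : Sample k → ℝ) := continuous_sampleSize.measurable
  have hsizeP : Integrable (sampleSize : Sample k → ℝ) P :=
    (integrable_map_measure hSm.aestronglyMeasurable (hX 0).aemeasurable).2 hsize
  have hint : Integrable (sampleCoeff γ : Sample k → _) P :=
    (hsizeP.const_mul 2).mono' hξc.aestronglyMeasurable
      (ae_of_all _ fun x => norm_sampleCoeff_le_sampleSize hγ x)
  have hMP : M = ∫ x, sampleCoeff γ x ∂P := by
    rw [hM, hP, integral_map (hX 0).aemeasurable hξc.aestronglyMeasurable]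
  obtain ⟨hα, hβ, hαs, ⟨b, hb⟩ | ⟨hβs, hprod⟩⟩ := hαβ
  -- step sizes `O(1/t)`: truncate at level `t + N + 1`, for every `N` at once
  · set s : ℕ → ℕ → Set (Sample k) := fun N t => {x | sampleSize x ≤ t + N + 1} with hs
    have hsm : ∀ N t, MeasurableSet (s N t) := fun N t => measurableSet_le hSm measurable_const
    have hbound : ∀ N t, ∀ x ∈ s N t, ‖sampleCoeff γ x‖ ≤ 2 * (t + N + 1) := fun N t x hx =>
      (norm_sampleCoeff_le_sampleSize hγ x).trans (mul_le_mul_of_nonneg_left hx zero_le_two)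
    have hL2 : ∀ N t, MemLp (sampleCoeff γ : Sample k → _) 2 (P.restrict (s N t)) := fun N t =>
      MemLp.of_bound hξc.aestronglyMeasurable (2 * (t + N + 1))
        ((ae_restrict_iff' (hsm N t)).2 (ae_of_all _ (hbound N t)))
    have hL2S : ∀ N t, Integrable (fun x : Sample k => sampleSize x ^ 2) (P.restrict (s N t)) :=
      fun N t => (MemLp.of_bound (p := 2) hSm.aestronglyMeasurable ((t : ℝ) + N + 1)
        ((ae_restrict_iff' (hsm N t)).2 (ae_of_all _ fun x hx => by
          rw [Real.norm_of_nonneg (sampleSize_nonneg x)]; exact hx))).integrable_sq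
    have hsum : ∀ N, Summable fun t =>
        β t ^ 2 * (∫ x in s N t, ‖sampleCoeff γ x‖ ^ 2 ∂P + 1) := fun N => by
      have h1 := summable_truncated_second_moment hSm hsizeP sampleSize_nonneg N
      have h2 : Summable fun t : ℕ => (((t : ℝ) + 1) ^ 2)⁻¹ := by
        have := (summable_nat_add_iff 1).2 (Real.summable_nat_pow_inv.2 one_lt_two)
        simpa using this
      refine Summable.of_nonneg_of_le (fun t => mul_nonneg (sq_nonneg _)
        (add_nonneg (integral_nonneg fun x => sq_nonneg _) zero_le_one)) (fun t => ?_)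
        (((h1.mul_left 4).add h2).mul_left (b ^ 2))
      have h3 : ∫ x in s N t, ‖sampleCoeff γ x‖ ^ 2 ∂P
          ≤ 4 * ∫ x in s N t, sampleSize x ^ 2 ∂P := by
        rw [← integral_const_mul]
        refine integral_mono_of_nonneg (ae_of_all _ fun x => sq_nonneg _)
          ((hL2S N t).const_mul 4) (ae_of_all _ fun x => ?_)
        have := pow_le_pow_left₀ (norm_nonneg _) (norm_sampleCoeff_le_sampleSize hγ x) 2
        simp only
        linarith
      have h4 : β t ^ 2 ≤ b ^ 2 * (((t : ℝ) + 1) ^ 2)⁻¹ := by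
        rw [← div_eq_mul_inv, ← div_pow]
        exact pow_le_pow_left₀ (hβ t).le (hb t) 2
      have h5 : 0 ≤ ∫ x in s N t, ‖sampleCoeff γ x‖ ^ 2 ∂P :=
        integral_nonneg fun x => sq_nonneg _
      calc _ ≤ b ^ 2 * (((t : ℝ) + 1) ^ 2)⁻¹ * (4 * (∫ x in s N t, sampleSize x ^ 2 ∂P) + 1) :=
            mul_le_mul h4 (by linarith) (by linarith) (by positivity)
        _ = _ := by simp only [hs]; ring
    have hall : ∀ᵐ ω ∂μ, ∀ N, Tendsto (fun t => (iteratePair grad γ η α β θ₀ w₀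
        (fun t => (s N t).indicator id (X t ω)) t).1) atTop (𝓝 θs) := by
      refine ae_all_iff.2 fun N => ?_
      refine ae_tendsto_truncated hX hind hlaw (hsm N) (fun t t' htt x hx => ?_) ?_ hint (hL2 N)
        hα hβ hαs (hsum N) hη hMP hunit hm hc hm' hcoer hcov htd hθs hj hgrad hmode θ₀ w₀
      · have h1 : (t : ℝ) ≤ t' := Nat.cast_le.2 htt
        have h2 : sampleSize x ≤ t + N + 1 := hx
        exact h2.trans (by linarith)
      · refine Set.eq_univ_of_forall fun x => Set.mem_iUnion.2 ?_
        obtain ⟨n, hn⟩ := exists_nat_ge (sampleSize x)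
        exact ⟨n, hn.trans (by linarith [Nat.cast_nonneg (α := ℝ) N])⟩
    filter_upwards [hall, ae_exists_linear_bound hSm hsizeP sampleSize_nonneg hX hlaw]
      with ω hω ⟨N, hN⟩
    have hfix : (fun t => (s N t).indicator id (X t ω)) = fun t => X t ω :=
      funext fun t => Set.indicator_of_mem (show X t ω ∈ s N t from hN t) _
    simpa only [hfix] using hω N
  -- square integrable products: no truncation
  · have hL : MemLp (sampleCoeff γ : Sample k → _) 2 P :=
      (memLp_map_measure_iff hξc.aestronglyMeasurable (hX 0).aemeasurable).2
        (memLp_sampleCoeff (hX 0).aemeasurable hγ hprod)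
    have := ae_tendsto_truncated hX hind hlaw (s := fun _ => Set.univ)
      (fun _ => MeasurableSet.univ) (fun _ _ _ => le_rfl) (Set.iUnion_const _) hint
      (fun _ => by rwa [Measure.restrict_univ]) hα hβ hαs (hβs.mul_right _) hη hMP hunit hm hc
      hm' hcoer hcov htd hθs hj hgrad hmode θ₀ w₀
    simpa only [Set.indicator_univ, id] using this

end Convergence

end GTDIST

theorem corollary2 {Ω : Type*} [MeasurableSpace Ω] (μ : Measure Ω) [IsProbabilityMeasure μ]
    (k : ℕ) (γ η : ℝ) (hγ : γ ∈ Set.Icc (0 : ℝ) 1) (hη : 0 < η)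
    (X : ℕ → Ω → GTDIST.Sample k)
    (hindep : iIndepFun X μ)
    (hident : ∀ t, IdentDistrib (X t) (X 0) μ μ)
    (hmom : GTDIST.UniformlyBoundedSecondMoments μ X)
    (hA : IsUnit (GTDIST.tdMatrix μ γ (X 0)))
    (hC : IsUnit (GTDIST.featureCov μ (X 0))) :
    ∃ θs : Fin k → ℝ, GTDIST.IsRegTDSolution μ γ η (X 0) θs ∧
      ∀ α β : ℕ → ℝ, GTDIST.AdmissibleStepSizes μ (X 0) α β →
        ∀ θ₀ w₀ : Fin k → ℝ,
          (GTDIST.TwoTimeScale α β ∨ GTDIST.OneTimeScale α β →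
            ∀ᵐ ω ∂μ, Tendsto (GTDIST.gtd2IST γ η α β (fun t => X t ω) θ₀ w₀) atTop (𝓝 θs)) ∧
          (GTDIST.TwoTimeScale α β →
            ∀ᵐ ω ∂μ, Tendsto (GTDIST.tdcIST γ η α β (fun t => X t ω) θ₀ w₀) atTop (𝓝 θs)) := by
  open GTDIST in
  have hXae : ∀ t, AEMeasurable (X t) μ := fun t => (hident t).aemeasurable_fst
  obtain ⟨B, hB⟩ := hmom
  have hsize : Integrable (fun ω => sampleSize (X 0 ω)) μ :=
    integrable_sampleSize (hXae 0) ((hB 0).1.trans_lt ENNReal.coe_lt_top)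
      ((hB 0).2.1.trans_lt ENNReal.coe_lt_top) ((hB 0).2.2.trans_lt ENNReal.coe_lt_top)
  have hint : Integrable (fun ω => sampleCoeff γ (X 0 ω)) μ :=
    (hsize.const_mul 2).mono'
      ((continuous_sampleCoeff γ).measurable.comp_aemeasurable (hXae 0)).aestronglyMeasurable
      (ae_of_all _ fun ω => norm_sampleCoeff_le_sampleSize hγ (X 0 ω))
  obtain ⟨hunit, ⟨m, hm, hcoer⟩, ⟨c, hc, hcov⟩, ⟨m', hm', htd⟩, θs, hθs, hsol⟩ :=
    exists_regTDSolution hint hη hA hC rfl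
  refine ⟨WithLp.ofLp θs, hsol, fun α β hαβ θ₀ w₀ => ?_⟩
  -- the samples are only almost everywhere measurable, so pass to measurable modifications
  set X' : ℕ → Ω → Sample k := fun t => (hXae t).mk (X t) with hX'
  have hXX' : ∀ t, X t =ᵐ[μ] X' t := fun t => (hXae t).ae_eq_mk
  have hX'm : ∀ t, Measurable (X' t) := fun t => (hXae t).measurable_mk
  have hX'i : iIndepFun X' μ := hindep.congr hXX'
  have hX'd : ∀ t, IdentDistrib (X' t) (X' 0) μ μ := fun t =>
    ((IdentDistrib.of_ae_eq (hXae t) (hXX' t)).symm.trans (hident t)).trans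
      (IdentDistrib.of_ae_eq (hXae 0) (hXX' 0))
  have hsize' : Integrable (fun ω => sampleSize (X' 0 ω)) μ :=
    hsize.congr ((hXX' 0).fun_comp sampleSize)
  have hM : ∫ ω, sampleCoeff γ (X 0 ω) ∂μ = ∫ ω, sampleCoeff γ (X' 0 ω) ∂μ :=
    integral_congr_ae ((hXX' 0).fun_comp (sampleCoeff γ))
  have hαβ' : AdmissibleStepSizes μ (X' 0) α β := by
    refine ⟨hαβ.1, hαβ.2.1, hαβ.2.2.1, hαβ.2.2.2.imp_right fun h => ⟨h.1, ?_, ?_, ?_⟩⟩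
    · exact fun i j => (h.2.1 i j).ae_eq ((hXX' 0).fun_comp fun x => x.1 i * x.1 j)
    · exact fun i j => (h.2.2.1 i j).ae_eq ((hXX' 0).fun_comp fun x => x.1 i * x.2.2 j)
    · exact fun i => (h.2.2.2 i).ae_eq ((hXX' 0).fun_comp fun x => x.2.1 * x.1 i)
  have hpath : ∀ᵐ ω ∂μ, (fun t => X' t ω) = fun t => X t ω := by
    filter_upwards [ae_all_iff.2 hXX'] with ω hω
    exact funext fun t => (hω t).symm
  have key := fun {grad : (Fin k → ℝ) → (Fin k → ℝ) → Sample k → (Fin k → ℝ)} {j : ℝ}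
      (hj : |j| ≤ 1) hgrad hmode =>
    ae_tendsto_iterates hX'm hX'i hX'd hγ hsize' hαβ' hη.le hM hunit hm hc hm' hcoer hcov htd hθs
      (grad := grad) (j := j) hj hgrad hmode θ₀ w₀
  refine ⟨fun h => ?_, fun h => ?_⟩
  · filter_upwards [hpath, key (by simp) (fun z x => gradient_zero_sampleCoeff γ x z)
      (h.imp_right fun h1 => ⟨h1, rfl⟩)] with ω hω hlim
    rwa [hω] at hlim
  · filter_upwards [hpath, key (by simp) (fun z x => gradient_one_sampleCoeff γ x z)
      (Or.inl h)] with ω hω hlim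
    rwa [hω] at hlim
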